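/- Let $\mu$ be a probability measure on $\mathbb C$ whose support consists of exactly $n$ distinct points $e^{i\lambda_1},\dots,e^{i\lambda_n}$ of the unit circle ($\lambda_j\in\mathbb R$), with $\mu(\{1\})=0$. Let $p(u)=\prod_{j=1}^n\frac{u-e^{i\lambda_j}}{1-e^{i\lambda_j}}$. For $0\le k\le n$ let $\psi_k$ be the polynomial of degree $k$ with $\psi_k(1)=1$ that is orthogonal to $1,\dots,u^{k-1}$ in $L^2(\mu)$, and let $[\psi_k]$ be its leading coefficient. For $0\le k\le n-1$ let the modified Verblunsky coefficient $\gamma_k\in\mathbb C\setminus\{1\}$ and $w_k,v_k\in\mathbb R$ be given by $$\frac{2\gamma_k}{1-\gamma_k}=w_k-iv_k=-\frac{2\psi_{k+1}(0)}{\overline{[\psi_k]}},$$ and let $x_0=0$, $y_0=1$, $x_{k+1}=x_k+v_ky_k$, $y_{k+1}=y_k(1+w_k)$. For $t\in[0,1]$ put $x(t)+iy(t)=x_{\lfloor nt\rfloor}+iy_{\lfloor nt\rfloor}$ and $$X=\begin{pmatrix}1&-x\\0&y\end{pmatrix},\quad Y=\frac{X}{\sqrt{\det X}},\quad R=\frac{X^tX}{2\det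 X},\quad J=\begin{pmatrix}0&-1\\1&0\end{pmatrix},\quad \mathfrak u_0=\begin{pmatrix}1\\0\end{pmatrix},\quad \mathfrak u_1=\begin{pmatrix}-x(1)\\-1\end{pmatrix}.$$ Let $L^2_R$ be the space of (complexified) functions $v$ on $(0,1]$ with $\int_0^1 v^*Rv\,dt<\infty$, and let $\tau v=R^{-1}Jv'$ be the Dirac operator on $L^2_R$ whose domain consists of the locally absolutely continuous $v:(0,1]\to\mathbb C^2$ with $v,\tau v\in L^2_R$, $\lim_{s\downarrow0}v(s)^tJ\mathfrak u_0=0$ and $v(1)^tJ\mathfrak u_1=0$. Let $\mathtt r\tau=(Y\tau Y^{-1})^{-1}$ on $L^2((0,1];\mathbb C^2)$. With $a=X\mathfrak u_0/\sqrt{\det X}$ and $c=X\mathfrak u_1/\sqrt{\det X}$, let $K(s,t)=\frac12a(s)c(t)^t\mathbf 1(s<t)+\frac12c(s)a(t)^t\mathbf 1(s\ge t)$ and $\mathfrak t=\int_0^1\operatorname{Tr}K(s,s)\,ds$. The secular function of $\tau$ is $$\zeta_\tau(z)=e^{-z\mathfrak t}\,{\det}_2(I-z\,\mathtt r\tau),\qquad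 {\det}_2(I-zA)=\prod_\nu(1-z\nu)e^{z\nu},$$ where the product runs over the eigenvalues $\nu$ of $A$ with algebraic multiplicity. All these objects are well defined: $\psi_k$ exists and is unique for $0\le k\le n$, the $\gamma_k$ exist, $y_k>0$ for $0\le k<n$, $y_n=0$, $\mathtt r\tau$ exists as a bounded operator, the integral $\mathfrak t$ converges absolutely, and the product defining ${\det}_2(I-z\,\mathtt r\tau)$ converges unconditionally for all $z\in\mathbb C$. For every $z\in\mathbb C$ there is a unique absolutely continuous $H(\cdot,z):[0,1]\to\mathbb C^2$ with $\tau H=zH$ almost everywhere and $H(0,z)=[1,0]^t$. Moreover: (i) For $0\le k\le n$ and $z\in\mathbb C$, $$\psi_k(e^{iz/n})=e^{izk/(2n)}\,[1,-(x_k+iy_k)]\,H(k/n,z);$$ in particular $p(e^{iz/n})=\psi_n(e^{iz/n})=e^{iz/2}\,[1,-x_n]\,H(1,z)$. (ii) $\zeta_\tau(z)=p(e^{iz/n})\,e^{-iz/2}$ for all $z\in\mathbb C$. (iii) The spectrum of $\tau$ is $\{n\lambda_k+2\pi nj:1\le k\le n,\ j\in\mathbb Z\}$, and it consists of eigenvalues.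 (iv) For all $z\in\mathbb C$, $$\zeta_\tau(z)=\prod_{j=1}^n\frac{\sin(\lambda_j/2-z/(2n))}{\sin(\lambda_j/2)}.$$ -/

import Mathlib

open MeasureTheory Filter Topology Set
open scoped Matrix Polynomial

noncomputable section

/-! ### Dirac operators on `(0, σ]` -/

/-- The data `Dir(X, u₀, u₁)` of a Dirac operator on `(0, σ]`: the path `x + i y`
and the two (real) boundary vectors. -/
structure DiracOp where
  σ : ℝ
  x : ℝ → ℝ
  y : ℝ → ℝ
  u0 : Fin 2 → ℝ
  u1 : Fin 2 → ℝ

namespace DiracOp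

/-- The matrix `J`. -/
def J : Matrix (Fin 2) (Fin 2) ℝ := !![0, -1; 1, 0]

/-- A real matrix acting on `ℂ²`. -/
def toC (A : Matrix (Fin 2) (Fin 2) ℝ) : Matrix (Fin 2) (Fin 2) ℂ :=
  A.map (fun r : ℝ => (r : ℂ))

/-- A real vector as an element of `ℂ²`. -/
def vecC (u : Fin 2 → ℝ) : Fin 2 → ℂ := fun i => (u i : ℂ)

variable (D : DiracOp)

def X (t : ℝ) : Matrix (Fin 2) (Fin 2) ℝ := !![1, -D.x t; 0, D.y t]

/-- `R = Xᵗ X / (2 det X)`. -/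
def R (t : ℝ) : Matrix (Fin 2) (Fin 2) ℝ :=
  (2 * (D.X t).det)⁻¹ • ((D.X t)ᵀ * D.X t)

/-- `Y = X / √(det X)`. -/
def Y (t : ℝ) : Matrix (Fin 2) (Fin 2) ℝ := (√(D.X t).det)⁻¹ • D.X t

/-- Lebesgue measure on `(0, σ]`. -/
def vol : Measure ℝ := volume.restrict (Ioc 0 D.σ)

/-- `τ u = R⁻¹ J u'`, for (complexified) functions `u : ℝ → ℂ²`; only the values of `u` on
`(0, σ]` matter for `τ u` on `(0, σ)`. -/
def tau (u : ℝ → Fin 2 → ℂ) (t : ℝ) : Fin 2 → ℂ :=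
  toC ((D.R t)⁻¹ * J) *ᵥ deriv u t

/-- The density `v* R v` of the squared norm of `L²_R`. -/
def density (v : ℝ → Fin 2 → ℂ) (t : ℝ) : ℝ :=
  (star (v t) ⬝ᵥ (toC (D.R t) *ᵥ v t)).re

/-- `v ∈ L²_R`. -/
def MemL2R (v : ℝ → Fin 2 → ℂ) : Prop :=
  AEStronglyMeasurable v D.vol ∧ Integrable (D.density v) D.vol

/-- `‖v‖²` in `L²_R`. -/
def normSqR (v : ℝ → Fin 2 → ℂ) : ℝ := ∫ t, D.density v t ∂D.vol

/-- The domain of `τ`. Absolute continuity on the half-open interval `(0, σ]` is absolute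
continuity on each `[ε, σ]`. -/
def MemDom (v : ℝ → Fin 2 → ℂ) : Prop :=
  D.MemL2R v ∧
  (∀ ε ∈ Ioc 0 D.σ, AbsolutelyContinuousOnInterval v ε D.σ) ∧
  D.MemL2R (D.tau v) ∧
  Tendsto (fun s => v s ⬝ᵥ vecC (J *ᵥ D.u0)) (𝓝[>] 0) (𝓝 0) ∧
  v D.σ ⬝ᵥ vecC (J *ᵥ D.u1) = 0

/-- `z` is in the resolvent set: `τ - z` is a bijection from the domain of `τ` onto `L²_R`
with bounded inverse. -/
def InResolventSet (z : ℂ) : Prop :=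
  (∀ v, D.MemDom v → (∀ᵐ t ∂D.vol, D.tau v t = z • v t) → ∀ t ∈ Ioc 0 D.σ, v t = 0) ∧
  ∃ C : ℝ, ∀ g, D.MemL2R g → ∃ v, D.MemDom v ∧
    (∀ᵐ t ∂D.vol, D.tau v t - z • v t = g t) ∧ D.normSqR v ≤ C * D.normSqR g

/-- The spectrum of `τ`, as an unbounded operator on the complexification of `L²_R`. -/
def spec : Set ℂ := {z | ¬ D.InResolventSet z}

/-- `z` is an eigenvalue of `τ`. -/
def IsEigenvalue (z : ℂ) : Prop :=
  ∃ v, D.MemDom v ∧ (∀ᵐ t ∂D.vol, D.tau v t = z • v t) ∧ ∃ t ∈ Ioc 0 D.σ, v t ≠ 0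

/-- The complex Hilbert space `L²((0, σ]; ℂ²)`. -/
abbrev L2 : Type := Lp (EuclideanSpace ℂ (Fin 2)) 2 D.vol

/-- `r = (Y τ Y⁻¹)⁻¹`: the graph of `r` is the graph of `Y τ Y⁻¹` (whose domain is
`Y dom τ`) with the two coordinates exchanged. -/
def IsInverse (r : D.L2 →L[ℂ] D.L2) : Prop :=
  ∀ f g : D.L2, r f = g ↔ ∃ v, D.MemDom v ∧
    (∀ᵐ t ∂D.vol, ∀ i, g t i = (toC (D.Y t) *ᵥ v t) i) ∧
    (∀ᵐ t ∂D.vol, ∀ i, f t i = (toC (D.Y t) *ᵥ D.tau v t) i)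

open Classical in
/-- The operator `r τ = (Y τ Y⁻¹)⁻¹` on `L²((0, σ]; ℂ²)` (zero if there is no such bounded
operator; there is at most one). -/
def res : D.L2 →L[ℂ] D.L2 :=
  if h : ∃ r : D.L2 →L[ℂ] D.L2, D.IsInverse r then h.choose else 0

/-- `a = X u₀ / √(det X)`. -/
def a (t : ℝ) : Fin 2 → ℝ := (√(D.X t).det)⁻¹ • (D.X t *ᵥ D.u0)

/-- `c = X u₁ / √(det X)`. -/
def c (t : ℝ) : Fin 2 → ℝ := (√(D.X t).det)⁻¹ • (D.X t *ᵥ D.u1)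

/-- The integral kernel of `r τ`. -/
def kernel (s t : ℝ) : Matrix (Fin 2) (Fin 2) ℝ :=
  if s < t then (1 / 2 : ℝ) • Matrix.vecMulVec (D.a s) (D.c t)
  else (1 / 2 : ℝ) • Matrix.vecMulVec (D.c s) (D.a t)

/-- The integral trace of `r τ`. -/
def intTrace : ℝ := ∫ s, (D.kernel s s).trace ∂D.vol

end DiracOp

/-- The factor of the eigenvalue `ν` of `A` in the regularized determinant `det₂(I - z A)`,
with algebraic multiplicity. It equals `1` if `ν = 0` or if `ν` is not an eigenvalue. -/
def detTwoFactor {E : Type*} [AddCommGroup E] [Module ℂ E] (A : Module.End ℂ E) (z ν : ℂ) : ℂ :=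
  ((1 - z * ν) * Complex.exp (z * ν)) ^ Module.finrank ℂ (A.maxGenEigenspace ν)

/-- `det₂(I - z A) = ∏ (1 - z ν) e^{z ν}` over the eigenvalues `ν` of `A`. -/
def detTwo {E : Type*} [AddCommGroup E] [Module ℂ E] (A : Module.End ℂ E) (z : ℂ) : ℂ :=
  ∏' ν : ℂ, detTwoFactor A z ν

namespace DiracOp

variable (D : DiracOp)

/-- `r τ` as a linear endomorphism. -/
def resEnd : Module.End ℂ D.L2 := (D.res : D.L2 →ₗ[ℂ] D.L2)

/-- The secular function `ζ_τ(z) = e^{-z 𝔱} det₂(I - z r τ)`, where `𝔱` is the integral trace. -/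
def secular (z : ℂ) : ℂ := Complex.exp (-z * (D.intTrace : ℂ)) * detTwo D.resEnd z

/-- All ingredients of the secular function exist: `τ` is invertible with bounded `r τ`, the
integral trace converges absolutely and so does the product that defines `det₂`. -/
def SecularDefined : Prop :=
  D.IsInverse D.res ∧ Integrable (fun s => (D.kernel s s).trace) D.vol ∧
  ∀ z : ℂ, Multipliable (detTwoFactor D.resEnd z)

/-- `h` is the solution on `[0, σ]` of `τ h = z h`, `h(0) = u₀`: absolutely continuous, with the
equation holding almost everywhere. -/
def IsSolution (z : ℂ) (h : ℝ → Fin 2 → ℂ) : Prop :=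
  AbsolutelyContinuousOnInterval h 0 D.σ ∧ h 0 = vecC D.u0 ∧
  ∀ᵐ t ∂D.vol, D.tau h t = z • h t

end DiracOp

/-! ### Measures on the circle -/

/-- `p` has degree `k`, is orthogonal to `1, …, u^{k-1}` in `L²(μ)`, and `p(1) = 1`. -/
def IsOrthoPoly (μ : Measure ℂ) (k : ℕ) (p : ℂ[X]) : Prop :=
  p.natDegree = k ∧ p.eval 1 = 1 ∧
  ∀ j < k, ∫ u, p.eval u * (starRingEnd ℂ) (u ^ j) ∂μ = 0

open Classical in
/-- The `k`th orthogonal polynomial `ψ_k` normalized at `1`. -/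
def orthoPoly (μ : Measure ℂ) (k : ℕ) : ℂ[X] :=
  if h : ∃ p, IsOrthoPoly μ k p then h.choose else 0

/-- `w_k - i v_k = -2 ψ_{k+1}(0) / conj [ψ_k]`, where `[ψ_k]` is the leading coefficient. -/
def wv (μ : Measure ℂ) (k : ℕ) : ℂ :=
  -2 * (orthoPoly μ (k + 1)).eval 0 / (starRingEnd ℂ) (orthoPoly μ k).leadingCoeff

/-- The modified Verblunsky coefficient `γ_k`, the solution of `2 γ / (1 - γ) = w_k - i v_k`. -/
def modVerblunsky (μ : Measure ℂ) (k : ℕ) : ℂ := wv μ k / (2 + wv μ k)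

def wCoeff (μ : Measure ℂ) (k : ℕ) : ℝ := (wv μ k).re

def vCoeff (μ : Measure ℂ) (k : ℕ) : ℝ := -(wv μ k).im

/-- The discrete path `(x_k, y_k)`. -/
def verblunskyPath (μ : Measure ℂ) : ℕ → ℝ × ℝ
  | 0 => (0, 1)
  | k + 1 => ((verblunskyPath μ k).1 + vCoeff μ k * (verblunskyPath μ k).2, (verblunskyPath μ k).2 * (1 + wCoeff μ k))

/-- The discrete Dirac operator on `(0, 1]` of an `n`-point measure: it is built from
`x_{⌊nt⌋} + i y_{⌊nt⌋}`, with `u₀ = [1, 0]ᵗ` and `u₁ = [-x(1), -1]ᵗ`. -/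
def circDirac (μ : Measure ℂ) (n : ℕ) : DiracOp where
  σ := 1
  x := fun t => (verblunskyPath μ ⌊(n : ℝ) * t⌋₊).1
  y := fun t => (verblunskyPath μ ⌊(n : ℝ) * t⌋₊).2
  u0 := ![1, 0]
  u1 := ![-(verblunskyPath μ n).1, -1]

/-- The characteristic polynomial `p(u) = ∏ (u - e^{iλ_j}) / (1 - e^{iλ_j})`. -/
def normCharPoly {n : ℕ} (lam : Fin n → ℝ) (u : ℂ) : ℂ :=
  ∏ j, (u - Complex.exp (Complex.I * (lam j : ℂ))) / (1 - Complex.exp (Complex.I * (lam j : ℂ)))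

end

/-! Everything reduces to one entire function, the characteristic function F(z) = [1, -x_n] H(1, z)
of the boundary value problem.

On the interval [k/n, (k+1)/n) the equation τ H = z H reads H' = (z/2) B_k H with a constant matrix
B_k satisfying B_k² = -1, so one step multiplies H by cos θ + sin θ B_k with θ = z/(2n). The rows
[1, -(x_k ± i y_k)] are left eigenvectors of B_k with eigenvalues ±i (`matRot_row`). Hence a step
multiplies the corresponding two pairings with H by e^{±iθ}; up to the phase e^{iθ(k+1)} they become
uψ_k and the reversed polynomial ψ_k^* at u = e^{iz/n}. Passing from (x_k, y_k) to (x_{k+1},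
y_{k+1}) is exactly the Szegő recursion ψ_{k+1} = uψ_k + (a/2)(uψ_k - ψ_k^*) with a = w_k - i v_k.
This gives (i) by induction (`orthoPoly_eval_exp`). The recursion also multiplies the squared norm
by 1 + w_k, so y_k is proportional to ‖ψ_k‖²: positive for k < n and zero for k = n, where ψ_n
vanishes on the support and therefore equals p. So F(z) = e^{-iz/2} p(e^{iz/n}), which is the
product of sines.

For the operator theory, variation of constants shows that z is in the resolvent set unless F(z) =
0, and that a zero is an eigenvalue with a one-dimensional eigenspace (`FundSol.inResolventSet_iff`,
`FundSol.isEigenvalue_iff`). As F(0) = 1, the inverse exists; it is symmetric by Lagrange's identity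
(`isSymmetric_of_isInverse`), so algebraic multiplicities are geometric ones and all equal 1. Hence
det₂ is the product of (1 - z/e) e^{z/e} over the zeros e of F, listed without repetition.

Euler's sine product and the partial fractions of the cotangent evaluate that product as F(z) e^{zs}
with s = ∑ cot(λ_j/2)/(2n) (`tprod_latticePt`). The integral trace is -F'(0), by first-order
expansion of the step solution (`IsStep.hasDerivAt_charFun`), and the sine formula gives -F'(0) = s
as well. The exponentials cancel and the secular function is F. -/

noncomputable section

/-! ### Orthogonal polynomials of a finitely supported measure on the circle -/

section Szego

variable {ι : Type*} [Fintype ι]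

/-- The sesquilinear form `∑ m_j p(ζ_j) conj (q(ζ_j))` on polynomials. -/
def circForm (m : ι → ℝ) (ζ : ι → ℂ) (p q : ℂ[X]) : ℂ :=
  ∑ j, (m j : ℂ) * (p.eval (ζ j) * (starRingEnd ℂ) (q.eval (ζ j)))

variable {m : ι → ℝ} {ζ : ι → ℂ}

lemma circForm_add_right (p q r : ℂ[X]) :
    circForm m ζ p (q + r) = circForm m ζ p q + circForm m ζ p r := by
  simp only [circForm, Polynomial.eval_add, map_add, mul_add, Finset.sum_add_distrib]

lemma circForm_add_left (p q r : ℂ[X]) :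
    circForm m ζ (p + q) r = circForm m ζ p r + circForm m ζ q r := by
  simp only [circForm, Polynomial.eval_add, add_mul, mul_add, Finset.sum_add_distrib]

lemma circForm_sub_left (p q r : ℂ[X]) :
    circForm m ζ (p - q) r = circForm m ζ p r - circForm m ζ q r := by
  simp only [circForm, Polynomial.eval_sub, sub_mul, mul_sub, Finset.sum_sub_distrib]

lemma circForm_C_mul_left (c : ℂ) (p q : ℂ[X]) :
    circForm m ζ (Polynomial.C c * p) q = c * circForm m ζ p q := by
  simp only [circForm, Polynomial.eval_mul, Polynomial.eval_C, Finset.mul_sum]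
  exact Finset.sum_congr rfl fun j _ => by ring

lemma circForm_C_mul_right (c : ℂ) (p q : ℂ[X]) :
    circForm m ζ p (Polynomial.C c * q) = (starRingEnd ℂ) c * circForm m ζ p q := by
  simp only [circForm, Polynomial.eval_mul, Polynomial.eval_C, Finset.mul_sum, map_mul]
  exact Finset.sum_congr rfl fun j _ => by ring

lemma circForm_sum_right {κ : Type*} (s : Finset κ) (p : ℂ[X]) (q : κ → ℂ[X]) :
    circForm m ζ p (∑ i ∈ s, q i) = ∑ i ∈ s, circForm m ζ p (q i) := by
  classical
  induction s using Finset.induction_on with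
  | empty => simp [circForm]
  | insert a s ha ih => rw [Finset.sum_insert ha, Finset.sum_insert ha, circForm_add_right, ih]

lemma circForm_eq_zero_of_natDegree_lt {p q : ℂ[X]} {k : ℕ}
    (h : ∀ j < k, circForm m ζ p (Polynomial.X ^ j) = 0) (hq : q.natDegree < k) :
    circForm m ζ p q = 0 := by
  rw [Polynomial.as_sum_range_C_mul_X_pow q, circForm_sum_right]
  refine Finset.sum_eq_zero fun j hj => ?_
  rw [circForm_C_mul_right, h j (by have := Finset.mem_range.1 hj; omega), mul_zero]

lemma circForm_conj (p q : ℂ[X]) :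
    (starRingEnd ℂ) (circForm m ζ p q) = circForm m ζ q p := by
  simp only [circForm, map_sum, map_mul, Complex.conj_ofReal, Complex.conj_conj]
  exact Finset.sum_congr rfl fun j _ => by ring

/-- The squared norm of a polynomial. -/
def circNorm (m : ι → ℝ) (ζ : ι → ℂ) (p : ℂ[X]) : ℝ := ∑ j, m j * ‖p.eval (ζ j)‖ ^ 2

lemma circNorm_nonneg (hm : ∀ j, 0 < m j) (p : ℂ[X]) : 0 ≤ circNorm m ζ p :=
  Finset.sum_nonneg fun j _ => mul_nonneg (hm j).le (sq_nonneg _)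

lemma eq_zero_of_eval_eq_zero (hζ : Function.Injective ζ) {p : ℂ[X]}
    (hp : p.natDegree < Fintype.card ι) (h : ∀ j, p.eval (ζ j) = 0) : p = 0 :=
  Polynomial.eq_zero_of_natDegree_lt_card_of_eval_eq_zero p hζ h hp

lemma circNorm_pos (hm : ∀ j, 0 < m j) (hζ : Function.Injective ζ) {p : ℂ[X]}
    (hp : p.natDegree < Fintype.card ι) (h0 : p ≠ 0) : 0 < circNorm m ζ p := by
  refine lt_of_le_of_ne (circNorm_nonneg hm p) fun h => h0 ?_
  refine eq_zero_of_eval_eq_zero hζ hp fun j => ?_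
  have := (Finset.sum_eq_zero_iff_of_nonneg
    (fun j _ => mul_nonneg (hm j).le (sq_nonneg ‖p.eval (ζ j)‖))).1 h.symm j (Finset.mem_univ j)
  simpa [(hm j).ne'] using this

/-- A polynomial of degree at most `k` that vanishes at `1` and is orthogonal to
`1, …, u^{k-1}` is zero. -/
lemma eq_zero_of_orthogonal (hm : ∀ j, 0 < m j) (hζ : Function.Injective ζ)
    (hn : ∀ j, ‖ζ j‖ = 1) (h1 : ∀ j, ζ j ≠ 1) {r : ℂ[X]} {k : ℕ}
    (hk : k ≤ Fintype.card ι) (hr : r.natDegree ≤ k) (hr1 : r.eval 1 = 0)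
    (h : ∀ j < k, circForm m ζ r (Polynomial.X ^ j) = 0) : r = 0 := by
  by_contra hr0
  obtain ⟨s, rfl⟩ := Polynomial.dvd_iff_isRoot.2 (show r.IsRoot 1 from hr1)
  have hs0 : s ≠ 0 := right_ne_zero_of_mul hr0
  -- With r = (X - 1) s, the factor s has degree below k, so r is orthogonal to s.
  have hdeg : s.natDegree < k := by
    rw [Polynomial.natDegree_mul (Polynomial.X_sub_C_ne_zero 1) hs0,
      Polynomial.natDegree_X_sub_C] at hr
    omega
  have h0 := circForm_eq_zero_of_natDegree_lt h hdeg
  -- The form at (r, s) is ∑ m_j (ζ_j - 1) |s(ζ_j)|². Its real part has terms of one sign, because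
  -- Re ζ < 1 on the circle away from 1.
  have hre : ∑ j, m j * ((1 - (ζ j).re) * ‖s.eval (ζ j)‖ ^ 2) = 0 := by
    have h2 := congrArg Complex.re h0
    simp only [circForm, Polynomial.eval_mul, Polynomial.eval_sub, Polynomial.eval_X,
      Polynomial.eval_C, mul_assoc, Complex.mul_conj', Complex.re_sum, Complex.zero_re] at h2
    rw [← neg_eq_zero, ← Finset.sum_neg_distrib, ← h2]
    refine Finset.sum_congr rfl fun j _ => ?_
    rw [← Complex.ofReal_pow, Complex.re_ofReal_mul, Complex.re_mul_ofReal]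
    simp only [Complex.sub_re, Complex.one_re]
    ring
  have hpos : ∀ j, 0 < 1 - (ζ j).re := by
    intro j
    have hle : (ζ j).re ≤ 1 := (Complex.re_le_norm _).trans (hn j).le
    refine sub_pos.2 (lt_of_le_of_ne hle fun he => h1 j ?_)
    have hsq := Complex.sq_norm (ζ j)
    rw [hn j, Complex.normSq_apply, he] at hsq
    have : (ζ j).im = 0 := by nlinarith
    exact Complex.ext he this
  refine hs0 (eq_zero_of_eval_eq_zero hζ (by omega) fun j => ?_)
  have := (Finset.sum_eq_zero_iff_of_nonneg (fun j _ => mul_nonneg (hm j).le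
    (mul_nonneg (hpos j).le (sq_nonneg ‖s.eval (ζ j)‖)))).1 hre j (Finset.mem_univ j)
  simpa [(hm j).ne', (hpos j).ne'] using this

/-- `p` is the orthogonal polynomial of degree `k` normalized at `1`, and `q` is its reversal. -/
structure SzegoPair (m : ι → ℝ) (ζ : ι → ℂ) (k : ℕ) (p q : ℂ[X]) : Prop where
  natDegree_eq : p.natDegree = k
  eval_one : p.eval 1 = 1
  orth : ∀ j < k, circForm m ζ p (Polynomial.X ^ j) = 0
  natDegree_le : q.natDegree ≤ k
  eval_circle : ∀ u : ℂ, ‖u‖ = 1 → q.eval u = u ^ k * (starRingEnd ℂ) (p.eval u)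
  eval_zero : q.eval 0 = (starRingEnd ℂ) p.leadingCoeff

/-- The Szegő recursion. -/
def szegoNext (a : ℂ) (p q : ℂ[X]) : ℂ[X] :=
  Polynomial.X * p + Polynomial.C (a / 2) * (Polynomial.X * p - q)

/-- The Szegő recursion for the reversed polynomials. -/
def szegoDualNext (a : ℂ) (p q : ℂ[X]) : ℂ[X] :=
  q + Polynomial.C ((starRingEnd ℂ) a / 2) * (q - Polynomial.X * p)

lemma szegoPair_zero : SzegoPair m ζ 0 1 1 where
  natDegree_eq := by simp
  eval_one := by simp
  orth := by simp
  natDegree_le := by simp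
  eval_circle := by simp
  eval_zero := by simp

lemma SzegoPair.reversal_eval_one {k : ℕ} {p q : ℂ[X]} (h : SzegoPair m ζ k p q) :
    q.eval 1 = 1 := by
  rw [h.eval_circle 1 (by simp), h.eval_one]; simp

lemma SzegoPair.ne_zero {k : ℕ} {p q : ℂ[X]} (h : SzegoPair m ζ k p q) : p ≠ 0 := by
  rintro rfl
  simpa using h.eval_one

/-- Multiplication by u is unitary on the circle. -/
lemma SzegoPair.shift_orth (hn : ∀ j, ‖ζ j‖ = 1) {k : ℕ} {p q : ℂ[X]}
    (h : SzegoPair m ζ k p q) {j : ℕ} (hj : j < k) :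
    circForm m ζ (Polynomial.X * p) (Polynomial.X ^ (j + 1)) = 0 := by
  rw [← h.orth j hj]
  refine Finset.sum_congr rfl fun i _ => ?_
  have : ζ i * (starRingEnd ℂ) (ζ i) = 1 := by
    rw [Complex.mul_conj', hn i]; simp
  simp only [Polynomial.eval_mul, Polynomial.eval_X, Polynomial.eval_pow, map_pow, pow_succ, map_mul]
  linear_combination (↑(m i) * p.eval (ζ i) * (starRingEnd ℂ) (ζ i) ^ j) * this

/-- On the circle q = u^k conj p, so pairing q with u^(j+1) gives the conjugate of the pairing of p
with u^(k-j-1). -/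
lemma SzegoPair.reversal_orth (hn : ∀ j, ‖ζ j‖ = 1) {k : ℕ} {p q : ℂ[X]}
    (h : SzegoPair m ζ k p q) {j : ℕ} (hj : j < k) :
    circForm m ζ q (Polynomial.X ^ (j + 1)) = 0 := by
  have h2 := h.orth (k - (j + 1)) (by omega)
  rw [← circForm_conj, ← map_zero (starRingEnd ℂ), ← h2]
  congr 1
  refine Finset.sum_congr rfl fun i _ => ?_
  have : ζ i * (starRingEnd ℂ) (ζ i) = 1 := by
    rw [Complex.mul_conj', hn i]; simp
  simp only [Polynomial.eval_X, Polynomial.eval_pow, map_pow, h.eval_circle _ (hn i), map_mul,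
    Complex.conj_conj]
  have hpow : ζ i ^ (j + 1) * (starRingEnd ℂ) (ζ i) ^ k
      = (starRingEnd ℂ) (ζ i) ^ (k - (j + 1)) := by
    obtain ⟨l, rfl⟩ : ∃ l, k = (j + 1) + l := ⟨k - (j + 1), by omega⟩
    rw [pow_add ((starRingEnd ℂ) (ζ i)), ← mul_assoc, ← mul_pow, this, one_pow, one_mul,
      Nat.add_sub_cancel_left]
  linear_combination (↑(m i) * p.eval (ζ i)) * hpow

/-- Orthogonality to u, …, u^k holds for every a; only orthogonality to 1 is left to determine a. -/
lemma szegoNext_orth_succ (hn : ∀ j, ‖ζ j‖ = 1) {k : ℕ} {p q : ℂ[X]}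
    (h : SzegoPair m ζ k p q) (a : ℂ) {j : ℕ} (hj : j < k) :
    circForm m ζ (szegoNext a p q) (Polynomial.X ^ (j + 1)) = 0 := by
  rw [szegoNext, circForm_add_left, circForm_C_mul_left, circForm_sub_left,
    h.shift_orth hn hj, h.reversal_orth hn hj]
  simp

/-- There is a coefficient for which the Szegő recursion yields an orthogonal polynomial. -/
lemma SzegoPair.exists_coeff (hm : ∀ j, 0 < m j) (hζ : Function.Injective ζ)
    (hn : ∀ j, ‖ζ j‖ = 1) (h1 : ∀ j, ζ j ≠ 1) {k : ℕ} {p q : ℂ[X]}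
    (h : SzegoPair m ζ k p q) (hk : k < Fintype.card ι) :
    ∃ a : ℂ, ∀ j < k + 1, circForm m ζ (szegoNext a p q) (Polynomial.X ^ j) = 0 := by
  set A := circForm m ζ (Polynomial.X * p) (Polynomial.X ^ 0) with hA
  set B := circForm m ζ q (Polynomial.X ^ 0) with hB
  -- Otherwise Xp - q vanishes at 1 and is orthogonal to 1, …, u^k, hence is zero; but Xp has degree
  -- k + 1 and q has degree at most k.
  have hAB : B - A ≠ 0 := by
    intro hBA
    have hr : Polynomial.X * p - q = 0 := by
      refine eq_zero_of_orthogonal hm hζ hn h1 (k := k + 1) hk ?_ ?_ ?_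
      · refine (Polynomial.natDegree_sub_le _ _).trans (max_le ?_ (h.natDegree_le.trans (by omega)))
        refine Polynomial.natDegree_mul_le.trans ?_
        rw [Polynomial.natDegree_X, h.natDegree_eq, add_comm]
      · simp [h.eval_one, h.reversal_eval_one]
      · intro j hj
        rw [circForm_sub_left]
        cases j with
        | zero => rw [← hA, ← hB]; linear_combination -hBA
        | succ j => rw [h.shift_orth hn (by omega), h.reversal_orth hn (by omega), sub_zero]
    have hd : (Polynomial.X * p).natDegree = q.natDegree := by rw [sub_eq_zero.1 hr]
    rw [Polynomial.natDegree_X_mul h.ne_zero, h.natDegree_eq] at hd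
    have := h.natDegree_le
    omega
  -- The solution of A + (a/2)(A - B) = 0, which is orthogonality to 1.
  refine ⟨2 * A / (B - A), fun j hj => ?_⟩
  cases j with
  | zero =>
    rw [szegoNext, circForm_add_left, circForm_C_mul_left, circForm_sub_left, ← hA, ← hB]
    field_simp
    ring
  | succ j => exact szegoNext_orth_succ hn h _ (by omega)

/-- Write r for the next polynomial. Since |Xp| = |q| = |p| on the circle, |r|² - (1 + Re a)|p|²
equals -Re(conj a · r · conj q) pointwise. The sum of this is zero, because r is orthogonal to q,
whose degree is at most k. -/
lemma SzegoPair.norm_next (hn : ∀ j, ‖ζ j‖ = 1) {k : ℕ} {p q : ℂ[X]}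
    (h : SzegoPair m ζ k p q) {a : ℂ}
    (ha : ∀ j < k + 1, circForm m ζ (szegoNext a p q) (Polynomial.X ^ j) = 0) :
    circNorm m ζ (szegoNext a p q) = circNorm m ζ p * (1 + a.re) := by
  have h3 : circForm m ζ (szegoNext a p q) q = 0 :=
    circForm_eq_zero_of_natDegree_lt ha (Nat.lt_succ_of_le h.natDegree_le)
  have h4 := congrArg Complex.re (congrArg (fun w => (starRingEnd ℂ) a * w) h3)
  simp only [mul_zero, Complex.zero_re] at h4
  rw [← sub_eq_zero, ← neg_eq_zero, ← h4]
  simp only [circNorm, circForm, Finset.mul_sum, Finset.sum_mul, Complex.re_sum,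
    ← Finset.sum_sub_distrib, ← Finset.sum_neg_distrib]
  refine Finset.sum_congr rfl fun i _ => ?_
  have hq := h.eval_circle (ζ i) (hn i)
  have hqn : Complex.normSq (q.eval (ζ i)) = Complex.normSq (p.eval (ζ i)) := by
    rw [Complex.normSq_eq_norm_sq, Complex.normSq_eq_norm_sq, hq]
    simp [hn i]
  have hpn : Complex.normSq (ζ i * p.eval (ζ i)) = Complex.normSq (p.eval (ζ i)) := by
    rw [Complex.normSq_eq_norm_sq, Complex.normSq_eq_norm_sq]
    simp [hn i]
  rw [← Complex.normSq_eq_norm_sq, ← Complex.normSq_eq_norm_sq]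
  have he : (szegoNext a p q).eval (ζ i) = ζ i * p.eval (ζ i) + a / 2 * (ζ i * p.eval (ζ i) - q.eval (ζ i)) := by
    simp [szegoNext]
  rw [he]
  generalize ζ i * p.eval (ζ i) = s at hpn
  generalize q.eval (ζ i) = t at hqn
  rw [← hpn] at hqn ⊢
  simp only [Complex.normSq_apply] at hqn ⊢
  simp
  linear_combination (m i * (a.re ^ 2 + a.im ^ 2) / 4) * hqn

lemma SzegoPair.circNorm_pos (hm : ∀ j, 0 < m j) (hζ : Function.Injective ζ) {k : ℕ}
    {p q : ℂ[X]} (h : SzegoPair m ζ k p q) (hk : k < Fintype.card ι) : 0 < circNorm m ζ p :=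
  _root_.circNorm_pos hm hζ (h.natDegree_eq.symm ▸ hk) h.ne_zero

/-- The correction term vanishes at 1, since p and q both equal 1 there. So the recursion keeps the
normalization whatever a is. -/
lemma szegoNext_eval_one {k : ℕ} {p q : ℂ[X]} (h : SzegoPair m ζ k p q) (a : ℂ) :
    (szegoNext a p q).eval 1 = 1 := by
  simp [szegoNext, h.eval_one, h.reversal_eval_one]

/-- The value at 0 of the next polynomial is -(a/2) q(0) = -(a/2) conj [p]; this recovers a and
matches it with the defining formula of w_k - i v_k. -/
lemma SzegoPair.next (hm : ∀ j, 0 < m j) (hζ : Function.Injective ζ)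
    (hn : ∀ j, ‖ζ j‖ = 1) {k : ℕ} {p q : ℂ[X]} (h : SzegoPair m ζ k p q)
    (hk : k < Fintype.card ι) {a : ℂ}
    (ha : ∀ j < k + 1, circForm m ζ (szegoNext a p q) (Polynomial.X ^ j) = 0) :
    SzegoPair m ζ (k + 1) (szegoNext a p q) (szegoDualNext a p q) ∧
      -2 * (szegoNext a p q).eval 0 / (starRingEnd ℂ) p.leadingCoeff = a := by
  -- Both squared norms are nonnegative, so Re a ≥ -1. Hence 1 + a/2 ≠ 0 and the degree really rises
  -- to k + 1, also in the last step, where the new norm is zero.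
  have hre : 0 ≤ 1 + a.re := by
    have h2 := h.norm_next hn ha
    have h3 := circNorm_nonneg (ζ := ζ) hm (szegoNext a p q)
    rw [h2] at h3
    exact nonneg_of_mul_nonneg_right h3 (h.circNorm_pos hm hζ hk)
  have ha2 : 1 + a / 2 ≠ 0 := by
    intro h0
    have := congrArg Complex.re h0
    simp at this
    linarith
  have hlead : p.leadingCoeff ≠ 0 := Polynomial.leadingCoeff_ne_zero.2 h.ne_zero
  have hqc : q.coeff (k + 1) = 0 :=
    Polynomial.coeff_eq_zero_of_natDegree_lt (Nat.lt_succ_of_le h.natDegree_le)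
  have hpc : p.coeff k = p.leadingCoeff := by rw [Polynomial.leadingCoeff, h.natDegree_eq]
  have hc : (szegoNext a p q).coeff (k + 1) = (1 + a / 2) * p.leadingCoeff := by
    rw [szegoNext]
    simp only [Polynomial.coeff_add, Polynomial.coeff_X_mul, Polynomial.coeff_C_mul,
      Polynomial.coeff_sub, hqc, hpc]
    ring
  have hXp : (Polynomial.X * p).natDegree ≤ k + 1 := by
    rw [Polynomial.natDegree_X_mul h.ne_zero, h.natDegree_eq]
  have hq1 : q.natDegree ≤ k + 1 := h.natDegree_le.trans (Nat.le_succ k)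
  have hdeg : (szegoNext a p q).natDegree = k + 1 := by
    refine Polynomial.natDegree_eq_of_le_of_coeff_ne_zero ?_ ?_
    · refine Polynomial.natDegree_add_le_of_degree_le hXp ?_
      exact (Polynomial.natDegree_C_mul_le _ _).trans
        ((Polynomial.natDegree_sub_le _ _).trans (max_le hXp hq1))
    · rw [hc]; exact mul_ne_zero ha2 hlead
  refine ⟨⟨hdeg, szegoNext_eval_one h a, ha, ?_, fun u hu => ?_, ?_⟩, ?_⟩
  · refine Polynomial.natDegree_add_le_of_degree_le hq1 ?_
    exact (Polynomial.natDegree_C_mul_le _ _).trans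
      ((Polynomial.natDegree_sub_le _ _).trans (max_le hq1 hXp))
  · have huu : u * (starRingEnd ℂ) u = 1 := by rw [Complex.mul_conj', hu]; simp
    have hpow : u ^ k * (starRingEnd ℂ) u ^ k = 1 := by rw [← mul_pow, huu, one_pow]
    simp only [szegoNext, szegoDualNext, Polynomial.eval_add, Polynomial.eval_mul,
      Polynomial.eval_sub, Polynomial.eval_X, Polynomial.eval_C, map_add, map_mul, map_sub,
      h.eval_circle u hu, map_div₀, map_pow, Complex.conj_conj, Complex.conj_ofNat, pow_succ]
    linear_combination (-(u ^ k * (starRingEnd ℂ) (p.eval u) * (1 + (starRingEnd ℂ) a / 2))) * huu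
      + ((starRingEnd ℂ) a / 2 * u * p.eval u) * hpow
  · rw [Polynomial.leadingCoeff, hdeg, hc]
    simp [szegoDualNext, h.eval_zero, Complex.conj_ofNat]
    ring
  · have hl : (starRingEnd ℂ) p.leadingCoeff ≠ 0 := by simpa using hlead
    rw [div_eq_iff hl, ← h.eval_zero]
    simp [szegoNext]
    ring

end Szego

/-! ### Orthogonal polynomials and Verblunsky path of an n-point measure -/

section CircleMeasure

variable {n : ℕ} {ζ : Fin n → ℂ} {μ : Measure ℂ}

/-- Deleting the other support points leaves a neighbourhood of ζ_j, of positive measure; the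
complement of the support is null, so the atom carries that mass. -/
lemma measure_singleton_pos_of_support [IsProbabilityMeasure μ]
    (hsupp : μ.support = Set.range ζ) (j : Fin n) : 0 < μ.real {ζ j} := by
  have hmem : ζ j ∈ μ.support := hsupp ▸ Set.mem_range_self j
  have hfin : (Set.range ζ \ {ζ j}).Finite := (Set.finite_range ζ).subset Set.sdiff_subset
  have hU : (Set.range ζ \ {ζ j})ᶜ ∈ 𝓝 (ζ j) :=
    hfin.isClosed.isOpen_compl.mem_nhds (by simp)
  have hpos := (Measure.mem_support_iff_forall _).1 hmem _ hU
  have hle : μ (Set.range ζ \ {ζ j})ᶜ ≤ μ {ζ j} + μ μ.supportᶜ := by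
    refine (measure_mono ?_).trans (measure_union_le _ _)
    intro u hu
    rw [hsupp]
    by_cases h : u = ζ j
    · exact Or.inl h
    · exact Or.inr fun h2 => hu ⟨h2, h⟩
  rw [Measure.measure_compl_support, add_zero] at hle
  exact ENNReal.toReal_pos (hpos.trans_le hle).ne' (measure_ne_top _ _)

lemma integral_eq_sum_of_support [IsProbabilityMeasure μ] (hζ : Function.Injective ζ)
    (hsupp : μ.support = Set.range ζ) (f : ℂ → ℂ) :
    ∫ u, f u ∂μ = ∑ j, (μ.real {ζ j} : ℂ) * f (ζ j) := by
  classical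
  have hs : (Set.range ζ) = ((Finset.univ.image ζ : Finset ℂ) : Set ℂ) := by simp
  have hr : μ.restrict (Set.range ζ) = μ := by
    refine Measure.restrict_eq_self_of_ae_mem ?_
    rw [← hsupp]
    exact Measure.support_mem_ae
  have hfin : IntegrableOn f (Finset.univ.image ζ : Finset ℂ) μ :=
    IntegrableOn.finset
  have h : ∫ u, f u ∂μ = ∫ u in (Finset.univ.image ζ : Finset ℂ), f u ∂μ := by rw [← hs, hr]
  rw [h, setIntegral_finset _ hfin, Finset.sum_image fun a _ b _ h => hζ h]
  exact Finset.sum_congr rfl fun j _ => Complex.real_smul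

lemma isOrthoPoly_iff [IsProbabilityMeasure μ] (hζ : Function.Injective ζ)
    (hsupp : μ.support = Set.range ζ) (k : ℕ) (p : ℂ[X]) :
    IsOrthoPoly μ k p ↔ p.natDegree = k ∧ p.eval 1 = 1 ∧
      ∀ j < k, circForm (fun j => μ.real {ζ j}) ζ p (Polynomial.X ^ j) = 0 := by
  simp only [IsOrthoPoly, integral_eq_sum_of_support hζ hsupp, circForm, Polynomial.eval_pow,
    Polynomial.eval_X]

/-- The reversed orthogonal polynomials. -/
def orthoDual (μ : Measure ℂ) : ℕ → ℂ[X]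
  | 0 => 1
  | k + 1 => szegoDualNext (wv μ k) (orthoPoly μ k) (orthoDual μ k)

lemma IsOrthoPoly.unique [IsProbabilityMeasure μ] (hζ : Function.Injective ζ)
    (hsupp : μ.support = Set.range ζ) (hn : ∀ j, ‖ζ j‖ = 1) (h1 : ∀ j, ζ j ≠ 1)
    {k : ℕ} (hk : k ≤ n) {p q : ℂ[X]} (hp : IsOrthoPoly μ k p) (hq : IsOrthoPoly μ k q) :
    p = q := by
  rw [isOrthoPoly_iff hζ hsupp] at hp hq
  refine sub_eq_zero.1 (eq_zero_of_orthogonal (measure_singleton_pos_of_support hsupp) hζ hn h1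
    (k := k) (by simpa using hk) ?_ ?_ fun j hj => ?_)
  · exact (Polynomial.natDegree_sub_le _ _).trans (max_le hp.1.le hq.1.le)
  · rw [Polynomial.eval_sub, hp.2.1, hq.2.1, sub_self]
  · rw [circForm_sub_left, hp.2.2 j hj, hq.2.2 j hj, sub_zero]

lemma orthoPoly_eq_of_isOrthoPoly [IsProbabilityMeasure μ] (hζ : Function.Injective ζ)
    (hsupp : μ.support = Set.range ζ) (hn : ∀ j, ‖ζ j‖ = 1) (h1 : ∀ j, ζ j ≠ 1)
    {k : ℕ} (hk : k ≤ n) {p : ℂ[X]} (hp : IsOrthoPoly μ k p) : orthoPoly μ k = p := by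
  have hex : ∃ p, IsOrthoPoly μ k p := ⟨p, hp⟩
  rw [orthoPoly, dif_pos hex]
  exact hex.choose_spec.unique hζ hsupp hn h1 hk hp

/-- By induction: some coefficient a makes the Szegő recursion orthogonal, uniqueness identifies the
result with `orthoPoly μ (k + 1)`, and its value at 0 then identifies a with `wv μ k`. -/
lemma szegoPair_orthoPoly [IsProbabilityMeasure μ] (hζ : Function.Injective ζ)
    (hsupp : μ.support = Set.range ζ) (hn : ∀ j, ‖ζ j‖ = 1) (h1 : ∀ j, ζ j ≠ 1)
    {k : ℕ} (hk : k ≤ n) :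
    SzegoPair (fun j => μ.real {ζ j}) ζ k (orthoPoly μ k) (orthoDual μ k) := by
  induction k with
  | zero =>
    have h := orthoPoly_eq_of_isOrthoPoly hζ hsupp hn h1 hk
      ((isOrthoPoly_iff hζ hsupp 0 1).2 ⟨by simp, by simp, by simp⟩)
    rw [h]
    exact szegoPair_zero
  | succ k ih =>
    have hp := ih (by omega)
    have hm := measure_singleton_pos_of_support hsupp
    have hkn : k < Fintype.card (Fin n) := by simpa using hk
    obtain ⟨a, ha⟩ := hp.exists_coeff hm hζ hn h1 hkn
    obtain ⟨hnext, haeq⟩ := hp.next hm hζ hn hkn ha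
    have h := orthoPoly_eq_of_isOrthoPoly hζ hsupp hn h1 hk
      ((isOrthoPoly_iff hζ hsupp (k + 1) _).2 ⟨hnext.natDegree_eq, hnext.eval_one, hnext.orth⟩)
    have hw : wv μ k = a := by rw [wv, h, haeq]
    rw [orthoDual, h, hw]
    exact hnext

lemma orthoPoly_succ [IsProbabilityMeasure μ] (hζ : Function.Injective ζ)
    (hsupp : μ.support = Set.range ζ) (hn : ∀ j, ‖ζ j‖ = 1) (h1 : ∀ j, ζ j ≠ 1)
    {k : ℕ} (hk : k < n) :
    orthoPoly μ (k + 1) = szegoNext (wv μ k) (orthoPoly μ k) (orthoDual μ k) ∧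
    circNorm (fun j => μ.real {ζ j}) ζ (orthoPoly μ (k + 1)) =
      circNorm (fun j => μ.real {ζ j}) ζ (orthoPoly μ k) * (1 + wCoeff μ k) := by
  have hp := szegoPair_orthoPoly hζ hsupp hn h1 hk.le
  have hm := measure_singleton_pos_of_support hsupp
  have hkn : k < Fintype.card (Fin n) := by simpa using hk
  obtain ⟨a, ha⟩ := hp.exists_coeff hm hζ hn h1 hkn
  obtain ⟨hnext, haeq⟩ := hp.next hm hζ hn hkn ha
  have h := orthoPoly_eq_of_isOrthoPoly hζ hsupp hn h1 (Nat.succ_le_of_lt hk)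
    ((isOrthoPoly_iff hζ hsupp (k + 1) _).2 ⟨hnext.natDegree_eq, hnext.eval_one, hnext.orth⟩)
  have hw : wv μ k = a := by rw [wv, h, haeq]
  rw [wCoeff, h, hw]
  exact ⟨rfl, hp.norm_next hn ha⟩

lemma isOrthoPoly_orthoPoly [IsProbabilityMeasure μ] (hζ : Function.Injective ζ)
    (hsupp : μ.support = Set.range ζ) (hn : ∀ j, ‖ζ j‖ = 1) (h1 : ∀ j, ζ j ≠ 1)
    {k : ℕ} (hk : k ≤ n) : IsOrthoPoly μ k (orthoPoly μ k) := by
  have h := szegoPair_orthoPoly hζ hsupp hn h1 hk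
  exact (isOrthoPoly_iff hζ hsupp k _).2 ⟨h.natDegree_eq, h.eval_one, h.orth⟩

/-- The normalized characteristic polynomial vanishes on the support, so it is orthogonal to
everything; uniqueness still holds at degree n. -/
lemma orthoPoly_eval_top [IsProbabilityMeasure μ] (hζ : Function.Injective ζ)
    (hsupp : μ.support = Set.range ζ) (hn : ∀ j, ‖ζ j‖ = 1) (h1 : ∀ j, ζ j ≠ 1) (u : ℂ) :
    (orthoPoly μ n).eval u = ∏ j, (u - ζ j) / (1 - ζ j) := by
  set P : ℂ[X] := Polynomial.C (∏ j, (1 - ζ j))⁻¹ * ∏ j, (Polynomial.X - Polynomial.C (ζ j))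
    with hP
  have hc : ∏ j, (1 - ζ j) ≠ 0 :=
    Finset.prod_ne_zero_iff.2 fun j _ => sub_ne_zero.2 (h1 j).symm
  have heval : ∀ u, P.eval u = ∏ j, (u - ζ j) / (1 - ζ j) := by
    intro u
    rw [hP, Polynomial.eval_mul, Polynomial.eval_C, Polynomial.eval_prod, Finset.prod_div_distrib]
    simp only [Polynomial.eval_sub, Polynomial.eval_X, Polynomial.eval_C]
    rw [div_eq_inv_mul]
  have hPo : IsOrthoPoly μ n P := by
    refine (isOrthoPoly_iff hζ hsupp n P).2 ⟨?_, ?_, fun j _ => ?_⟩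
    · rw [hP, Polynomial.natDegree_C_mul (inv_ne_zero hc), Polynomial.natDegree_finsetProd_X_sub_C_eq_card]
      simp
    · rw [heval]
      exact Finset.prod_eq_one fun j _ => div_self (sub_ne_zero.2 (h1 j).symm)
    · refine Finset.sum_eq_zero fun i _ => ?_
      have : P.eval (ζ i) = 0 := by
        rw [heval]
        exact Finset.prod_eq_zero (Finset.mem_univ i) (by simp)
      rw [this, zero_mul, mul_zero]
  rw [orthoPoly_eq_of_isOrthoPoly hζ hsupp hn h1 le_rfl hPo, heval]

lemma circNorm_orthoPoly_top [IsProbabilityMeasure μ] (hζ : Function.Injective ζ)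
    (hsupp : μ.support = Set.range ζ) (hn : ∀ j, ‖ζ j‖ = 1) (h1 : ∀ j, ζ j ≠ 1) :
    circNorm (fun j => μ.real {ζ j}) ζ (orthoPoly μ n) = 0 := by
  refine Finset.sum_eq_zero fun i _ => ?_
  have : (orthoPoly μ n).eval (ζ i) = 0 := by
    rw [orthoPoly_eval_top hζ hsupp hn h1]
    exact Finset.prod_eq_zero (Finset.mem_univ i) (by simp)
  simp [this]

lemma pos_of_support [IsProbabilityMeasure μ] (hsupp : μ.support = Set.range ζ) : 0 < n := by
  have h : μ.support.Nonempty := Measure.nonempty_support (IsProbabilityMeasure.ne_zero μ)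
  rw [hsupp] at h
  obtain ⟨_, j, _⟩ := h
  exact j.pos

/-- `y_k` is the squared norm of `ψ_k`. -/
lemma circNorm_orthoPoly_eq [IsProbabilityMeasure μ] (hζ : Function.Injective ζ)
    (hsupp : μ.support = Set.range ζ) (hn : ∀ j, ‖ζ j‖ = 1) (h1 : ∀ j, ζ j ≠ 1)
    {k : ℕ} (hk : k ≤ n) :
    circNorm (fun j => μ.real {ζ j}) ζ (orthoPoly μ k) =
      circNorm (fun j => μ.real {ζ j}) ζ (orthoPoly μ 0) * (verblunskyPath μ k).2 := by
  induction k with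
  | zero => simp [verblunskyPath]
  | succ k ih =>
    rw [(orthoPoly_succ hζ hsupp hn h1 hk).2, ih (by omega), verblunskyPath, mul_assoc]

lemma verblunskyPath_pos [IsProbabilityMeasure μ] (hζ : Function.Injective ζ)
    (hsupp : μ.support = Set.range ζ) (hn : ∀ j, ‖ζ j‖ = 1) (h1 : ∀ j, ζ j ≠ 1)
    {k : ℕ} (hk : k < n) : 0 < (verblunskyPath μ k).2 := by
  have hm := measure_singleton_pos_of_support hsupp
  have h0 := (szegoPair_orthoPoly hζ hsupp hn h1 hk.le).circNorm_pos hm hζ (by simpa using hk)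
  rw [circNorm_orthoPoly_eq hζ hsupp hn h1 hk.le] at h0
  exact pos_of_mul_pos_right h0 (circNorm_nonneg hm _)

lemma verblunskyPath_top [IsProbabilityMeasure μ] (hζ : Function.Injective ζ)
    (hsupp : μ.support = Set.range ζ) (hn : ∀ j, ‖ζ j‖ = 1) (h1 : ∀ j, ζ j ≠ 1) :
    (verblunskyPath μ n).2 = 0 := by
  have hm := measure_singleton_pos_of_support hsupp
  have h0 := (szegoPair_orthoPoly hζ hsupp hn h1 (Nat.zero_le n)).circNorm_pos hm hζ
    (by simpa using pos_of_support hsupp)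
  have h := circNorm_orthoPoly_eq hζ hsupp hn h1 le_rfl
  rw [circNorm_orthoPoly_top hζ hsupp hn h1] at h
  exact (mul_eq_zero.1 h.symm).resolve_left h0.ne'

lemma one_add_wCoeff_nonneg [IsProbabilityMeasure μ] (hζ : Function.Injective ζ)
    (hsupp : μ.support = Set.range ζ) (hn : ∀ j, ‖ζ j‖ = 1) (h1 : ∀ j, ζ j ≠ 1)
    {k : ℕ} (hk : k < n) : 0 ≤ 1 + wCoeff μ k := by
  have hm := measure_singleton_pos_of_support hsupp
  have h := (orthoPoly_succ hζ hsupp hn h1 hk).2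
  have h0 := (szegoPair_orthoPoly hζ hsupp hn h1 hk.le).circNorm_pos hm hζ (by simpa using hk)
  have h3 := circNorm_nonneg (ζ := ζ) hm (orthoPoly μ (k + 1))
  rw [h] at h3
  exact nonneg_of_mul_nonneg_right h3 h0

/-- The Möbius relation can be inverted because Re w ≥ -1 excludes w = -2. -/
lemma modVerblunsky_spec [IsProbabilityMeasure μ] (hζ : Function.Injective ζ)
    (hsupp : μ.support = Set.range ζ) (hn : ∀ j, ‖ζ j‖ = 1) (h1 : ∀ j, ζ j ≠ 1)
    {k : ℕ} (hk : k < n) : modVerblunsky μ k ≠ 1 ∧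
      2 * modVerblunsky μ k / (1 - modVerblunsky μ k) = wv μ k := by
  have hre := one_add_wCoeff_nonneg hζ hsupp hn h1 hk
  have h2 : 2 + wv μ k ≠ 0 := by
    intro h0
    have := congrArg Complex.re h0
    simp at this
    rw [wCoeff] at hre
    linarith
  have h3 : 1 - modVerblunsky μ k = 2 / (2 + wv μ k) := by
    rw [modVerblunsky]; field_simp; ring
  constructor
  · intro h
    rw [h, sub_self] at h3
    exact div_ne_zero two_ne_zero h2 h3.symm
  · rw [h3, modVerblunsky]; field_simp

end CircleMeasure

/-! ### Absolutely continuous vector-valued functions -/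

namespace AbsolutelyContinuousOnInterval

section General

variable {E F : Type*} [PseudoMetricSpace E] [PseudoMetricSpace F] {a b : ℝ}

lemma of_dist_le {f : ℝ → E} {g : ℝ → F} (hg : AbsolutelyContinuousOnInterval g a b)
    (h : ∀ x ∈ uIcc a b, ∀ y ∈ uIcc a b, dist (f x) (f y) ≤ dist (g x) (g y)) :
    AbsolutelyContinuousOnInterval f a b := by
  rw [absolutelyContinuousOnInterval_iff] at hg ⊢
  intro ε hε
  obtain ⟨δ, hδ, H⟩ := hg ε hε
  refine ⟨δ, hδ, fun E hE hlt => lt_of_le_of_lt (Finset.sum_le_sum fun i hi => ?_) (H E hE hlt)⟩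
  exact h _ (hE.1 i hi).1 _ (hE.1 i hi).2

lemma lipschitz_comp {f : ℝ → E} (hf : AbsolutelyContinuousOnInterval f a b) {φ : E → F}
    (hφ : LipschitzWith 1 φ) : AbsolutelyContinuousOnInterval (fun t => φ (f t)) a b :=
  hf.of_dist_le fun x _ y _ => by simpa using hφ.dist_le_mul (f x) (f y)

/-- In the sup metric an increment is at most the sum of the increments of the coordinates. -/
lemma pi {ι : Type*} [Fintype ι] {f : ℝ → ι → E}
    (h : ∀ i, AbsolutelyContinuousOnInterval (fun t => f t i) a b) :
    AbsolutelyContinuousOnInterval f a b := by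
  have hs := tendsto_finsetSum (Finset.univ : Finset ι) fun i _ => h i
  simp only [Finset.sum_const_zero] at hs
  refine squeeze_zero (fun _ => Finset.sum_nonneg fun _ _ => dist_nonneg) (fun S => ?_) hs
  rw [Finset.sum_comm]
  refine Finset.sum_le_sum fun i _ => ?_
  refine (dist_pi_le_iff (Finset.sum_nonneg fun _ _ => dist_nonneg)).2 fun j => ?_
  exact Finset.single_le_sum
    (f := fun j => dist (f (S.2 i).1 j) (f (S.2 i).2 j)) (fun _ _ => dist_nonneg)
    (Finset.mem_univ j)

lemma apply {ι : Type*} [Fintype ι] {f : ℝ → ι → E} (h : AbsolutelyContinuousOnInterval f a b)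
    (i : ι) : AbsolutelyContinuousOnInterval (fun t => f t i) a b :=
  h.lipschitz_comp (φ := fun v : ι → E => v i) (LipschitzWith.eval i)

lemma const (c : E) : AbsolutelyContinuousOnInterval (fun _ => c) a b :=
  LipschitzOnWith.absolutelyContinuousOnInterval (K := 0)
    (LipschitzWith.const c).lipschitzOnWith

end General

section Normed

variable {E : Type*} [NormedAddCommGroup E] [NormedSpace ℝ E] {a b : ℝ}

lemma ae_hasDerivAt [FiniteDimensional ℝ E] {f : ℝ → E}
    (hf : AbsolutelyContinuousOnInterval f a b) :
    ∀ᵐ x, x ∈ uIcc a b → HasDerivAt f (deriv f x) x := by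
  filter_upwards [hf.boundedVariationOn.ae_differentiableAt_of_mem_uIcc] with x hx h
  exact (hx h).hasDerivAt

/-- The increments are dominated by those of the primitive of ‖f‖, which is the real-valued case. -/
lemma intervalIntegral [CompleteSpace E] {f : ℝ → E} {c : ℝ}
    (h : IntervalIntegrable f volume a b) (hc : c ∈ uIcc a b) :
    AbsolutelyContinuousOnInterval (fun x => ∫ t in c..x, f t) a b := by
  have hi : ∀ x ∈ uIcc a b, ∀ y ∈ uIcc a b, IntervalIntegrable f volume x y :=
    fun x hx y hy => h.mono_set (uIcc_subset_uIcc hx hy)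
  refine (h.norm.absolutelyContinuousOnInterval_intervalIntegral hc).of_dist_le
    fun x hx y hy => ?_
  rw [dist_comm, dist_comm (∫ t in c..x, ‖f t‖), dist_eq_norm, Real.dist_eq,
    intervalIntegral.integral_interval_sub_left (hi c hc y hy) (hi c hc x hx),
    intervalIntegral.integral_interval_sub_left (hi c hc y hy).norm (hi c hc x hx).norm]
  exact intervalIntegral.norm_integral_le_abs_integral_norm

/-- The fundamental theorem of calculus. -/
lemma sub_eq_integral [CompleteSpace E] {f g : ℝ → E}
    (hf : AbsolutelyContinuousOnInterval f a b) (hg : IntervalIntegrable g volume a b)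
    (h : ∀ᵐ x, x ∈ uIcc a b → HasDerivAt f (g x) x) : f b - f a = ∫ t in a..b, g t := by
  have hG := intervalIntegral hg (left_mem_uIcc : a ∈ uIcc a b)
  obtain ⟨C, hC⟩ := (hf.sub hG).const_of_ae_hasDerivAt_zero (by
    filter_upwards [h, hg.ae_hasDerivAt_integral] with x hx1 hx2 hx
    simpa using! (hx1 hx).sub (hx2 hx a left_mem_uIcc))
  have ha := hC a left_mem_uIcc
  have hb := hC b right_mem_uIcc
  simp only [Pi.sub_apply, intervalIntegral.integral_same, sub_zero] at ha hb
  rw [ha, ← hb]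
  abel

end Normed

variable {a b : ℝ}

lemma mulC {f g : ℝ → ℂ} (hf : AbsolutelyContinuousOnInterval f a b)
    (hg : AbsolutelyContinuousOnInterval g a b) :
    AbsolutelyContinuousOnInterval (fun t => f t * g t) a b :=
  hf.smul hg

lemma finset_sum {ι E : Type*} [NormedAddCommGroup E] (s : Finset ι) {f : ι → ℝ → E}
    (h : ∀ i ∈ s, AbsolutelyContinuousOnInterval (f i) a b) :
    AbsolutelyContinuousOnInterval (fun t => ∑ i ∈ s, f i t) a b := by
  classical
  induction s using Finset.induction_on with
  | empty => simpa using const (0 : E)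
  | insert i s hi ih =>
    simp only [Finset.sum_insert hi]
    exact (h i (by simp)).add (ih fun j hj => h j (by simp [hj]))

lemma mulVec {ι : Type*} [Fintype ι] {M : ℝ → Matrix ι ι ℂ} {v : ℝ → ι → ℂ}
    (hM : ∀ i j, AbsolutelyContinuousOnInterval (fun t => M t i j) a b)
    (hv : AbsolutelyContinuousOnInterval v a b) :
    AbsolutelyContinuousOnInterval (fun t => M t *ᵥ v t) a b :=
  pi fun i => finset_sum _ fun j _ => (hM i j).mulC (hv.apply j)

end AbsolutelyContinuousOnInterval

lemma hasDerivAt_mulVec {ι : Type*} [Fintype ι] {M : ℝ → Matrix ι ι ℂ} {M' : Matrix ι ι ℂ}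
    {v : ℝ → ι → ℂ} {v' : ι → ℂ} {t : ℝ}
    (hM : ∀ i j, HasDerivAt (fun t => M t i j) (M' i j) t) (hv : HasDerivAt v v' t) :
    HasDerivAt (fun t => M t *ᵥ v t) (M' *ᵥ v t + M t *ᵥ v') t := by
  refine hasDerivAt_pi.2 fun i => ?_
  simp only [Pi.add_apply, Matrix.mulVec, dotProduct, ← Finset.sum_add_distrib]
  exact HasDerivAt.fun_sum fun j _ => (hM i j).mul (hasDerivAt_pi.1 hv j)

/-! ### Dirac operators with bounded coefficients -/

lemma norm_mulVec_le_of_entry {A : Matrix (Fin 2) (Fin 2) ℂ} {K : ℝ} (h : ∀ i j, ‖A i j‖ ≤ K)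
    (v : Fin 2 → ℂ) : ‖A *ᵥ v‖ ≤ 2 * K * ‖v‖ := by
  have hK : 0 ≤ K := (norm_nonneg _).trans (h 0 0)
  refine (pi_norm_le_iff_of_nonneg (by positivity)).2 fun i => ?_
  simp only [Matrix.mulVec, dotProduct, Fin.sum_univ_two]
  refine (norm_add_le _ _).trans ?_
  rw [norm_mul, norm_mul]
  have h0 := mul_le_mul (h i 0) (norm_le_pi_norm v 0) (norm_nonneg _) hK
  have h1 := mul_le_mul (h i 1) (norm_le_pi_norm v 1) (norm_nonneg _) hK
  linarith

lemma aestronglyMeasurable_mulVec {α : Type*} [MeasurableSpace α] {ν : Measure α}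
    {A : α → Matrix (Fin 2) (Fin 2) ℂ} {g : α → Fin 2 → ℂ}
    (hA : ∀ i j, AEStronglyMeasurable (fun t => A t i j) ν) (hg : AEStronglyMeasurable g ν) :
    AEStronglyMeasurable (fun t => A t *ᵥ g t) ν := by
  refine (aemeasurable_pi_iff.2 fun i => ?_).aestronglyMeasurable
  simp only [Matrix.mulVec, dotProduct]
  exact Finset.aemeasurable_fun_sum _ fun j _ =>
    ((hA i j).aemeasurable).mul (aemeasurable_pi_iff.1 hg.aemeasurable j)

lemma memLp_mulVec {α : Type*} [MeasurableSpace α] {ν : Measure α} {p : ENNReal}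
    {A : α → Matrix (Fin 2) (Fin 2) ℂ} {g : α → Fin 2 → ℂ} {K : ℝ}
    (hA : ∀ i j, AEStronglyMeasurable (fun t => A t i j) ν)
    (hK : ∀ᵐ t ∂ν, ∀ i j, ‖A t i j‖ ≤ K) (hg : MemLp g p ν) :
    MemLp (fun t => A t *ᵥ g t) p ν := by
  refine hg.of_le_mul (c := 2 * K) (aestronglyMeasurable_mulVec hA hg.1) ?_
  filter_upwards [hK] with t ht
  exact norm_mulVec_le_of_entry ht _

namespace DiracOp

variable (D : DiracOp)

/-- Bounded coefficients on `(0, σ)` that stay away from degeneracy, in the normalization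
`u₀ = [1, 0]ᵗ`, `u₁ = [*, -1]ᵗ`. -/
structure Regular : Prop where
  pos : 0 < D.σ
  measurable_x : Measurable D.x
  measurable_y : Measurable D.y
  bound : ∃ C, 0 ≤ C ∧ ∀ t ∈ Ioo 0 D.σ,
    0 < D.y t ∧ |D.x t| ≤ C ∧ D.y t ≤ C ∧ (D.y t)⁻¹ ≤ C
  u0_eq : D.u0 = ![1, 0]
  u1_eq : D.u1 1 = -1

/-- The matrix `J⁻¹ R`. -/
def gen (t : ℝ) : Matrix (Fin 2) (Fin 2) ℂ :=
  ((2 * D.y t : ℝ) : ℂ)⁻¹ • !![-(D.x t : ℂ), (D.x t : ℂ) ^ 2 + (D.y t : ℂ) ^ 2; -1, (D.x t : ℂ)]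

/-- The boundary form at `σ`. -/
def bdry (v : Fin 2 → ℂ) : ℂ := v 0 + (D.u1 0 : ℂ) * v 1

lemma bdry_add (v w : Fin 2 → ℂ) : D.bdry (v + w) = D.bdry v + D.bdry w := by
  simp only [bdry, Pi.add_apply]; ring

lemma bdry_smul (c : ℂ) (v : Fin 2 → ℂ) : D.bdry (c • v) = c * D.bdry v := by
  simp only [bdry, Pi.smul_apply, smul_eq_mul]; ring

variable {D}

lemma toC_R (t : ℝ) : toC (D.R t) = ((2 * D.y t : ℝ) : ℂ)⁻¹ •
    !![1, -(D.x t : ℂ); -(D.x t : ℂ), (D.x t : ℂ) ^ 2 + (D.y t : ℂ) ^ 2] := by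
  ext i j
  fin_cases i <;> fin_cases j <;>
    simp [toC, R, X, Matrix.mul_apply, Fin.sum_univ_two]
  ring_nf
  simp

lemma toC_Y_mulVec (t : ℝ) (v : Fin 2 → ℂ) : toC (D.Y t) *ᵥ v =
    ((√(D.y t) : ℝ) : ℂ)⁻¹ • ![v 0 - D.x t * v 1, D.y t * v 1] := by
  ext i
  fin_cases i <;>
    simp [toC, Y, X, Matrix.mulVec, dotProduct, Fin.sum_univ_two] <;> ring

lemma toC_mul (A B : Matrix (Fin 2) (Fin 2) ℝ) : toC (A * B) = toC A * toC B :=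
  Matrix.map_mul (f := Complex.ofRealHom)

lemma toC_one : toC 1 = 1 := Matrix.map_one _ Complex.ofReal_zero Complex.ofReal_one

lemma isUnit_det_R {t : ℝ} (hy : D.y t ≠ 0) : IsUnit (D.R t).det := by
  have : (D.R t).det = 1 / 4 := by
    simp [R, X, Matrix.det_mul, Matrix.det_transpose]
    field_simp
    norm_num
  rw [this]
  norm_num

lemma gen_mul {t : ℝ} (hy : D.y t ≠ 0) : D.gen t * toC ((D.R t)⁻¹ * J) = 1 := by
  have h : D.gen t = toC (-J * D.R t) := by
    rw [toC_mul, toC_R, gen]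
    ext i j
    fin_cases i <;> fin_cases j <;>
    simp [toC, J, Matrix.mul_apply, Fin.sum_univ_two]
  rw [h, ← toC_mul, Matrix.mul_assoc, Matrix.mul_nonsing_inv_cancel_left _ _ (isUnit_det_R hy)]
  have : -J * J = 1 := by
    ext i j
    fin_cases i <;> fin_cases j <;> simp [J, Matrix.mul_apply, Fin.sum_univ_two]
  rw [this, toC_one]

/-- Turns the Dirac equation τ v = g into the linear system v' = J⁻¹ R g, the form in which it is
solved. -/
lemma tau_eq_iff {t : ℝ} (hy : D.y t ≠ 0) (v : ℝ → Fin 2 → ℂ) (g : Fin 2 → ℂ) :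
    D.tau v t = g ↔ deriv v t = D.gen t *ᵥ g := by
  have h1 := gen_mul hy
  have h2 := mul_eq_one_comm.1 h1
  constructor
  · rintro rfl
    rw [tau, Matrix.mulVec_mulVec, h1, Matrix.one_mulVec]
  · intro h
    rw [tau, h, Matrix.mulVec_mulVec, h2, Matrix.one_mulVec]

lemma deriv_eq_gen_tau {t : ℝ} (hy : D.y t ≠ 0) (v : ℝ → Fin 2 → ℂ) :
    deriv v t = D.gen t *ᵥ D.tau v t := (tau_eq_iff hy v _).1 rfl

lemma ae_vol_mem : ∀ᵐ t ∂D.vol, t ∈ Ioo 0 D.σ := by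
  rw [vol, ← restrict_Ioo_eq_restrict_Ioc]
  exact ae_restrict_mem measurableSet_Ioo

lemma ae_vol_iff {P : ℝ → Prop} : (∀ᵐ t ∂D.vol, P t) ↔ ∀ᵐ t, t ∈ Ioo 0 D.σ → P t := by
  rw [vol, ← restrict_Ioo_eq_restrict_Ioc, ae_restrict_iff' measurableSet_Ioo]

lemma density_eq (v : ℝ → Fin 2 → ℂ) (t : ℝ) : D.density v t =
    (2 * D.y t)⁻¹ * (‖v t 0 - D.x t * v t 1‖ ^ 2 + D.y t ^ 2 * ‖v t 1‖ ^ 2) := by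
  rw [density, toC_R, ← Complex.normSq_eq_norm_sq, ← Complex.normSq_eq_norm_sq,
    Matrix.smul_mulVec, dotProduct_smul, ← Complex.ofReal_inv, smul_eq_mul,
    Complex.re_ofReal_mul]
  congr 1
  simp [Matrix.mulVec, dotProduct, Fin.sum_univ_two, Complex.normSq_apply, pow_two]
  ring

lemma density_nonneg (hD : D.Regular) (v : ℝ → Fin 2 → ℂ) {t : ℝ} (ht : t ∈ Ioo 0 D.σ) :
    0 ≤ D.density v t := by
  obtain ⟨C, _, hC⟩ := hD.bound
  have := (hC t ht).1
  rw [density_eq]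
  positivity

lemma Regular.y_pos (hD : D.Regular) {t : ℝ} (ht : t ∈ Ioo 0 D.σ) : 0 < D.y t := by
  obtain ⟨C, _, hC⟩ := hD.bound
  exact (hC t ht).1

/-- The coefficients are bounded and y stays away from 0, so the norm of L²_R is equivalent to the
plain L² norm. The constant is the sum of those for the two directions. -/
lemma exists_density_bound (hD : D.Regular) : ∃ K, 0 ≤ K ∧ ∀ v : ℝ → Fin 2 → ℂ, ∀ t ∈ Ioo 0 D.σ,
    D.density v t ≤ K * ‖v t‖ ^ 2 ∧ ‖v t‖ ^ 2 ≤ K * D.density v t := by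
  obtain ⟨C, hC0, hC⟩ := hD.bound
  refine ⟨C * ((1 + C) ^ 2 + C ^ 2) + 2 * C * (2 + 2 * C ^ 4 + C ^ 2), by positivity,
    fun v t ht => ?_⟩
  obtain ⟨hy, hx, hyC, hyi⟩ := hC t ht
  have hn0 := norm_le_pi_norm (v t) 0
  have hn1 := norm_le_pi_norm (v t) 1
  rw [density_eq]
  set y := D.y t
  set x := D.x t
  have hx1 : ‖(x : ℂ) * v t 1‖ ≤ C * ‖v t 1‖ := by
    rw [norm_mul, Complex.norm_real, Real.norm_eq_abs]
    gcongr
  have ha : ‖v t 0 - x * v t 1‖ ≤ (1 + C) * ‖v t‖ := by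
    refine (norm_sub_le _ _).trans ?_
    have := mul_le_mul_of_nonneg_left hn1 hC0
    linarith
  have hb : ‖v t 0‖ ≤ ‖v t 0 - x * v t 1‖ + C * ‖v t 1‖ := by
    calc ‖v t 0‖ = ‖(v t 0 - x * v t 1) + x * v t 1‖ := by rw [sub_add_cancel]
      _ ≤ _ := (norm_add_le _ _).trans (by linarith)
  have h2y : (2 * y)⁻¹ ≤ C := by
    rw [mul_inv]
    have : 0 < y⁻¹ := inv_pos.2 hy
    linarith
  constructor
  · calc (2 * y)⁻¹ * (‖v t 0 - x * v t 1‖ ^ 2 + y ^ 2 * ‖v t 1‖ ^ 2)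
        ≤ C * (((1 + C) * ‖v t‖) ^ 2 + C ^ 2 * ‖v t‖ ^ 2) := by gcongr
      _ = C * ((1 + C) ^ 2 + C ^ 2) * ‖v t‖ ^ 2 := by ring
      _ ≤ _ := by
        gcongr
        have : 0 ≤ 2 * C * (2 + 2 * C ^ 4 + C ^ 2) := by positivity
        linarith
  · set a := ‖v t 0 - x * v t 1‖
    set b := ‖v t 1‖
    have hdens : (a ^ 2 + y ^ 2 * b ^ 2) ≤ 2 * C * ((2 * y)⁻¹ * (a ^ 2 + y ^ 2 * b ^ 2)) := by
      have h1 : 1 ≤ 2 * C * (2 * y)⁻¹ := by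
        rw [← div_eq_mul_inv, one_le_div (by positivity)]
        linarith
      have h2 : 0 ≤ a ^ 2 + y ^ 2 * b ^ 2 := by positivity
      nlinarith
    have hb2 : b ^ 2 ≤ C ^ 2 * (a ^ 2 + y ^ 2 * b ^ 2) := by
      have h1 : 1 ≤ C * y := by
        have := mul_le_mul_of_nonneg_right hyi hy.le
        rwa [inv_mul_cancel₀ hy.ne'] at this
      have h2 : 1 ≤ (C * y) ^ 2 := one_le_pow₀ h1
      have h3 : b ^ 2 ≤ (C * y) ^ 2 * b ^ 2 := le_mul_of_one_le_left (sq_nonneg b) h2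
      have h4 : 0 ≤ C ^ 2 * a ^ 2 := by positivity
      nlinarith
    have h0 : ‖v t 0‖ ^ 2 ≤ 2 * a ^ 2 + 2 * C ^ 2 * b ^ 2 := by
      have : ‖v t 0‖ ^ 2 ≤ (a + C * b) ^ 2 := by gcongr
      nlinarith [sq_nonneg (a - C * b)]
    have hE : 0 ≤ a ^ 2 + y ^ 2 * b ^ 2 := by positivity
    have hv : ‖v t‖ ^ 2 ≤ (2 + 2 * C ^ 4 + C ^ 2) * (a ^ 2 + y ^ 2 * b ^ 2) := by
      have hmax : ‖v t‖ ^ 2 ≤ ‖v t 0‖ ^ 2 + b ^ 2 := by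
        have hle : ‖v t‖ ≤ √(‖v t 0‖ ^ 2 + b ^ 2) := by
          refine (pi_norm_le_iff_of_nonneg (Real.sqrt_nonneg _)).2 fun i => ?_
          refine Real.le_sqrt_of_sq_le ?_
          fin_cases i
          · simpa using sq_nonneg b
          · simp [b]
        calc ‖v t‖ ^ 2 ≤ √(‖v t 0‖ ^ 2 + b ^ 2) ^ 2 := by gcongr
          _ = _ := Real.sq_sqrt (by positivity)
      have h5 : C ^ 2 * b ^ 2 ≤ C ^ 2 * (C ^ 2 * (a ^ 2 + y ^ 2 * b ^ 2)) := by gcongr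
      have h6 : 0 ≤ y ^ 2 * b ^ 2 := by positivity
      nlinarith
    calc ‖v t‖ ^ 2 ≤ (2 + 2 * C ^ 4 + C ^ 2) * (a ^ 2 + y ^ 2 * b ^ 2) := hv
      _ ≤ (2 + 2 * C ^ 4 + C ^ 2) * (2 * C * ((2 * y)⁻¹ * (a ^ 2 + y ^ 2 * b ^ 2))) := by gcongr
      _ = 2 * C * (2 + 2 * C ^ 4 + C ^ 2) * ((2 * y)⁻¹ * (a ^ 2 + y ^ 2 * b ^ 2)) := by ring
      _ ≤ _ := by
        gcongr
        have : 0 ≤ C * ((1 + C) ^ 2 + C ^ 2) := by positivity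
        linarith

lemma exists_gen_bound (hD : D.Regular) :
    ∃ K, ∀ t ∈ Ioo 0 D.σ, ∀ i j, ‖D.gen t i j‖ ≤ K := by
  obtain ⟨C, hC0, hC⟩ := hD.bound
  refine ⟨C * (2 * C ^ 2 + C + 1), fun t ht i j => ?_⟩
  obtain ⟨hy, hx, hyC, hyi⟩ := hC t ht
  have hx2 : D.x t ^ 2 ≤ C ^ 2 := sq_le_sq' (by linarith [neg_abs_le (D.x t)]) (by linarith [le_abs_self (D.x t)])
  have hy2 : D.y t ^ 2 ≤ C ^ 2 := by gcongr
  have h2y : ‖((2 * D.y t : ℝ) : ℂ)⁻¹‖ ≤ C := by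
    rw [← Complex.ofReal_inv, Complex.norm_real, Real.norm_of_nonneg (by positivity), mul_inv]
    have : 0 < (D.y t)⁻¹ := inv_pos.2 hy
    linarith
  rw [gen, Matrix.smul_apply, smul_eq_mul, norm_mul]
  refine mul_le_mul h2y ?_ (norm_nonneg _) hC0
  have hC2 := sq_nonneg C
  fin_cases i <;> fin_cases j
  · simp; linarith
  · have : ((D.x t : ℂ) ^ 2 + (D.y t : ℂ) ^ 2) = ((D.x t ^ 2 + D.y t ^ 2 : ℝ) : ℂ) := by
      push_cast; ring
    simp only [Fin.zero_eta, Fin.mk_one, Matrix.of_apply, Matrix.cons_val', Matrix.cons_val_one,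
      Matrix.cons_val_zero, Matrix.cons_val_fin_one, this]
    rw [Complex.norm_real, Real.norm_of_nonneg (by positivity)]
    linarith
  · simp; positivity
  · simp; linarith

lemma aestronglyMeasurable_gen (hD : D.Regular) (i j : Fin 2) {ν : Measure ℝ} :
    AEStronglyMeasurable (fun t => D.gen t i j) ν := by
  have hx : Measurable fun t => (D.x t : ℂ) := Complex.measurable_ofReal.comp hD.measurable_x
  have hy : Measurable fun t => (D.y t : ℂ) := Complex.measurable_ofReal.comp hD.measurable_y
  refine Measurable.aestronglyMeasurable ?_
  fin_cases i <;> fin_cases j <;> simp [gen] <;> fun_prop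

lemma memLp_gen_mulVec (hD : D.Regular) {p : ENNReal} {g : ℝ → Fin 2 → ℂ}
    (hg : MemLp g p D.vol) : MemLp (fun t => D.gen t *ᵥ g t) p D.vol := by
  obtain ⟨K, hK⟩ := exists_gen_bound hD
  refine memLp_mulVec (K := K) (fun i j => aestronglyMeasurable_gen hD i j) ?_ hg
  filter_upwards [ae_vol_mem] with t ht using hK t ht

lemma aestronglyMeasurable_density (hD : D.Regular) {v : ℝ → Fin 2 → ℂ}
    (hv : AEStronglyMeasurable v D.vol) : AEStronglyMeasurable (D.density v) D.vol := by
  have hx : Measurable fun t => (D.x t : ℂ) := Complex.measurable_ofReal.comp hD.measurable_x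
  have hy := hD.measurable_y
  have h0 := aemeasurable_pi_iff.1 hv.aemeasurable 0
  have h1 := aemeasurable_pi_iff.1 hv.aemeasurable 1
  refine AEMeasurable.aestronglyMeasurable ?_
  simp only [funext (density_eq v)]
  exact ((hy.const_mul 2).inv.aemeasurable).mul
    (((h0.sub (hx.aemeasurable.mul h1)).norm.pow_const 2).add
      ((hy.pow_const 2).aemeasurable.mul (h1.norm.pow_const 2)))

lemma memL2R_iff (hD : D.Regular) {v : ℝ → Fin 2 → ℂ} : D.MemL2R v ↔ MemLp v 2 D.vol := by
  obtain ⟨K, _, hK⟩ := exists_density_bound hD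
  constructor
  · rintro ⟨hm, hi⟩
    refine (memLp_two_iff_integrable_sq_norm hm).2 ?_
    refine (hi.const_mul K).mono' (hm.norm.pow 2) ?_
    filter_upwards [ae_vol_mem] with t ht
    rw [Real.norm_of_nonneg (sq_nonneg _)]
    exact (hK v t ht).2
  · intro h
    refine ⟨h.1, ?_⟩
    refine (((memLp_two_iff_integrable_sq_norm h.1).1 h).const_mul K).mono'
      (aestronglyMeasurable_density hD h.1) ?_
    filter_upwards [ae_vol_mem] with t ht
    rw [Real.norm_of_nonneg (density_nonneg hD v ht)]
    exact (hK v t ht).1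

instance : IsFiniteMeasure D.vol := by rw [vol]; infer_instance

end DiracOp

/-! ### Fundamental matrices, variation of constants and the resolvent set -/

namespace DiracOp

/-- The fundamental matrix of `τ v = z v`. -/
structure FundSol (D : DiracOp) (z : ℂ) (M : ℝ → Matrix (Fin 2) (Fin 2) ℂ) : Prop where
  zero : M 0 = 1
  det : ∀ t, (M t).det = 1
  ac : ∀ i j, AbsolutelyContinuousOnInterval (fun t => M t i j) 0 D.σ
  hasDerivAt : ∀ᵐ t, t ∈ Ioo 0 D.σ → ∀ i j,
    HasDerivAt (fun t => M t i j) ((z • (D.gen t * M t)) i j) t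

variable {D : DiracOp} {z : ℂ} {M : ℝ → Matrix (Fin 2) (Fin 2) ℂ}

lemma FundSol.zero_one : FundSol D 0 (fun _ => 1) where
  zero := rfl
  det := fun _ => Matrix.det_one
  ac := fun i j => AbsolutelyContinuousOnInterval.const _
  hasDerivAt := ae_of_all _ fun t _ i j => by simpa using hasDerivAt_const t _

lemma FundSol.mul_adjugate (hM : FundSol D z M) (t : ℝ) : M t * (M t).adjugate = 1 := by
  rw [Matrix.mul_adjugate, hM.det, one_smul]

lemma FundSol.adjugate_mul (hM : FundSol D z M) (t : ℝ) : (M t).adjugate * M t = 1 := by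
  rw [Matrix.adjugate_mul, hM.det, one_smul]

lemma FundSol.adjugate_ac (hM : FundSol D z M) (i j : Fin 2) :
    AbsolutelyContinuousOnInterval (fun t => (M t).adjugate i j) 0 D.σ := by
  simp only [Matrix.adjugate_fin_two]
  fin_cases i <;> fin_cases j
  · exact hM.ac 1 1
  · exact (hM.ac 0 1).neg
  · exact (hM.ac 1 0).neg
  · exact hM.ac 0 0

/-- As det M = 1, the adjugate is M⁻¹, and this is (M⁻¹)' = -M⁻¹ M' M⁻¹. Entrywise it amounts to J⁻¹
R having trace zero. -/
lemma FundSol.adjugate_deriv (hM : FundSol D z M) : ∀ᵐ t, t ∈ Ioo 0 D.σ → ∀ i j,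
    HasDerivAt (fun t => (M t).adjugate i j) ((-(z • ((M t).adjugate * D.gen t))) i j) t := by
  filter_upwards [hM.hasDerivAt] with t ht hmem i j
  have h := ht hmem
  simp only [Matrix.adjugate_fin_two]
  fin_cases i <;> fin_cases j
  · refine (h 1 1).congr_deriv ?_
    simp only [Matrix.smul_apply, Matrix.neg_apply, Matrix.mul_apply, Fin.sum_univ_two]
    simp [gen]
    ring
  · refine (h 0 1).neg.congr_deriv ?_
    simp only [Matrix.smul_apply, Matrix.neg_apply, Matrix.mul_apply, Fin.sum_univ_two, smul_eq_mul]
    simp only [gen, Matrix.smul_apply, smul_eq_mul, Fin.isValue, Fin.zero_eta, Fin.mk_one,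
      Matrix.of_apply, Matrix.cons_val', Matrix.cons_val_zero, Matrix.cons_val_one,
      Matrix.cons_val_fin_one]
    ring
  · refine (h 1 0).neg.congr_deriv ?_
    simp only [Matrix.smul_apply, Matrix.neg_apply, Matrix.mul_apply, Fin.sum_univ_two, smul_eq_mul]
    simp only [gen, Matrix.smul_apply, smul_eq_mul, Fin.isValue, Fin.zero_eta, Fin.mk_one,
      Matrix.of_apply, Matrix.cons_val', Matrix.cons_val_zero, Matrix.cons_val_one,
      Matrix.cons_val_fin_one]
    ring
  · refine (h 0 0).congr_deriv ?_
    simp only [Matrix.smul_apply, Matrix.neg_apply, Matrix.mul_apply, Fin.sum_univ_two]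
    simp [gen]
    ring

lemma exists_entry_bound {A : ℝ → Matrix (Fin 2) (Fin 2) ℂ} (hσ : 0 < D.σ)
    (h : ∀ i j, AbsolutelyContinuousOnInterval (fun t => A t i j) 0 D.σ) :
    ∃ K, 0 ≤ K ∧ ∀ t ∈ Icc 0 D.σ, ∀ i j, ‖A t i j‖ ≤ K := by
  choose K hK using fun i j => (h i j).exists_bound
  refine ⟨∑ i, ∑ j, |K i j|, by positivity, fun t ht i j => ?_⟩
  rw [uIcc_of_le hσ.le] at hK
  calc ‖A t i j‖ ≤ |K i j| := (hK i j t ht).trans (le_abs_self _)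
    _ ≤ ∑ j, |K i j| :=
      Finset.single_le_sum (f := fun j => |K i j|) (fun _ _ => abs_nonneg _) (Finset.mem_univ j)
    _ ≤ _ := Finset.single_le_sum (f := fun i => ∑ j, |K i j|)
      (fun _ _ => Finset.sum_nonneg fun _ _ => abs_nonneg _) (Finset.mem_univ i)

lemma aestronglyMeasurable_of_ac {E : Type*} [NormedAddCommGroup E] [SecondCountableTopology E]
    {f : ℝ → E} (hσ : 0 < D.σ) (h : AbsolutelyContinuousOnInterval f 0 D.σ) :
    AEStronglyMeasurable f D.vol := by
  have hc := h.continuousOn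
  rw [uIcc_of_le hσ.le] at hc
  exact (hc.mono Ioc_subset_Icc_self).aestronglyMeasurable measurableSet_Ioc

lemma memLp_of_ac {E : Type*} [NormedAddCommGroup E] [SecondCountableTopology E]
    {f : ℝ → E} (hσ : 0 < D.σ) (h : AbsolutelyContinuousOnInterval f 0 D.σ) {p : ENNReal} :
    MemLp f p D.vol := by
  obtain ⟨C, hC⟩ := h.exists_bound
  rw [uIcc_of_le hσ.le] at hC
  refine MemLp.of_bound (aestronglyMeasurable_of_ac hσ h) C ?_
  filter_upwards [ae_vol_mem] with t ht using hC t (Ioo_subset_Icc_self ht)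

lemma intervalIntegrable_of_vol {E : Type*} [NormedAddCommGroup E] {f : ℝ → E} (hσ : 0 < D.σ)
    (h : Integrable f D.vol) : IntervalIntegrable f volume 0 D.σ :=
  (intervalIntegrable_iff_integrableOn_Ioc_of_le hσ.le).2 h

/-- The integrand of the variation of constants formula. -/
def source (D : DiracOp) (M : ℝ → Matrix (Fin 2) (Fin 2) ℂ) (g : ℝ → Fin 2 → ℂ) (t : ℝ) :
    Fin 2 → ℂ := (M t).adjugate *ᵥ (D.gen t *ᵥ g t)

lemma FundSol.memLp_source (hM : FundSol D z M) (hD : D.Regular) {p : ENNReal}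
    {g : ℝ → Fin 2 → ℂ} (hg : MemLp g p D.vol) : MemLp (D.source M g) p D.vol := by
  obtain ⟨K, _, hK⟩ := exists_entry_bound hD.pos hM.adjugate_ac
  refine memLp_mulVec (K := K)
    (fun i j => aestronglyMeasurable_of_ac hD.pos (hM.adjugate_ac i j)) ?_ (memLp_gen_mulVec hD hg)
  filter_upwards [ae_vol_mem] with t ht using hK t (Ioo_subset_Icc_self ht)

lemma FundSol.intervalIntegrable_source (hM : FundSol D z M) (hD : D.Regular)
    {g : ℝ → Fin 2 → ℂ} (hg : Integrable g D.vol) :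
    IntervalIntegrable (D.source M g) volume 0 D.σ :=
  intervalIntegrable_of_vol hD.pos
    (memLp_one_iff_integrable.1 (hM.memLp_source hD (memLp_one_iff_integrable.2 hg)))

/-- The variation of constants formula. -/
def varConst (D : DiracOp) (M : ℝ → Matrix (Fin 2) (Fin 2) ℂ) (c : Fin 2 → ℂ)
    (g : ℝ → Fin 2 → ℂ) (t : ℝ) : Fin 2 → ℂ := M t *ᵥ (c + ∫ s in (0 : ℝ)..t, D.source M g s)

lemma FundSol.varConst_ac (hM : FundSol D z M) (hD : D.Regular) (c : Fin 2 → ℂ)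
    {g : ℝ → Fin 2 → ℂ} (hg : Integrable g D.vol) :
    AbsolutelyContinuousOnInterval (D.varConst M c g) 0 D.σ :=
  AbsolutelyContinuousOnInterval.mulVec hM.ac ((AbsolutelyContinuousOnInterval.const c).add
    (AbsolutelyContinuousOnInterval.intervalIntegral (hM.intervalIntegrable_source hD hg)
      left_mem_uIcc))

lemma FundSol.varConst_zero (hM : FundSol D z M) (c : Fin 2 → ℂ) (g : ℝ → Fin 2 → ℂ) :
    D.varConst M c g 0 = c := by
  simp [varConst, hM.zero]

lemma FundSol.tau_varConst (hM : FundSol D z M) (hD : D.Regular) (c : Fin 2 → ℂ)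
    {g : ℝ → Fin 2 → ℂ} (hg : Integrable g D.vol) :
    ∀ᵐ t ∂D.vol, D.tau (D.varConst M c g) t = z • D.varConst M c g t + g t := by
  rw [ae_vol_iff]
  filter_upwards [hM.hasDerivAt, (hM.intervalIntegrable_source hD hg).ae_hasDerivAt_integral]
    with t h1 h2 ht
  have ht' : t ∈ uIcc 0 D.σ := by
    rw [uIcc_of_le hD.pos.le]; exact Ioo_subset_Icc_self ht
  rw [tau_eq_iff (hD.y_pos ht).ne']
  have h3 := hasDerivAt_mulVec (M' := z • (D.gen t * M t)) (h1 ht)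
    ((h2 ht' 0 left_mem_uIcc).const_add c)
  have h4 : deriv (D.varConst M c g) t = _ := h3.deriv
  rw [h4, source, Matrix.mulVec_mulVec (D.gen t *ᵥ g t), hM.mul_adjugate, Matrix.one_mulVec,
    Matrix.mulVec_add (D.gen t), Matrix.mulVec_smul, varConst, Matrix.smul_mulVec,
    Matrix.mulVec_mulVec]

/-- The derivative of M⁻¹ v is the source term. As v is only absolutely continuous away from 0,
integration runs from ε to σ; the source is integrable up to 0, which supplies the constant c. -/
lemma FundSol.eq_varConst (hM : FundSol D z M) (hD : D.Regular) {v g : ℝ → Fin 2 → ℂ}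
    (hg : Integrable g D.vol)
    (hv : ∀ ε ∈ Ioc 0 D.σ, AbsolutelyContinuousOnInterval v ε D.σ)
    (h : ∀ᵐ t ∂D.vol, D.tau v t = z • v t + g t) :
    ∃ c, ∀ t ∈ Ioc 0 D.σ, v t = D.varConst M c g t := by
  have hS := hM.intervalIntegrable_source hD hg
  have key : ∀ ε ∈ Ioc 0 D.σ, (M D.σ).adjugate *ᵥ v D.σ - (M ε).adjugate *ᵥ v ε
      = ∫ s in ε..D.σ, D.source M g s := by
    intro ε hε
    have hsub : uIcc ε D.σ ⊆ uIcc 0 D.σ := by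
      rw [uIcc_of_le hε.2, uIcc_of_le hD.pos.le]
      exact Icc_subset_Icc_left hε.1.le
    refine AbsolutelyContinuousOnInterval.sub_eq_integral
      (f := fun t => (M t).adjugate *ᵥ v t)
      (AbsolutelyContinuousOnInterval.mulVec (fun i j => (hM.adjugate_ac i j).mono hsub)
        (hv ε hε)) (hS.mono_set hsub) ?_
    have hne : ∀ᵐ t : ℝ, t ≠ D.σ := by simp [ae_iff, measure_singleton]
    filter_upwards [hM.adjugate_deriv, (hv ε hε).ae_hasDerivAt, ae_vol_iff.1 h, hne]
      with t h1 h2 h3 h4 ht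
    have ht0 : t ∈ Ioo 0 D.σ := by
      rw [uIcc_of_le hε.2] at ht
      exact ⟨hε.1.trans_le ht.1, lt_of_le_of_ne ht.2 h4⟩
    refine (hasDerivAt_mulVec (h1 ht0) (h2 ht)).congr_deriv ?_
    rw [(tau_eq_iff (hD.y_pos ht0).ne' v _).1 (h3 ht0), source, Matrix.mulVec_add,
      Matrix.mulVec_add, Matrix.neg_mulVec, Matrix.smul_mulVec, Matrix.mulVec_smul,
      Matrix.mulVec_smul, Matrix.mulVec_mulVec]
    abel
  refine ⟨(M D.σ).adjugate *ᵥ v D.σ - ∫ s in (0 : ℝ)..D.σ, D.source M g s, fun t ht => ?_⟩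
  have hk := key t ht
  have ht' : t ∈ uIcc 0 D.σ := by
    rw [uIcc_of_le hD.pos.le]; exact Ioc_subset_Icc_self ht
  have hadd := intervalIntegral.integral_add_adjacent_intervals
    (hS.mono_set (uIcc_subset_uIcc left_mem_uIcc ht'))
    (hS.mono_set (uIcc_subset_uIcc ht' right_mem_uIcc))
  have : (M t).adjugate *ᵥ v t = (M D.σ).adjugate *ᵥ v D.σ - (∫ s in (0 : ℝ)..D.σ, D.source M g s)
      + ∫ s in (0 : ℝ)..t, D.source M g s := by
    rw [← hadd, ← hk]; abel
  rw [varConst, ← this, Matrix.mulVec_mulVec, hM.mul_adjugate, Matrix.one_mulVec]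

lemma dot_J_u0 (hD : D.Regular) (v : Fin 2 → ℂ) : v ⬝ᵥ vecC (J *ᵥ D.u0) = v 1 := by
  simp [vecC, J, hD.u0_eq, dotProduct, Fin.sum_univ_two, Matrix.mulVec]

lemma dot_J_u1 (hD : D.Regular) (v : Fin 2 → ℂ) : v ⬝ᵥ vecC (J *ᵥ D.u1) = D.bdry v := by
  simp [vecC, J, hD.u1_eq, bdry, dotProduct, Fin.sum_univ_two, Matrix.mulVec]
  ring

lemma tendsto_zero_of_ac (hσ : 0 < D.σ) {v w : ℝ → Fin 2 → ℂ}
    (hw : AbsolutelyContinuousOnInterval w 0 D.σ) (h : ∀ t ∈ Ioc 0 D.σ, v t = w t) :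
    Tendsto v (𝓝[>] 0) (𝓝 (w 0)) := by
  have hc := hw.continuousOn 0 left_mem_uIcc
  rw [uIcc_of_le hσ.le] at hc
  have hc' := (hc.mono Ioc_subset_Icc_self).tendsto
  rw [nhdsWithin_Ioc_eq_nhdsGT hσ] at hc'
  refine hc'.congr' ?_
  filter_upwards [Ioc_mem_nhdsGT hσ] with t ht using (h t ht).symm

lemma MemDom.integrable_tau {v : ℝ → Fin 2 → ℂ} (hv : D.MemDom v) (hD : D.Regular) :
    Integrable (D.tau v) D.vol :=
  ((memL2R_iff hD).1 hv.2.2.1).integrable (by norm_num)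

/-- A function in the domain extends to an absolutely continuous function on `[0, σ]`. -/
lemma MemDom.exists_ac {v : ℝ → Fin 2 → ℂ} (hv : D.MemDom v) (hD : D.Regular) :
    ∃ w, AbsolutelyContinuousOnInterval w 0 D.σ ∧ (∀ t ∈ Ioc 0 D.σ, v t = w t) ∧ w 0 1 = 0 := by
  -- At z = 0 the fundamental matrix is 1, and v becomes a constant plus the integral of J⁻¹ R τ v,
  -- which is integrable up to 0.
  have h0 : FundSol D 0 (fun _ => 1) := .zero_one
  obtain ⟨c, hc⟩ := h0.eq_varConst hD (hv.integrable_tau hD) hv.2.1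
    (ae_of_all _ fun t => by simp)
  refine ⟨_, h0.varConst_ac hD c (hv.integrable_tau hD), hc, ?_⟩
  have ht := tendsto_zero_of_ac hD.pos (h0.varConst_ac hD c (hv.integrable_tau hD)) hc
  have h1 := hv.2.2.2.1
  simp only [dot_J_u0 hD] at h1
  exact tendsto_nhds_unique (((continuous_apply 1).tendsto _).comp ht) h1

lemma memDom_of_ac (hD : D.Regular) {v : ℝ → Fin 2 → ℂ}
    (hv : AbsolutelyContinuousOnInterval v 0 D.σ) (h0 : v 0 1 = 0) (h1 : D.bdry (v D.σ) = 0)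
    (ht : D.MemL2R (D.tau v)) : D.MemDom v := by
  refine ⟨(memL2R_iff hD).2 (memLp_of_ac hD.pos hv), fun ε hε => hv.mono ?_, ht, ?_, ?_⟩
  · rw [uIcc_of_le hε.2, uIcc_of_le hD.pos.le]
    exact Icc_subset_Icc_left hε.1.le
  · simp only [dot_J_u0 hD]
    rw [← h0]
    exact ((continuous_apply 1).tendsto _).comp
      (tendsto_zero_of_ac hD.pos hv fun t _ => rfl)
  · rw [dot_J_u1 hD, h1]

/-- The characteristic function of the boundary value problem. -/
def charFun (D : DiracOp) (M : ℝ → Matrix (Fin 2) (Fin 2) ℂ) : ℂ := D.bdry (M D.σ *ᵥ ![1, 0])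

lemma eq_smul_of_apply_one {c : Fin 2 → ℂ} (h : c 1 = 0) : c = c 0 • ![1, 0] := by
  ext i; fin_cases i <;> simp [h]

/-- The regular solution. -/
def regSol (M : ℝ → Matrix (Fin 2) (Fin 2) ℂ) (t : ℝ) : Fin 2 → ℂ := M t *ᵥ ![1, 0]

/-- The boundary condition at 0 leaves only multiples of the regular solution; the one at σ then
reads κ F = 0. -/
lemma FundSol.eq_smul_regSol (hM : FundSol D z M) (hD : D.Regular) {v : ℝ → Fin 2 → ℂ}
    (hv : D.MemDom v) (h : ∀ᵐ t ∂D.vol, D.tau v t = z • v t) :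
    ∃ κ : ℂ, (∀ t ∈ Ioc 0 D.σ, v t = κ • regSol M t) ∧ κ * D.charFun M = 0 := by
  obtain ⟨c, hc⟩ := hM.eq_varConst hD (g := 0) (integrable_zero _ _ _) hv.2.1
    (by simpa using h)
  have ht := tendsto_zero_of_ac hD.pos (hM.varConst_ac hD c (integrable_zero _ _ _)) hc
  have h1 := hv.2.2.2.1
  simp only [dot_J_u0 hD] at h1
  have hc1 := tendsto_nhds_unique (((continuous_apply 1).tendsto _).comp ht) h1
  rw [hM.varConst_zero] at hc1
  have heq : ∀ t ∈ Ioc 0 D.σ, v t = c 0 • regSol M t := by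
    intro t ht
    rw [hc t ht, varConst, regSol]
    simp only [source, Pi.zero_apply, Matrix.mulVec_zero, intervalIntegral.integral_zero, add_zero]
    conv_lhs => rw [eq_smul_of_apply_one hc1, Matrix.mulVec_smul]
  refine ⟨c 0, heq, ?_⟩
  have h2 := hv.2.2.2.2
  rw [dot_J_u1 hD, heq _ (right_mem_Ioc.2 hD.pos), bdry_smul] at h2
  exact h2

lemma FundSol.regSol_ac (hM : FundSol D z M) :
    AbsolutelyContinuousOnInterval (regSol M) 0 D.σ :=
  AbsolutelyContinuousOnInterval.mulVec hM.ac (AbsolutelyContinuousOnInterval.const _)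

lemma regSol_eq_varConst (M : ℝ → Matrix (Fin 2) (Fin 2) ℂ) :
    regSol M = D.varConst M ![1, 0] 0 := by
  ext t : 1
  simp [regSol, varConst, source]

lemma FundSol.tau_regSol (hM : FundSol D z M) (hD : D.Regular) :
    ∀ᵐ t ∂D.vol, D.tau (regSol M) t = z • regSol M t := by
  simpa [← regSol_eq_varConst] using
    hM.tau_varConst hD ![1, 0] (g := 0) (integrable_zero _ _ _)

lemma MemL2R.congr_ae {v w : ℝ → Fin 2 → ℂ} (hD : D.Regular) (hv : D.MemL2R v)
    (h : w =ᵐ[D.vol] v) : D.MemL2R w :=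
  (memL2R_iff hD).2 (((memL2R_iff hD).1 hv).ae_eq h.symm)

lemma FundSol.memDom_regSol (hM : FundSol D z M) (hD : D.Regular) (hF : D.charFun M = 0) :
    D.MemDom (regSol M) := by
  refine memDom_of_ac hD hM.regSol_ac (by simp [regSol, hM.zero]) hF ?_
  refine MemL2R.congr_ae hD ?_ (hM.tau_regSol hD)
  exact (memL2R_iff hD).2 ((memLp_of_ac hD.pos hM.regSol_ac).const_smul z)

lemma FundSol.regSol_ne_zero (hM : FundSol D z M) (t : ℝ) : regSol M t ≠ 0 := by
  intro h
  have h2 := congrArg (fun v => (M t).adjugate *ᵥ v) h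
  simp only [regSol, Matrix.mulVec_mulVec, hM.adjugate_mul, Matrix.one_mulVec,
    Matrix.mulVec_zero] at h2
  simpa using congrFun h2 0

lemma FundSol.isEigenvalue (hM : FundSol D z M) (hD : D.Regular) (hF : D.charFun M = 0) :
    D.IsEigenvalue z :=
  ⟨_, hM.memDom_regSol hD hF, hM.tau_regSol hD, D.σ, right_mem_Ioc.2 hD.pos,
    hM.regSol_ne_zero _⟩

lemma FundSol.eq_zero_of_charFun_ne (hM : FundSol D z M) (hD : D.Regular) (hF : D.charFun M ≠ 0)
    {v : ℝ → Fin 2 → ℂ} (hv : D.MemDom v) (h : ∀ᵐ t ∂D.vol, D.tau v t = z • v t) :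
    ∀ t ∈ Ioc 0 D.σ, v t = 0 := by
  obtain ⟨κ, h1, h2⟩ := hM.eq_smul_regSol hD hv h
  intro t ht
  rw [h1 t ht, (mul_eq_zero.1 h2).resolve_right hF, zero_smul]

lemma norm_bdry_le (v : Fin 2 → ℂ) : ‖D.bdry v‖ ≤ (1 + |D.u1 0|) * ‖v‖ := by
  refine (norm_add_le _ _).trans ?_
  rw [norm_mul, Complex.norm_real, Real.norm_eq_abs]
  have h0 := norm_le_pi_norm v 0
  have h1 := mul_le_mul_of_nonneg_left (norm_le_pi_norm v 1) (abs_nonneg (D.u1 0))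
  linarith

/-- Cauchy–Schwarz against the constant 1, obtained by integrating the square of ‖g‖ minus its mean.
-/
lemma sq_integral_norm_le (hσ : 0 < D.σ) {g : ℝ → Fin 2 → ℂ} (hg : MemLp g 2 D.vol) :
    (∫ t, ‖g t‖ ∂D.vol) ^ 2 ≤ D.σ * ∫ t, ‖g t‖ ^ 2 ∂D.vol := by
  have h1 : Integrable (fun t => ‖g t‖) D.vol := (hg.integrable (by norm_num)).norm
  have h2 := (memLp_two_iff_integrable_sq_norm hg.1).1 hg
  have hreal : D.vol.real univ = D.σ := by
    simp [vol, Measure.real, hσ.le]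
  set G := ∫ t, ‖g t‖ ∂D.vol
  have h3 : 0 ≤ ∫ t, (‖g t‖ - G / D.σ) ^ 2 ∂D.vol := integral_nonneg fun t => sq_nonneg _
  have h4 : ∫ t, (‖g t‖ - G / D.σ) ^ 2 ∂D.vol
      = (∫ t, ‖g t‖ ^ 2 ∂D.vol) - 2 * (G / D.σ) * G + D.σ * (G / D.σ) ^ 2 := by
    have : ∀ t, (‖g t‖ - G / D.σ) ^ 2
        = ‖g t‖ ^ 2 - 2 * (G / D.σ) * ‖g t‖ + (G / D.σ) ^ 2 := fun t => by ring
    simp only [this]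
    have hi : Integrable (fun t => ‖g t‖ ^ 2 - 2 * (G / D.σ) * ‖g t‖) D.vol :=
      h2.sub (h1.const_mul _)
    rw [integral_add hi (integrable_const _),
      integral_sub h2 (h1.const_mul _), integral_const_mul, integral_const, hreal, smul_eq_mul]
  rw [h4] at h3
  have h5 : D.σ * ((∫ t, ‖g t‖ ^ 2 ∂D.vol) - 2 * (G / D.σ) * G + D.σ * (G / D.σ) ^ 2)
      = D.σ * (∫ t, ‖g t‖ ^ 2 ∂D.vol) - G ^ 2 := by
    field_simp
    ring
  have h6 := mul_nonneg hσ.le h3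
  rw [h5] at h6
  linarith

/-- Variation of constants from the initial vector κ [1, 0]ᵗ, which satisfies the condition at 0.
The free scalar κ meets the condition at σ because F ≠ 0. Then sup ‖v‖ is bounded by the L¹ norm of
g, hence by its L² norm. -/
lemma FundSol.exists_bounded_solution (hM : FundSol D z M) (hD : D.Regular)
    (hF : D.charFun M ≠ 0) : ∃ C : ℝ, ∀ g, D.MemL2R g → ∃ v, D.MemDom v ∧
      (∀ᵐ t ∂D.vol, D.tau v t - z • v t = g t) ∧ D.normSqR v ≤ C * D.normSqR g := by
  obtain ⟨K, hK0, hK⟩ := exists_density_bound hD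
  obtain ⟨Kg, hKg⟩ := exists_gen_bound hD
  obtain ⟨Ka, hKa0, hKa⟩ := exists_entry_bound hD.pos hM.adjugate_ac
  obtain ⟨Km, hKm0, hKm⟩ := exists_entry_bound hD.pos hM.ac
  set q := 1 + |D.u1 0|
  have hq : 0 ≤ q := by positivity
  -- K1 bounds the source by ‖g‖; K2 and K3 below bound κ and v by the L¹ norm of g.
  set K1 := 2 * Ka * (2 * Kg)
  have hKg0 : 0 ≤ Kg := by
    have h := hKg (D.σ / 2) ⟨by linarith [hD.pos], by linarith [hD.pos]⟩ 0 0
    exact (norm_nonneg _).trans h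
  have hK1 : 0 ≤ K1 := by positivity
  set K2 := q * (2 * Km * K1) / ‖D.charFun M‖
  set K3 := 2 * Km * (K2 + K1)
  have hK3 : 0 ≤ K3 := by positivity
  refine ⟨K * K3 ^ 2 * D.σ * (D.σ * K), fun g hg => ?_⟩
  have hg2 := (memL2R_iff hD).1 hg
  have hgi : Integrable g D.vol := hg2.integrable (by norm_num)
  set G := ∫ t, ‖g t‖ ∂D.vol with hG
  have hG0 : 0 ≤ G := integral_nonneg fun _ => norm_nonneg _
  have hS := hM.intervalIntegrable_source hD hgi
  have hI : ∀ t ∈ Icc 0 D.σ, ‖∫ s in (0 : ℝ)..t, D.source M g s‖ ≤ K1 * G := by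
    intro t ht
    have hSi := (memLp_one_iff_integrable.1
      (hM.memLp_source hD (memLp_one_iff_integrable.2 hgi)))
    calc ‖∫ s in (0 : ℝ)..t, D.source M g s‖ ≤ ∫ s in (0 : ℝ)..t, ‖D.source M g s‖ :=
          intervalIntegral.norm_integral_le_integral_norm ht.1
      _ ≤ ∫ s, ‖D.source M g s‖ ∂D.vol := by
          rw [intervalIntegral.integral_of_le ht.1]
          exact setIntegral_mono_set hSi.norm (ae_of_all _ fun _ => norm_nonneg _)
            (Ioc_subset_Ioc_right ht.2).eventuallyLE
      _ ≤ ∫ s, K1 * ‖g s‖ ∂D.vol := by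
          refine integral_mono_ae hSi.norm (hgi.norm.const_mul _) ?_
          filter_upwards [ae_vol_mem] with s hs
          calc ‖D.source M g s‖ ≤ 2 * Ka * ‖D.gen s *ᵥ g s‖ :=
                norm_mulVec_le_of_entry (hKa s (Ioo_subset_Icc_self hs)) _
            _ ≤ 2 * Ka * (2 * Kg * ‖g s‖) := by
                gcongr
                exact norm_mulVec_le_of_entry (hKg s hs) _
            _ = K1 * ‖g s‖ := by ring
      _ = K1 * G := integral_const_mul _ _
  -- The solution of κ F + (boundary form of M(σ) ∫ source) = 0.
  set κ : ℂ := -D.bdry (M D.σ *ᵥ ∫ s in (0 : ℝ)..D.σ, D.source M g s) / D.charFun M with hκ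
  have hκn : ‖κ‖ ≤ K2 * G := by
    have hσm : D.σ ∈ Icc 0 D.σ := right_mem_Icc.2 hD.pos.le
    rw [hκ, norm_div, norm_neg]
    calc _ ≤ (q * (2 * Km * (K1 * G))) / ‖D.charFun M‖ := by
          gcongr
          refine (norm_bdry_le _).trans ?_
          gcongr
          refine (norm_mulVec_le_of_entry (hKm _ hσm) _).trans ?_
          gcongr
          exact hI _ hσm
      _ = K2 * G := by ring
  have hcn : ‖κ • (![1, 0] : Fin 2 → ℂ)‖ ≤ K2 * G := by
    rw [norm_smul]
    have : ‖(![1, 0] : Fin 2 → ℂ)‖ ≤ 1 := by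
      refine (pi_norm_le_iff_of_nonneg zero_le_one).2 fun i => ?_
      fin_cases i <;> simp
    calc _ ≤ ‖κ‖ * 1 := by gcongr
      _ ≤ _ := by rwa [mul_one]
  set v := D.varConst M (κ • ![1, 0]) g with hv
  have hac := hM.varConst_ac hD (κ • ![1, 0]) hgi
  have htau := hM.tau_varConst hD (κ • ![1, 0]) hgi
  rw [← hv] at hac htau
  have hvn : ∀ t ∈ Icc 0 D.σ, ‖v t‖ ≤ K3 * G := by
    intro t ht
    calc ‖v t‖ ≤ 2 * Km * ‖κ • (![1, 0] : Fin 2 → ℂ) + ∫ s in (0 : ℝ)..t, D.source M g s‖ :=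
          norm_mulVec_le_of_entry (hKm t ht) _
      _ ≤ 2 * Km * (K2 * G + K1 * G) := by
          gcongr
          exact (norm_add_le _ _).trans (add_le_add hcn (hI t ht))
      _ = K3 * G := by ring
  refine ⟨v, memDom_of_ac hD hac ?_ ?_ ?_, ?_, ?_⟩
  · rw [hv, hM.varConst_zero]; simp
  · rw [hv, varConst, Matrix.mulVec_add, bdry_add, Matrix.mulVec_smul, bdry_smul, hκ]
    change _ / _ * D.charFun M + _ = 0
    rw [div_mul_cancel₀ _ hF]
    ring
  · refine MemL2R.congr_ae hD ?_ htau
    exact (memL2R_iff hD).2 (((memLp_of_ac hD.pos hac).const_smul z).add hg2)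
  · filter_upwards [htau] with t ht
    rw [ht]; abel
  · have hreal : D.vol.real univ = D.σ := by
      simp [vol, Measure.real, hD.pos.le]
    have hvL : D.MemL2R v := (memL2R_iff hD).2 (memLp_of_ac hD.pos hac)
    have h1 : D.normSqR v ≤ K * (K3 * G) ^ 2 * D.σ := by
      calc D.normSqR v ≤ ∫ _, K * (K3 * G) ^ 2 ∂D.vol := by
            refine integral_mono_ae hvL.2 (integrable_const _) ?_
            filter_upwards [ae_vol_mem] with t ht
            refine ((hK v t ht).1).trans ?_
            gcongr
            exact hvn t (Ioo_subset_Icc_self ht)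
        _ = _ := by rw [integral_const, hreal, smul_eq_mul, mul_comm]
    have h2 : G ^ 2 ≤ D.σ * (K * D.normSqR g) := by
      refine (sq_integral_norm_le hD.pos hg2).trans ?_
      refine mul_le_mul_of_nonneg_left ?_ hD.pos.le
      rw [normSqR, ← integral_const_mul]
      refine integral_mono_ae ((memLp_two_iff_integrable_sq_norm hg2.1).1 hg2)
        (hg.2.const_mul _) ?_
      filter_upwards [ae_vol_mem] with t ht using (hK g t ht).2
    calc D.normSqR v ≤ K * (K3 * G) ^ 2 * D.σ := h1
      _ = K * K3 ^ 2 * D.σ * G ^ 2 := by ring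
      _ ≤ K * K3 ^ 2 * D.σ * (D.σ * (K * D.normSqR g)) := by
          have := hD.pos
          gcongr
      _ = _ := by ring

lemma FundSol.inResolventSet_iff (hM : FundSol D z M) (hD : D.Regular) :
    D.InResolventSet z ↔ D.charFun M ≠ 0 := by
  constructor
  · rintro ⟨h, _⟩ hF
    exact hM.regSol_ne_zero _ (h _ (hM.memDom_regSol hD hF) (hM.tau_regSol hD) D.σ
      (right_mem_Ioc.2 hD.pos))
  · intro hF
    exact ⟨fun v hv h => hM.eq_zero_of_charFun_ne hD hF hv h, hM.exists_bounded_solution hD hF⟩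

lemma FundSol.isEigenvalue_iff (hM : FundSol D z M) (hD : D.Regular) :
    D.IsEigenvalue z ↔ D.charFun M = 0 := by
  refine ⟨?_, hM.isEigenvalue hD⟩
  rintro ⟨v, hv, h, t, ht, hne⟩
  by_contra hF
  exact hne (hM.eq_zero_of_charFun_ne hD hF hv h t ht)

end DiracOp

/-! ### The bounded inverse and its symmetry -/

namespace DiracOp

variable {D : DiracOp}

lemma MemDom.ae_hasDerivAt {v : ℝ → Fin 2 → ℂ} (hv : D.MemDom v) (hD : D.Regular) :
    ∀ᵐ t ∂D.vol, HasDerivAt v (D.gen t *ᵥ D.tau v t) t := by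
  obtain ⟨w, hw, heq, _⟩ := hv.exists_ac hD
  rw [ae_vol_iff]
  filter_upwards [hw.ae_hasDerivAt] with t ht hmem
  have hv' : v =ᶠ[𝓝 t] w := by
    filter_upwards [Ioo_mem_nhds hmem.1 hmem.2] with s hs using heq s (Ioo_subset_Ioc_self hs)
  have h := (ht (by rw [uIcc_of_le hD.pos.le]; exact Ioo_subset_Icc_self hmem)).congr_of_eventuallyEq hv'
  rw [← deriv_eq_gen_tau (hD.y_pos hmem).ne', h.deriv]
  exact h

/-- `deriv` is linear only where both functions are differentiable, so `tau` is linear only almost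
everywhere. -/
lemma tau_lincomb {v w : ℝ → Fin 2 → ℂ} (hD : D.Regular) (hv : D.MemDom v) (hw : D.MemDom w)
    (a b : ℂ) : ∀ᵐ t ∂D.vol, D.tau (a • v + b • w) t = a • D.tau v t + b • D.tau w t := by
  filter_upwards [hv.ae_hasDerivAt hD, hw.ae_hasDerivAt hD, ae_vol_mem] with t h1 h2 ht
  rw [tau_eq_iff (hD.y_pos ht).ne', Matrix.mulVec_add, Matrix.mulVec_smul, Matrix.mulVec_smul]
  exact ((h1.const_smul a).add (h2.const_smul b)).deriv

lemma MemDom.lincomb {v w : ℝ → Fin 2 → ℂ} (hD : D.Regular) (hv : D.MemDom v)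
    (hw : D.MemDom w) (a b : ℂ) : D.MemDom (a • v + b • w) := by
  obtain ⟨v', hv', hveq, hv0⟩ := hv.exists_ac hD
  obtain ⟨w', hw', hweq, hw0⟩ := hw.exists_ac hD
  have htau := tau_lincomb hD hv hw a b
  refine ⟨(memL2R_iff hD).2 ((((memL2R_iff hD).1 hv.1).const_smul a).add
    (((memL2R_iff hD).1 hw.1).const_smul b)), fun ε hε => ?_, ?_, ?_, ?_⟩
  · exact ((hv.2.1 ε hε).const_smul a).add ((hw.2.1 ε hε).const_smul b)
  · exact MemL2R.congr_ae hD ((memL2R_iff hD).2 ((((memL2R_iff hD).1 hv.2.2.1).const_smul a).add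
      (((memL2R_iff hD).1 hw.2.2.1).const_smul b))) htau
  · have h1 := hv.2.2.2.1
    have h2 := hw.2.2.2.1
    simp only [dot_J_u0 hD] at h1 h2 ⊢
    simpa using (h1.const_mul a).add (h2.const_mul b)
  · have h1 := hv.2.2.2.2
    have h2 := hw.2.2.2.2
    rw [dot_J_u1 hD] at h1 h2 ⊢
    rw [Pi.add_apply, bdry_add, Pi.smul_apply, Pi.smul_apply, bdry_smul, bdry_smul, h1, h2]
    simp

/-- The isometry `v ↦ Y v`, up to a factor, as a map into `L²`-functions. -/
def lift (D : DiracOp) (v : ℝ → Fin 2 → ℂ) (t : ℝ) : EuclideanSpace ℂ (Fin 2) :=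
  WithLp.toLp 2 (toC (D.Y t) *ᵥ v t)

/-- Inverse of `lift`. -/
def unlift (D : DiracOp) (f : ℝ → EuclideanSpace ℂ (Fin 2)) (t : ℝ) : Fin 2 → ℂ :=
  (√(D.y t) : ℂ) • ![f t 0 + D.x t / D.y t * f t 1, f t 1 / D.y t]

lemma lift_apply (v : ℝ → Fin 2 → ℂ) (t : ℝ) (i : Fin 2) :
    D.lift v t i = (toC (D.Y t) *ᵥ v t) i := rfl

lemma lift_congr {v w : ℝ → Fin 2 → ℂ} {t : ℝ} (h : v t = w t) : D.lift v t = D.lift w t := by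
  rw [lift, lift, h]

lemma lift_lincomb (v w : ℝ → Fin 2 → ℂ) (a b : ℂ) (t : ℝ) :
    D.lift (a • v + b • w) t = a • D.lift v t + b • D.lift w t := by
  ext i
  simp only [PiLp.add_apply, PiLp.smul_apply, lift_apply, Pi.add_apply, Pi.smul_apply,
    Matrix.mulVec_add, Matrix.mulVec_smul]

lemma sqrt_y_ne (hD : D.Regular) {t : ℝ} (ht : t ∈ Ioo 0 D.σ) : ((√(D.y t) : ℝ) : ℂ) ≠ 0 :=
  Complex.ofReal_ne_zero.2 (Real.sqrt_ne_zero'.2 (hD.y_pos ht))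

lemma unlift_lift (hD : D.Regular) (v : ℝ → Fin 2 → ℂ) {t : ℝ} (ht : t ∈ Ioo 0 D.σ) :
    D.unlift (D.lift v) t = v t := by
  have hs := sqrt_y_ne hD ht
  have hy : (D.y t : ℂ) ≠ 0 := Complex.ofReal_ne_zero.2 (hD.y_pos ht).ne'
  ext i
  simp only [unlift, lift_apply, toC_Y_mulVec]
  fin_cases i
  · simp
    field_simp
    ring
  · simp
    field_simp

lemma lift_unlift (hD : D.Regular) (f : ℝ → EuclideanSpace ℂ (Fin 2)) {t : ℝ}
    (ht : t ∈ Ioo 0 D.σ) : D.lift (D.unlift f) t = f t := by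
  have hs := sqrt_y_ne hD ht
  have hy : (D.y t : ℂ) ≠ 0 := Complex.ofReal_ne_zero.2 (hD.y_pos ht).ne'
  ext i
  rw [lift_apply, toC_Y_mulVec]
  fin_cases i
  · simp [unlift]
    field_simp
    ring
  · simp [unlift]
    field_simp

/-- Yᵗ Y = Xᵗ X / det X = 2 R. -/
lemma norm_sq_lift (hD : D.Regular) (v : ℝ → Fin 2 → ℂ) {t : ℝ} (ht : t ∈ Ioo 0 D.σ) :
    ‖D.lift v t‖ ^ 2 = 2 * D.density v t := by
  have hy := hD.y_pos ht
  rw [EuclideanSpace.norm_sq_eq, Fin.sum_univ_two, lift_apply, lift_apply, toC_Y_mulVec, density_eq]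
  simp only [Pi.smul_apply, smul_eq_mul, norm_mul, norm_inv, Complex.norm_real, mul_pow, inv_pow,
    Real.norm_eq_abs, sq_abs, Real.sq_sqrt hy.le, Matrix.cons_val_zero, Matrix.cons_val_one]
  field_simp

lemma aestronglyMeasurable_toLp {v : ℝ → Fin 2 → ℂ} {ν : Measure ℝ}
    (h : AEStronglyMeasurable v ν) :
    AEStronglyMeasurable (fun t => (WithLp.toLp 2 (v t) : EuclideanSpace ℂ (Fin 2))) ν :=
  (PiLp.continuous_toLp 2 _).comp_aestronglyMeasurable h

lemma MemL2R.memLp_lift {v : ℝ → Fin 2 → ℂ} (hD : D.Regular) (hv : D.MemL2R v) :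
    MemLp (D.lift v) 2 D.vol := by
  have hm : AEStronglyMeasurable (D.lift v) D.vol := by
    refine aestronglyMeasurable_toLp ?_
    simp only [toC_Y_mulVec]
    have hx : Measurable fun t => (D.x t : ℂ) := Complex.measurable_ofReal.comp hD.measurable_x
    have hy : Measurable fun t => (D.y t : ℂ) := Complex.measurable_ofReal.comp hD.measurable_y
    have hs : Measurable fun t => ((√(D.y t) : ℝ) : ℂ)⁻¹ :=
      (Complex.measurable_ofReal.comp hD.measurable_y.sqrt).inv
    have h0 := aemeasurable_pi_iff.1 hv.1.aemeasurable 0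
    have h1 := aemeasurable_pi_iff.1 hv.1.aemeasurable 1
    refine (aemeasurable_pi_iff.2 fun i => ?_).aestronglyMeasurable
    fin_cases i
    · exact hs.aemeasurable.mul (h0.sub (hx.aemeasurable.mul h1))
    · exact hs.aemeasurable.mul (hy.aemeasurable.mul h1)
  refine (memLp_two_iff_integrable_sq_norm hm).2 ((hv.2.const_mul 2).congr ?_)
  filter_upwards [ae_vol_mem] with t ht using (norm_sq_lift hD v ht).symm

lemma memL2R_unlift (hD : D.Regular) {f : ℝ → EuclideanSpace ℂ (Fin 2)} (hf : MemLp f 2 D.vol) :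
    D.MemL2R (D.unlift f) := by
  constructor
  · have hx : Measurable fun t => (D.x t : ℂ) := Complex.measurable_ofReal.comp hD.measurable_x
    have hy : Measurable fun t => (D.y t : ℂ) := Complex.measurable_ofReal.comp hD.measurable_y
    have hs : Measurable fun t => ((√(D.y t) : ℝ) : ℂ) :=
      Complex.measurable_ofReal.comp hD.measurable_y.sqrt
    have h0 : AEMeasurable (fun t => f t 0) D.vol :=
      ((EuclideanSpace.proj (𝕜 := ℂ) (0 : Fin 2)).continuous.comp_aestronglyMeasurable
        hf.1).aemeasurable
    have h1 : AEMeasurable (fun t => f t 1) D.vol :=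
      ((EuclideanSpace.proj (𝕜 := ℂ) (1 : Fin 2)).continuous.comp_aestronglyMeasurable
        hf.1).aemeasurable
    refine (aemeasurable_pi_iff.2 fun i => ?_).aestronglyMeasurable
    fin_cases i
    · exact hs.aemeasurable.mul (h0.add ((hx.div hy).aemeasurable.mul h1))
    · exact hs.aemeasurable.mul (h1.div hy.aemeasurable)
  · have h2 := ((memLp_two_iff_integrable_sq_norm hf.1).1 hf).const_mul (1 / 2)
    refine h2.congr ?_
    filter_upwards [ae_vol_mem] with t ht
    have := norm_sq_lift hD (D.unlift f) ht
    rw [lift_unlift hD f ht] at this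
    linarith

/-- The element `Y v` of `L²`. -/
def toL2 (hD : D.Regular) {v : ℝ → Fin 2 → ℂ} (hv : D.MemL2R v) : D.L2 :=
  (hv.memLp_lift hD).toLp (D.lift v)

lemma coeFn_toL2 (hD : D.Regular) {v : ℝ → Fin 2 → ℂ} (hv : D.MemL2R v) :
    toL2 hD hv =ᵐ[D.vol] D.lift v := MemLp.coeFn_toLp _

lemma norm_sq_toL2 (hD : D.Regular) {v : ℝ → Fin 2 → ℂ} (hv : D.MemL2R v) :
    ‖toL2 hD hv‖ ^ 2 = 2 * D.normSqR v := by
  have h : ‖toL2 hD hv‖ ^ 2 = ∫ t, ‖toL2 hD hv t‖ ^ 2 ∂D.vol := by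
    have h1 := L2.inner_def (𝕜 := ℂ) (toL2 hD hv) (toL2 hD hv)
    simp only [inner_self_eq_norm_sq_to_K] at h1
    have h2 : ((‖toL2 hD hv‖ ^ 2 : ℝ) : ℂ) = ((∫ t, ‖toL2 hD hv t‖ ^ 2 ∂D.vol : ℝ) : ℂ) := by
      rw [← integral_complex_ofReal]
      push_cast
      exact h1
    exact_mod_cast h2
  rw [h, normSqR, ← integral_const_mul]
  refine integral_congr_ae ?_
  filter_upwards [coeFn_toL2 hD hv, ae_vol_mem] with t h1 h2
  rw [h1, norm_sq_lift hD v h2]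

/-- `v` is in the domain of `τ` and `Y τ v = f`. -/
structure Solves (D : DiracOp) (v : ℝ → Fin 2 → ℂ) (f : D.L2) : Prop where
  memDom : D.MemDom v
  ae_eq : ∀ᵐ t ∂D.vol, f t = D.lift (D.tau v) t

lemma Solves.lincomb (hD : D.Regular) {v w : ℝ → Fin 2 → ℂ} {f g : D.L2} (hv : D.Solves v f)
    (hw : D.Solves w g) (a b : ℂ) : D.Solves (a • v + b • w) (a • f + b • g) := by
  refine ⟨hv.memDom.lincomb hD hw.memDom a b, ?_⟩
  filter_upwards [hv.ae_eq, hw.ae_eq, tau_lincomb hD hv.memDom hw.memDom a b,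
    Lp.coeFn_add (a • f) (b • g), Lp.coeFn_smul a f, Lp.coeFn_smul b g] with t h1 h2 h3 h4 h5 h6
  rw [h4, Pi.add_apply, h5, h6, Pi.smul_apply, Pi.smul_apply, h1, h2, ← lift_lincomb]
  exact lift_congr h3.symm

/-- At z = 0 the fundamental matrix is 1. So 0 is always in the resolvent set, which gives both
injectivity and bounded invertibility of τ. -/
lemma charFun_one : D.charFun (fun _ => 1) = 1 := by simp [charFun, bdry]

lemma Solves.eq_zero (hD : D.Regular) {v : ℝ → Fin 2 → ℂ} (hv : D.Solves v 0) :
    ∀ t ∈ Ioc 0 D.σ, v t = 0 := by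
  refine FundSol.zero_one.eq_zero_of_charFun_ne hD (by rw [charFun_one]; exact one_ne_zero)
    hv.memDom ?_
  filter_upwards [hv.ae_eq, Lp.coeFn_zero (EuclideanSpace ℂ (Fin 2)) 2 D.vol, ae_vol_mem]
    with t h1 h2 h3
  rw [zero_smul, ← unlift_lift hD (D.tau v) h3, unlift, ← h1, h2]
  ext i
  fin_cases i <;> simp

lemma Solves.unique (hD : D.Regular) {v w : ℝ → Fin 2 → ℂ} {f : D.L2} (hv : D.Solves v f)
    (hw : D.Solves w f) : ∀ t ∈ Ioc 0 D.σ, v t = w t := by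
  have h := hv.lincomb hD hw 1 (-1)
  simp only [one_smul, neg_smul, add_neg_cancel] at h
  intro t ht
  have := h.eq_zero hD t ht
  rwa [Pi.add_apply, Pi.neg_apply, ← sub_eq_add_neg, sub_eq_zero] at this

lemma exists_solves (hD : D.Regular) : ∃ C : ℝ, 0 ≤ C ∧ ∀ f : D.L2, ∃ v, D.Solves v f ∧
    2 * D.normSqR v ≤ C * ‖f‖ ^ 2 := by
  obtain ⟨C, hC⟩ := (FundSol.zero_one (D := D)).exists_bounded_solution hD
    (by rw [charFun_one]; exact one_ne_zero)
  refine ⟨|C|, abs_nonneg C, fun f => ?_⟩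
  have hf := memL2R_unlift hD (Lp.memLp f)
  obtain ⟨v, hv, htau, hle⟩ := hC _ hf
  have hfeq : toL2 hD hf = f := by
    refine Lp.ext ?_
    filter_upwards [coeFn_toL2 hD hf, ae_vol_mem] with t h1 h2
    rw [h1, lift_unlift hD _ h2]
  refine ⟨v, ⟨hv, ?_⟩, ?_⟩
  · filter_upwards [htau, ae_vol_mem] with t h1 h2
    rw [zero_smul, sub_zero] at h1
    rw [lift_congr h1, lift_unlift hD _ h2]
  · have h3 := norm_sq_toL2 hD hf
    rw [hfeq] at h3
    have h4 : C * D.normSqR (D.unlift f) ≤ |C| * D.normSqR (D.unlift f) := by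
      refine mul_le_mul_of_nonneg_right (le_abs_self C) ?_
      have := sq_nonneg ‖f‖
      linarith
    rw [h3]
    linarith

lemma isInverse_iff {r : D.L2 →L[ℂ] D.L2} : D.IsInverse r ↔
    ∀ f g : D.L2, r f = g ↔ ∃ v, D.Solves v f ∧ ∀ᵐ t ∂D.vol, g t = D.lift v t := by
  have key : ∀ (g : D.L2) (v : ℝ → Fin 2 → ℂ), (∀ᵐ t ∂D.vol, g t = D.lift v t) ↔
      ∀ᵐ t ∂D.vol, ∀ i, g t i = (toC (D.Y t) *ᵥ v t) i := fun g v => by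
    refine eventually_congr (Eventually.of_forall fun t => ?_)
    constructor
    · intro h i; rw [h, lift_apply]
    · intro h; ext i; rw [h i, lift_apply]
  refine forall_congr' fun f => forall_congr' fun g => ?_
  refine iff_congr Iff.rfl ⟨?_, ?_⟩
  · rintro ⟨v, h1, h2, h3⟩
    exact ⟨v, ⟨h1, (key f _).2 h3⟩, (key g v).2 h2⟩
  · rintro ⟨v, ⟨h1, h3⟩, h2⟩
    exact ⟨v, h1, (key g v).1 h2, (key f _).1 h3⟩

/-- A bounded choice of solutions of Y τ v = f is automatically linear in f, by uniqueness of the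
solution. -/
lemma exists_isInverse (hD : D.Regular) : ∃ r : D.L2 →L[ℂ] D.L2, D.IsInverse r := by
  obtain ⟨C, hC0, hC⟩ := exists_solves hD
  choose S hS hbound using hC
  have hlin : ∀ (a b : ℂ) (f g : D.L2), toL2 hD (hS (a • f + b • g)).memDom.1 =
      a • toL2 hD (hS f).memDom.1 + b • toL2 hD (hS g).memDom.1 := by
    intro a b f g
    refine Lp.ext ?_
    have hu := (hS (a • f + b • g)).unique hD ((hS f).lincomb hD (hS g) a b)
    filter_upwards [coeFn_toL2 hD (hS (a • f + b • g)).memDom.1, coeFn_toL2 hD (hS f).memDom.1,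
      coeFn_toL2 hD (hS g).memDom.1, ae_vol_mem,
      Lp.coeFn_add (a • toL2 hD (hS f).memDom.1) (b • toL2 hD (hS g).memDom.1),
      Lp.coeFn_smul a (toL2 hD (hS f).memDom.1), Lp.coeFn_smul b (toL2 hD (hS g).memDom.1)]
      with t h1 h2 h3 h4 h5 h6 h7
    rw [h1, h5, Pi.add_apply, h6, h7, Pi.smul_apply, Pi.smul_apply, h2, h3, ← lift_lincomb]
    exact lift_congr (hu t (Ioo_subset_Ioc_self h4))
  let r₀ : D.L2 →ₗ[ℂ] D.L2 :=
    { toFun := fun f => toL2 hD (hS f).memDom.1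
      map_add' := fun f g => by simpa using hlin 1 1 f g
      map_smul' := fun a f => by simpa using hlin a 0 f 0 }
  have hr₀ : ∀ f, r₀ f = toL2 hD (hS f).memDom.1 := fun f => rfl
  refine ⟨r₀.mkContinuous (√C) fun f => ?_, isInverse_iff.2 fun f g => ?_⟩
  · refine (sq_le_sq₀ (norm_nonneg _) (by positivity)).1 ?_
    rw [hr₀, norm_sq_toL2, mul_pow, Real.sq_sqrt hC0]
    exact hbound f
  · rw [LinearMap.mkContinuous_apply, hr₀]
    constructor
    · rintro rfl
      exact ⟨S f, hS f, coeFn_toL2 hD _⟩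
    · rintro ⟨v, hv, hg⟩
      refine Lp.ext ?_
      filter_upwards [coeFn_toL2 hD (hS f).memDom.1, hg, ae_vol_mem] with t h1 h2 h3
      rw [h1, h2]
      exact lift_congr ((hS f).unique hD hv t (Ioo_subset_Ioc_self h3))

lemma isInverse_res (hD : D.Regular) : D.IsInverse D.res := by
  have h := exists_isInverse hD
  rw [res, dif_pos h]
  exact h.choose_spec

/-- ⟨Yv, Yw⟩ = 2 v* R w = 2 v* J (J⁻¹ R w). With w replaced by τ w the last bracket is w', so the
inner product becomes half of the derivative of a Wronskian. -/
lemma inner_lift (hD : D.Regular) (v w : ℝ → Fin 2 → ℂ) {t : ℝ} (ht : t ∈ Ioo 0 D.σ) :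
    inner ℂ (D.lift v t) (D.lift w t) = 2 * ((starRingEnd ℂ) (v t 1) * (D.gen t *ᵥ w t) 0
      - (starRingEnd ℂ) (v t 0) * (D.gen t *ᵥ w t) 1) := by
  have hy := hD.y_pos ht
  have hs := sqrt_y_ne hD ht
  have hs2 : ((√(D.y t) : ℝ) : ℂ) ^ 2 = (D.y t : ℂ) := by
    rw [← Complex.ofReal_pow, Real.sq_sqrt hy.le]
  have hy' : (D.y t : ℂ) ≠ 0 := Complex.ofReal_ne_zero.2 hy.ne'
  rw [PiLp.inner_apply, Fin.sum_univ_two]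
  simp only [lift_apply, toC_Y_mulVec, RCLike.inner_apply]
  simp [gen, Matrix.mulVec, dotProduct, Fin.sum_univ_two]
  field_simp
  rw [hs2]
  field_simp
  ring

/-- Lagrange's identity: ⟨r f, g⟩ - ⟨f, r g⟩ is the integral of the derivative of 2Q, where Q is the
Wronskian of conj v and w. At 0 the second components vanish; at σ both functions satisfy the same
real boundary condition. So Q is zero at both ends. -/
lemma isSymmetric_of_isInverse (hD : D.Regular) {r : D.L2 →L[ℂ] D.L2} (hr : D.IsInverse r) :
    (r : D.L2 →ₗ[ℂ] D.L2).IsSymmetric := by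
  intro f g
  obtain ⟨v, hv, hrf⟩ := (isInverse_iff.1 hr f (r f)).1 rfl
  obtain ⟨w, hw, hrg⟩ := (isInverse_iff.1 hr g (r g)).1 rfl
  change inner ℂ (r f) g = inner ℂ f (r g)
  obtain ⟨v', hv', hveq, hv0⟩ := hv.memDom.exists_ac hD
  obtain ⟨w', hw', hweq, hw0⟩ := hw.memDom.exists_ac hD
  have hconj : LipschitzWith 1 (starRingEnd ℂ) := Complex.isometry_conj.lipschitz
  set Q : ℝ → ℂ := fun t => (starRingEnd ℂ) (v' t 1) * w' t 0 - (starRingEnd ℂ) (v' t 0) * w' t 1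
    with hQ
  have hQac : AbsolutelyContinuousOnInterval Q 0 D.σ :=
    ((((hv'.apply 1).lipschitz_comp hconj).mulC (hw'.apply 0)).sub
      (((hv'.apply 0).lipschitz_comp hconj).mulC (hw'.apply 1)))
  have hi1 := L2.integrable_inner (𝕜 := ℂ) (r f) g
  have hi2 := L2.integrable_inner (𝕜 := ℂ) f (r g)
  rw [L2.inner_def, L2.inner_def, ← sub_eq_zero, ← integral_sub hi1 hi2]
  have hint := intervalIntegrable_of_vol hD.pos (hi1.sub hi2)
  have hderiv : ∀ᵐ t, t ∈ uIcc 0 D.σ →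
      HasDerivAt (fun t => 2 * Q t) (inner ℂ (r f t) (g t) - inner ℂ (f t) (r g t)) t := by
    have hne0 : ∀ᵐ t : ℝ, t ≠ 0 := by simp [ae_iff, measure_singleton]
    have hne : ∀ᵐ t : ℝ, t ≠ D.σ := by simp [ae_iff, measure_singleton]
    filter_upwards [ae_vol_iff.1 hrf, ae_vol_iff.1 hrg, ae_vol_iff.1 hv.ae_eq,
      ae_vol_iff.1 hw.ae_eq, ae_vol_iff.1 (hv.memDom.ae_hasDerivAt hD),
      ae_vol_iff.1 (hw.memDom.ae_hasDerivAt hD), hne0, hne]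
      with t h1 h2 h3 h4 h5 h6 h7 h8 ht
    rw [uIcc_of_le hD.pos.le] at ht
    have hmem : t ∈ Ioo 0 D.σ := ⟨lt_of_le_of_ne ht.1 (Ne.symm h7), lt_of_le_of_ne ht.2 h8⟩
    have hev : ∀ᶠ s in 𝓝 t, 2 * Q s =
        2 * ((starRingEnd ℂ) (v s 1) * w s 0 - (starRingEnd ℂ) (v s 0) * w s 1) := by
      filter_upwards [Ioo_mem_nhds hmem.1 hmem.2] with s hs
      rw [hQ, hveq s (Ioo_subset_Ioc_self hs), hweq s (Ioo_subset_Ioc_self hs)]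
    have hdv := hasDerivAt_pi.1 (h5 hmem)
    have hdw := hasDerivAt_pi.1 (h6 hmem)
    refine HasDerivAt.congr_of_eventuallyEq ?_ hev
    refine ((((hdv 1).star.mul (hdw 0)).sub ((hdv 0).star.mul (hdw 1))).const_mul 2).congr_deriv ?_
    rw [h1 hmem, h2 hmem, h3 hmem, h4 hmem, inner_lift hD _ _ hmem,
      ← inner_conj_symm (D.lift (D.tau v) t), inner_lift hD _ _ hmem]
    simp only [map_mul, map_sub, Complex.conj_conj, Complex.conj_ofNat]
    simp only [starRingEnd_apply]
    ring
  have hfin := (hQac.const_smul (2 : ℂ)).sub_eq_integral hint hderiv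
  rw [intervalIntegral.integral_of_le hD.pos.le] at hfin
  change _ = ∫ t, (inner ℂ (r f t) (g t) - inner ℂ (f t) (r g t)) ∂D.vol at hfin
  rw [← hfin]
  have hσ : D.σ ∈ Ioc 0 D.σ := right_mem_Ioc.2 hD.pos
  have hbv := hv.memDom.2.2.2.2
  have hbw := hw.memDom.2.2.2.2
  rw [dot_J_u1 hD, hveq _ hσ, bdry] at hbv
  rw [dot_J_u1 hD, hweq _ hσ, bdry] at hbw
  have hbv' := congrArg (starRingEnd ℂ) hbv
  simp only [map_add, map_mul, Complex.conj_ofReal, map_zero] at hbv'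
  simp only [smul_eq_mul, hQ, hv0, hw0, map_zero]
  linear_combination 2 * (starRingEnd ℂ) (v' D.σ 1) * hbw - 2 * w' D.σ 1 * hbv'

end DiracOp

/-! ### Multiplicities of the eigenvalues of the inverse, and det₂ -/

namespace DiracOp

variable {D : DiracOp} {z : ℂ} {M : ℝ → Matrix (Fin 2) (Fin 2) ℂ}

/-- A symmetric operator has no Jordan blocks, so algebraic multiplicity can be computed from the
eigenfunctions of τ. -/
lemma maxGenEigenspace_eq (hD : D.Regular) (ν : ℂ) :
    D.resEnd.maxGenEigenspace ν = D.resEnd.eigenspace ν :=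
  (isSymmetric_of_isInverse hD (isInverse_res hD)).isFinitelySemisimple.maxGenEigenspace_eq_eigenspace ν

lemma solves_of_mem_eigenspace (hD : D.Regular) (hz : z ≠ 0) {f : D.L2}
    (hf : f ∈ D.resEnd.eigenspace z⁻¹) : ∃ v, D.MemDom v ∧
      (∀ᵐ t ∂D.vol, D.tau v t = z • v t) ∧ ∀ᵐ t ∂D.vol, f t = D.lift (z • v) t := by
  have hrf : D.res f = z⁻¹ • f := Module.End.mem_eigenspace_iff.1 hf
  obtain ⟨v, hv, hg⟩ := (isInverse_iff.1 (isInverse_res hD) f _).1 hrf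
  have hfl : ∀ᵐ t ∂D.vol, f t = D.lift (z • v) t := by
    filter_upwards [hg, Lp.coeFn_smul z⁻¹ f] with t h1 h2
    rw [h2, Pi.smul_apply] at h1
    have h3 := lift_lincomb (D := D) v v z 0 t
    rw [zero_smul, add_zero, zero_smul, add_zero] at h3
    rw [h3, ← h1, smul_smul, mul_inv_cancel₀ hz, one_smul]
  refine ⟨v, hv.memDom, ?_, hfl⟩
  filter_upwards [hfl, hv.ae_eq, ae_vol_mem] with t h1 h2 h3
  rw [← unlift_lift hD (D.tau v) h3, unlift, ← h2, h1]
  exact unlift_lift hD (z • v) h3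

lemma FundSol.finrank_maxGenEigenspace_of_ne (hM : FundSol D z M) (hD : D.Regular) (hz : z ≠ 0)
    (hF : D.charFun M ≠ 0) : Module.finrank ℂ (D.resEnd.maxGenEigenspace z⁻¹) = 0 := by
  have : D.resEnd.maxGenEigenspace z⁻¹ = ⊥ := by
    rw [maxGenEigenspace_eq hD, Submodule.eq_bot_iff]
    intro f hf
    obtain ⟨v, hv, htau, hfl⟩ := solves_of_mem_eigenspace hD hz hf
    have h0 := hM.eq_zero_of_charFun_ne hD hF hv htau
    refine Lp.ext ?_
    filter_upwards [hfl, Lp.coeFn_zero (EuclideanSpace ℂ (Fin 2)) 2 D.vol, ae_vol_mem]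
      with t h1 h2 h3
    rw [h1, h2, Pi.zero_apply, lift, Pi.smul_apply, h0 t (Ioo_subset_Ioc_self h3), smul_zero,
      Matrix.mulVec_zero, WithLp.toLp_zero]
  rw [this, finrank_bot]

/-- Every eigenfunction is a multiple of the regular solution, so its image under Y spans the
eigenspace. -/
lemma FundSol.finrank_maxGenEigenspace_of_eq (hM : FundSol D z M) (hD : D.Regular) (hz : z ≠ 0)
    (hF : D.charFun M = 0) : Module.finrank ℂ (D.resEnd.maxGenEigenspace z⁻¹) = 1 := by
  have hdom := hM.memDom_regSol hD hF
  set φ := toL2 hD hdom.1 with hφ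
  have hφc : φ =ᵐ[D.vol] D.lift (regSol M) := coeFn_toL2 hD hdom.1
  have hφ0 : φ ≠ 0 := by
    intro h
    rw [h] at hφc
    have hne : (ae D.vol).NeBot := by
      rw [ae_neBot]
      intro h0
      have : D.vol univ = 0 := by rw [h0]; rfl
      rw [vol, Measure.restrict_apply_univ, Real.volume_Ioc, sub_zero, ENNReal.ofReal_eq_zero] at this
      exact absurd hD.pos (not_lt.2 this)
    obtain ⟨t, h1, h2, h3⟩ := (hφc.and ((Lp.coeFn_zero (EuclideanSpace ℂ (Fin 2)) 2 D.vol).and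
      (ae_vol_mem (D := D)))).exists
    rw [h2] at h1
    have h4 := unlift_lift hD (regSol M) h3
    rw [unlift, ← h1] at h4
    refine hM.regSol_ne_zero t (h4.symm.trans ?_)
    ext i
    fin_cases i <;> simp
  have hspan : D.resEnd.maxGenEigenspace z⁻¹ = Submodule.span ℂ {φ} := by
    rw [maxGenEigenspace_eq hD]
    refine le_antisymm (fun f hf => ?_) ?_
    · obtain ⟨v, hv, htau, hfl⟩ := solves_of_mem_eigenspace hD hz hf
      obtain ⟨κ, h1, -⟩ := hM.eq_smul_regSol hD hv htau
      refine Submodule.mem_span_singleton.2 ⟨z * κ, Lp.ext ?_⟩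
      filter_upwards [hfl, Lp.coeFn_smul (z * κ) φ, hφc, ae_vol_mem] with t h2 h3 h4 h5
      have h6 := lift_lincomb (D := D) (regSol M) (regSol M) (z * κ) 0 t
      rw [zero_smul, add_zero, zero_smul, add_zero] at h6
      rw [h3, Pi.smul_apply, h4, h2, ← h6]
      refine lift_congr ?_
      rw [Pi.smul_apply, Pi.smul_apply, h1 t (Ioo_subset_Ioc_self h5), smul_smul]
    · rw [Submodule.span_singleton_le_iff_mem, Module.End.mem_eigenspace_iff]
      refine (isInverse_iff.1 (isInverse_res hD) φ _).2 ⟨z⁻¹ • regSol M, ⟨?_, ?_⟩, ?_⟩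
      · simpa using hdom.lincomb hD hdom z⁻¹ 0
      · have h1 := tau_lincomb hD hdom hdom z⁻¹ 0
        rw [zero_smul, add_zero] at h1
        filter_upwards [h1, hφc, hM.tau_regSol hD] with t h2 h3 h4
        rw [h3]
        refine lift_congr ?_
        rw [h2, h4, zero_smul, add_zero, smul_smul, inv_mul_cancel₀ hz, one_smul]
      · have h6 := fun t => lift_lincomb (D := D) (regSol M) (regSol M) z⁻¹ 0 t
        simp only [zero_smul, add_zero] at h6
        filter_upwards [hφc, Lp.coeFn_smul z⁻¹ φ] with t h3 h4
        rw [h4, Pi.smul_apply, h3, h6]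
  rw [hspan, finrank_span_singleton hφ0]

/-- The regularized determinant in terms of an enumeration of the zeros of the characteristic
function. -/
lemma detTwoFactor_comp {N : ℂ → ℝ → Matrix (Fin 2) (Fin 2) ℂ} (hD : D.Regular)
    (hN : ∀ z, FundSol D z (N z)) {ι : Type*} {e : ι → ℂ} (he0 : ∀ i, e i ≠ 0)
    (he : ∀ z, D.charFun (N z) = 0 ↔ z ∈ range e) (z : ℂ) :
    (∀ ν ∉ range fun i => (e i)⁻¹, detTwoFactor D.resEnd z ν = 1) ∧
    ∀ i, detTwoFactor D.resEnd z (e i)⁻¹ = (1 - z * (e i)⁻¹) * Complex.exp (z * (e i)⁻¹) := by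
  constructor
  · intro ν hν
    -- For ν = 0 the base of the power is 1, so the dimension of the kernel is irrelevant.
    by_cases h0 : ν = 0
    · simp [detTwoFactor, h0]
    · have hF : D.charFun (N ν⁻¹) ≠ 0 := by
        intro h
        obtain ⟨i, hi⟩ := (he _).1 h
        exact hν ⟨i, by simp [hi]⟩
      have := (hN ν⁻¹).finrank_maxGenEigenspace_of_ne hD (inv_ne_zero h0) hF
      rw [inv_inv] at this
      rw [detTwoFactor, this, pow_zero]
  · intro i
    rw [detTwoFactor, (hN (e i)).finrank_maxGenEigenspace_of_eq hD (he0 i) ((he _).2 ⟨i, rfl⟩),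
      pow_one]

end DiracOp

/-! ### Regularized sine products -/

lemma norm_one_sub_mul_exp_sub_one_le {u : ℂ} (hu : ‖u‖ ≤ 1) :
    ‖(1 - u) * Complex.exp u - 1‖ ≤ 3 * ‖u‖ ^ 2 := by
  have h := Complex.norm_exp_sub_one_sub_id_le hu
  have heq : (1 - u) * Complex.exp u - 1 = -u ^ 2 + (1 - u) * (Complex.exp u - 1 - u) := by ring
  rw [heq]
  calc _ ≤ ‖-u ^ 2‖ + ‖(1 - u) * (Complex.exp u - 1 - u)‖ := norm_add_le _ _
    _ ≤ ‖u‖ ^ 2 + 2 * ‖u‖ ^ 2 := by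
      rw [norm_neg, norm_pow, norm_mul]
      gcongr
      refine (norm_sub_le _ _).trans ?_
      rw [norm_one]; linarith
    _ = _ := by ring

/-- The exponential cancels the linear term, so square summability of u suffices. -/
lemma multipliable_one_sub_mul_exp {ι : Type*} {u : ι → ℂ} (hu : Summable fun i => ‖u i‖ ^ 2) :
    Multipliable fun i => (1 - u i) * Complex.exp (u i) := by
  have h : Summable fun i => ‖(1 - u i) * Complex.exp (u i) - 1‖ := by
    refine Summable.of_norm_bounded_eventually (hu.mul_left 3) ?_
    have h1 : ∀ᶠ i in cofinite, ‖u i‖ ^ 2 < 1 :=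
      hu.tendsto_cofinite_zero.eventually (gt_mem_nhds one_pos)
    filter_upwards [h1] with i hi
    rw [norm_norm]
    refine norm_one_sub_mul_exp_sub_one_le ?_
    nlinarith [norm_nonneg (u i)]
  simpa using multipliable_one_add_of_summable h

lemma prod_Icc_neg_succ (f : ℤ → ℂ) (N : ℕ) : ∏ j ∈ Finset.Icc (-(N : ℤ)) N, f j =
    f 0 * ∏ i ∈ Finset.range N, (f (i + 1) * f (-(i + 1))) := by
  induction N with
  | zero => simp
  | succ N ih =>
    have h : Finset.Icc (-((N + 1 : ℕ) : ℤ)) (N + 1 : ℕ) =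
        insert ((N : ℤ) + 1) (insert (-((N : ℤ) + 1)) (Finset.Icc (-(N : ℤ)) N)) := by
      ext j
      simp only [Finset.mem_Icc, Finset.mem_insert]
      omega
    rw [h, Finset.prod_insert, Finset.prod_insert, ih, Finset.prod_range_succ]
    · ring
    · simp
    · simp only [Finset.mem_insert, Finset.mem_Icc]
      omega

/-- The factors 1 - w/(x + j) form the quotient of Euler's sine products at x - w and at x. The
exponents add up to w times the partial fractions of π cot(πx). Pairing j with -j makes both
expansions applicable. -/
lemma tendsto_sin_prod {x : ℂ} (hx : x ∈ Complex.integerComplement) (w : ℂ) :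
    Tendsto (fun N : ℕ => ∏ j ∈ Finset.Icc (-(N : ℤ)) N,
      (1 - w / (x + j)) * Complex.exp (w / (x + j))) atTop
      (𝓝 (Complex.sin (Real.pi * (x - w)) / Complex.sin (Real.pi * x) *
        Complex.exp (w * (Real.pi * Complex.cot (Real.pi * x))))) := by
  have hx0 := Complex.integerComplement.ne_zero hx
  have hsin := sin_pi_mul_ne_zero hx
  have hcot := (tendsto_logDeriv_euler_cot_sub hx).const_add (1 / x)
  rw [add_sub_cancel] at hcot
  have h := ((Complex.tendsto_euler_sin_prod (x - w)).div (Complex.tendsto_euler_sin_prod x)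
    hsin).mul ((Complex.continuous_exp.tendsto _).comp (hcot.const_mul w))
  refine h.congr fun N => ?_
  have hj : ∀ j : ℤ, x + j ≠ 0 := fun j => Complex.integerComplement_add_ne_zero hx j
  rw [prod_Icc_neg_succ, Pi.div_apply, Function.comp_apply, mul_add, Complex.exp_add,
    Finset.mul_sum, Complex.exp_sum, mul_div_mul_comm, ← Finset.prod_div_distrib,
    mul_mul_mul_comm, ← Finset.prod_mul_distrib]
  congr 1
  · have hpi : (Real.pi : ℂ) ≠ 0 := Complex.ofReal_ne_zero.2 Real.pi_ne_zero
    rw [Int.cast_zero, add_zero, mul_one_div]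
    congr 1
    field_simp
  · refine Finset.prod_congr rfl fun i _ => ?_
    have h1 := hj (i + 1)
    have h2 := hj (-(i + 1))
    push_cast at h1 h2 ⊢
    have hi : ((i : ℂ) + 1) ≠ 0 := Nat.cast_add_one_ne_zero i
    have h2' : x - (i + 1) ≠ 0 := by rwa [sub_eq_add_neg]
    have h3 : 1 - x ^ 2 / ((i : ℂ) + 1) ^ 2 ≠ 0 := by
      have : 1 - x ^ 2 / ((i : ℂ) + 1) ^ 2 = -((x + (i + 1)) * (x - (i + 1))) / ((i : ℂ) + 1) ^ 2 := by
        field_simp; ring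
      rw [this]
      exact div_ne_zero (neg_ne_zero.2 (mul_ne_zero h1 h2')) (pow_ne_zero _ hi)
    have hexp : Complex.exp (w * (1 / (x - (i + 1)) + 1 / (x + (i + 1)))) =
        Complex.exp (w / (x + (i + 1))) * Complex.exp (w / (x + -(i + 1))) := by
      rw [← Complex.exp_add, ← sub_eq_add_neg x]
      congr 1
      ring
    have hrat : (1 - (x - w) ^ 2 / ((i : ℂ) + 1) ^ 2) / (1 - x ^ 2 / ((i : ℂ) + 1) ^ 2) =
        (1 - w / (x + (i + 1))) * (1 - w / (x + -(i + 1))) := by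
      rw [div_eq_iff h3, ← sub_eq_add_neg x]
      field_simp
      ring
    rw [hexp, hrat]
    ring

lemma summable_sq_div_add_int (x : ℝ) (w : ℂ) :
    Summable fun j : ℤ => ‖w / ((x : ℂ) + j)‖ ^ 2 := by
  have h := ((Real.summable_one_div_int_add_rpow x 2).2 one_lt_two).mul_left (‖w‖ ^ 2)
  refine h.congr fun j => ?_
  rw [norm_div, div_pow, ← Complex.ofReal_intCast, ← Complex.ofReal_add, Complex.norm_real,
    Real.norm_eq_abs, add_comm x, Real.rpow_ofNat]
  ring

/-- The product converges unconditionally, so it may be evaluated along the symmetric intervals. -/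
lemma tprod_sin {x : ℝ} (hx : (x : ℂ) ∈ Complex.integerComplement) (w : ℂ) :
    ∏' j : ℤ, (1 - w / ((x : ℂ) + j)) * Complex.exp (w / ((x : ℂ) + j)) =
      Complex.sin (Real.pi * (x - w)) / Complex.sin (Real.pi * x) *
        Complex.exp (w * (Real.pi * Complex.cot (Real.pi * x))) :=
  tendsto_nhds_unique ((multipliable_one_sub_mul_exp (summable_sq_div_add_int x w)).hasProd.comp
    (Finset.tendsto_Icc_neg (R := ℤ))) (tendsto_sin_prod hx w)

/-! ### Dirac operators with piecewise constant coefficients -/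

/-- The matrix `2 J⁻¹ R` for the coefficients `x + i y`. -/
def cplxStr (x y : ℝ) : Matrix (Fin 2) (Fin 2) ℂ :=
  (y : ℂ)⁻¹ • !![-(x : ℂ), (x : ℂ) ^ 2 + (y : ℂ) ^ 2; -1, (x : ℂ)]

lemma cplxStr_mul_self {x y : ℝ} (hy : y ≠ 0) : cplxStr x y * cplxStr x y = -1 := by
  have hy' : (y : ℂ) ≠ 0 := Complex.ofReal_ne_zero.2 hy
  rw [cplxStr, Matrix.smul_mul, Matrix.mul_smul, smul_smul]
  ext i j
  fin_cases i <;> fin_cases j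
  · simp; field_simp; ring
  · simp; right; ring
  · simp
  · simp; field_simp; ring

/-- The exponential `exp (θ B)` of a matrix with `B² = -1`. -/
def matRot (B : Matrix (Fin 2) (Fin 2) ℂ) (θ : ℂ) : Matrix (Fin 2) (Fin 2) ℂ :=
  Complex.cos θ • 1 + Complex.sin θ • B

lemma matRot_zero (B : Matrix (Fin 2) (Fin 2) ℂ) : matRot B 0 = 1 := by simp [matRot]

lemma matRot_apply (B : Matrix (Fin 2) (Fin 2) ℂ) (θ : ℂ) (i j : Fin 2) :
    matRot B θ i j = Complex.cos θ * (1 : Matrix (Fin 2) (Fin 2) ℂ) i j + Complex.sin θ * B i j :=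
  rfl

lemma det_matRot_cplxStr {x y : ℝ} (hy : y ≠ 0) (θ : ℂ) : (matRot (cplxStr x y) θ).det = 1 := by
  have hy' : (y : ℂ) ≠ 0 := Complex.ofReal_ne_zero.2 hy
  rw [Matrix.det_fin_two]
  simp only [matRot_apply]
  simp [cplxStr]
  field_simp
  linear_combination (y : ℂ) ^ 2 * Complex.cos_sq_add_sin_sq θ

lemma contDiff_matRot_apply (B : Matrix (Fin 2) (Fin 2) ℂ) (z : ℂ) (i j : Fin 2) :
    ContDiff ℝ 1 fun s : ℝ => matRot B (z * s / 2) i j := by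
  have hlin : ContDiff ℝ 1 fun s : ℝ => z * s / 2 :=
    (contDiff_const.mul Complex.ofRealCLM.contDiff).div_const 2
  exact (((Complex.contDiff_cos.restrict_scalars ℝ).comp hlin).mul contDiff_const).add
    (((Complex.contDiff_sin.restrict_scalars ℝ).comp hlin).mul contDiff_const)

lemma hasDerivAt_matRot {B : Matrix (Fin 2) (Fin 2) ℂ} (hB : B * B = -1) (z : ℂ) (a t : ℝ)
    (i j : Fin 2) : HasDerivAt (fun s : ℝ => matRot B (z * ((s - a : ℝ) : ℂ) / 2) i j)
      (((z / 2) • (B * matRot B (z * ((t - a : ℝ) : ℂ) / 2))) i j) t := by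
  have hlin : HasDerivAt (fun s : ℝ => z * ((s - a : ℝ) : ℂ) / 2) (z / 2) t := by
    have h := ((((hasDerivAt_id t).sub_const a).ofReal_comp).const_mul z).div_const 2
    simpa using h
  have h := (((Complex.hasDerivAt_cos _).scomp t hlin).mul_const
    ((1 : Matrix (Fin 2) (Fin 2) ℂ) i j)).add
      (((Complex.hasDerivAt_sin _).scomp t hlin).mul_const (B i j))
  refine h.congr_deriv ?_
  rw [matRot, Matrix.mul_add, Matrix.mul_smul, Matrix.mul_smul, hB, Matrix.mul_one]
  simp only [Matrix.smul_apply, Matrix.add_apply, Matrix.neg_apply, smul_eq_mul]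
  ring

/-- The time spent in the `k`-th interval of length `1 / n` up to time `t`. -/
def clampTime (n k : ℕ) (t : ℝ) : ℝ := max 0 (min (t - k / n) (1 / n))

/-- The fundamental matrix of the first `m` steps. -/
def stepSol (n : ℕ) (B : ℕ → Matrix (Fin 2) (Fin 2) ℂ) (z : ℂ) :
    ℕ → ℝ → Matrix (Fin 2) (Fin 2) ℂ
  | 0, _ => 1
  | m + 1, t => matRot (B m) (z * clampTime n m t / 2) * stepSol n B z m t

section StepSol

variable {n : ℕ} {B : ℕ → Matrix (Fin 2) (Fin 2) ℂ} {z : ℂ}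

lemma clampTime_of_le {k : ℕ} {t : ℝ} (h : t ≤ k / n) : clampTime n k t = 0 := by
  have : t - k / n ≤ 0 := by linarith
  exact max_eq_left ((min_le_left _ _).trans this)

lemma clampTime_of_ge {k : ℕ} {t : ℝ} (h : (k + 1 : ℕ) / (n : ℝ) ≤ t) :
    clampTime n k t = 1 / n := by
  have h1 : 1 / (n : ℝ) ≤ t - k / n := by
    push_cast at h
    rw [add_div] at h
    linarith
  rw [clampTime, min_eq_right h1, max_eq_right (by positivity)]

lemma clampTime_of_mem {k : ℕ} {t : ℝ} (h : t ∈ Icc ((k : ℝ) / n) ((k + 1 : ℕ) / (n : ℝ))) :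
    clampTime n k t = t - k / n := by
  have h2 := h.2
  push_cast at h2
  rw [add_div] at h2
  rw [clampTime, min_eq_left (by linarith), max_eq_right (by linarith [h.1])]

lemma stepSol_of_ge {m : ℕ} {s t : ℝ} (hs : (m : ℝ) / n ≤ s) (ht : (m : ℝ) / n ≤ t) :
    stepSol n B z m s = stepSol n B z m t := by
  induction m with
  | zero => rfl
  | succ m ih =>
    have hle : (m : ℝ) / n ≤ (m + 1 : ℕ) / (n : ℝ) := by gcongr; simp
    rw [stepSol, stepSol, clampTime_of_ge hs, clampTime_of_ge ht, ih (hle.trans hs) (hle.trans ht)]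

lemma stepSol_of_le {k m : ℕ} (hkm : k ≤ m) {t : ℝ} (ht : t ≤ (k : ℝ) / n) :
    stepSol n B z m t = stepSol n B z k t := by
  induction m, hkm using Nat.le_induction with
  | base => rfl
  | succ m hm ih =>
    have hle : (k : ℝ) / n ≤ (m : ℝ) / n := by gcongr
    rw [stepSol, clampTime_of_le (ht.trans hle), ih]
    simp [matRot_zero]

/-- At such a time the later factors are still 1 and the earlier ones are already complete; only the
k-th is moving. -/
lemma stepSol_of_mem {k m : ℕ} (hk : k < m) {t : ℝ}
    (ht : t ∈ Icc ((k : ℝ) / n) ((k + 1 : ℕ) / (n : ℝ))) :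
    stepSol n B z m t = matRot (B k) (z * ((t - k / n : ℝ) : ℂ) / 2) * stepSol n B z m (k / n) := by
  rw [stepSol_of_le (Nat.succ_le_of_lt hk) ht.2, stepSol, clampTime_of_mem ht,
    stepSol_of_le hk.le le_rfl, stepSol_of_ge ht.1 le_rfl]

lemma stepSol_zero_time (m : ℕ) : stepSol n B z m 0 = 1 := by
  rw [stepSol_of_le (Nat.zero_le m) (by simp), stepSol]

lemma det_stepSol {m : ℕ} (hB : ∀ k < m, ∀ θ, (matRot (B k) θ).det = 1) (t : ℝ) :
    (stepSol n B z m t).det = 1 := by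
  induction m with
  | zero => simp [stepSol]
  | succ m ih =>
    rw [stepSol, Matrix.det_mul, hB m (Nat.lt_succ_self m),
      ih fun k hk => hB k (hk.trans (Nat.lt_succ_self m)), one_mul]

lemma lipschitzWith_clampTime (n k : ℕ) : LipschitzWith 1 (clampTime n k) := by
  have h1 : LipschitzWith 1 fun t : ℝ => t - (k : ℝ) / n :=
    LipschitzWith.of_dist_le_mul fun s t => by simp
  exact (h1.min_const _).const_max _

/-- Each factor is a smooth function of a Lipschitz clock with values in [0, 1/n], hence Lipschitz.
-/
lemma stepSol_ac (m : ℕ) (i j : Fin 2) (a b : ℝ) :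
    AbsolutelyContinuousOnInterval (fun t => stepSol n B z m t i j) a b := by
  induction m generalizing i j with
  | zero => exact AbsolutelyContinuousOnInterval.const _
  | succ m ih =>
    simp only [stepSol, Matrix.mul_apply]
    refine AbsolutelyContinuousOnInterval.finset_sum _ fun l _ =>
      AbsolutelyContinuousOnInterval.mulC ?_ (ih l j)
    obtain ⟨K, hK⟩ := (contDiff_matRot_apply (B m) z i l).contDiffOn.exists_lipschitzOnWith
      (by decide) (convex_Icc (0 : ℝ) (1 / n)) isCompact_Icc
    have hmaps : MapsTo (clampTime n m) (uIcc a b) (Icc 0 (1 / n)) := fun t _ =>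
      ⟨le_max_left _ _, max_le (by positivity) (min_le_right _ _)⟩
    exact (hK.comp (lipschitzWith_clampTime n m).lipschitzOnWith
      hmaps).absolutelyContinuousOnInterval

lemma hasDerivAt_stepSol {k m : ℕ} (hk : k < m) (hB : B k * B k = -1) {t : ℝ}
    (ht : t ∈ Ioo ((k : ℝ) / n) ((k + 1 : ℕ) / (n : ℝ))) (i j : Fin 2) :
    HasDerivAt (fun t => stepSol n B z m t i j)
      (((z / 2) • (B k * stepSol n B z m t)) i j) t := by
  have hev : ∀ᶠ s in 𝓝 t, stepSol n B z m s i j =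
      ∑ l, matRot (B k) (z * ((s - k / n : ℝ) : ℂ) / 2) i l * stepSol n B z m (k / n) l j := by
    filter_upwards [Ioo_mem_nhds ht.1 ht.2] with s hs
    rw [stepSol_of_mem hk (Ioo_subset_Icc_self hs), Matrix.mul_apply]
  refine HasDerivAt.congr_of_eventuallyEq ?_ hev
  refine (HasDerivAt.fun_sum fun l _ =>
    (hasDerivAt_matRot hB z (k / n) t i l).mul_const _).congr_deriv ?_
  rw [stepSol_of_mem hk (Ioo_subset_Icc_self ht), ← Matrix.mul_assoc, Matrix.smul_apply,
    Matrix.mul_apply, Finset.smul_sum]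
  exact Finset.sum_congr rfl fun l _ => by rw [Matrix.smul_apply, smul_mul_assoc]

/-- The derivative of the fundamental matrix with respect to the spectral parameter. -/
lemma hasDerivAt_stepSol_param (m : ℕ) (hm : m ≤ n) (i j : Fin 2) :
    HasDerivAt (fun z : ℂ => stepSol n B z m 1 i j)
      (∑ k ∈ Finset.range m, 1 / (2 * n) * B k i j) 0 := by
  induction m generalizing i j with
  | zero => simpa [stepSol] using hasDerivAt_const (0 : ℂ) ((1 : Matrix (Fin 2) (Fin 2) ℂ) i j)
  | succ m ih =>
    have hn : 0 < (n : ℝ) := by exact_mod_cast (Nat.succ_pos m).trans_le hm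
    have hc : clampTime n m 1 = 1 / n := by
      refine clampTime_of_ge ((div_le_one hn).2 ?_)
      exact_mod_cast hm
    -- All factors are 1 at z = 0, so the product rule leaves only the sum of the derivatives of the
    -- factors.
    have hz : ∀ k, stepSol n B 0 k 1 = 1 := by
      intro k
      induction k with
      | zero => rfl
      | succ k ihk => simp [stepSol, ihk, matRot_zero]
    have hrot : ∀ l, HasDerivAt (fun z : ℂ => matRot (B m) (z * clampTime n m 1 / 2) i l)
        (1 / (2 * n) * B m i l) 0 := by
      intro l
      have hlin : HasDerivAt (fun z : ℂ => z * (clampTime n m 1 : ℂ) / 2) (1 / (2 * n)) 0 := by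
        refine (((hasDerivAt_id (0 : ℂ)).mul_const _).div_const 2).congr_deriv ?_
        rw [hc]
        push_cast
        ring
      refine ((hlin.ccos.mul_const ((1 : Matrix (Fin 2) (Fin 2) ℂ) i l)).add
        (hlin.csin.mul_const (B m i l))).congr_deriv ?_
      simp
    simp only [stepSol, Matrix.mul_apply]
    refine (HasDerivAt.fun_sum fun l _ => (hrot l).mul (ih (by omega) l j)).congr_deriv ?_
    simp only [hz, zero_mul, zero_div, matRot_zero, Finset.sum_add_distrib, Matrix.one_apply]
    simp [Finset.sum_range_succ, add_comm]

end StepSol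

/-! ### Step operators: regularity, integral trace and F'(0) -/

namespace DiracOp

/-- The coefficients of `D` are constant, equal to `x_k + i y_k`, on `[k / n, (k + 1) / n)`. -/
structure IsStep (D : DiracOp) (n : ℕ) (xs ys : ℕ → ℝ) : Prop where
  pos : 0 < n
  σ_eq : D.σ = 1
  x_eq : ∀ t, D.x t = xs ⌊(n : ℝ) * t⌋₊
  y_eq : ∀ t, D.y t = ys ⌊(n : ℝ) * t⌋₊
  y_pos : ∀ k < n, 0 < ys k

variable {D : DiracOp} {n : ℕ} {xs ys : ℕ → ℝ}

lemma IsStep.floor_lt (h : D.IsStep n xs ys) {t : ℝ} (ht : t ∈ Ioo 0 D.σ) :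
    ⌊(n : ℝ) * t⌋₊ < n := by
  have hn : (0 : ℝ) < n := by exact_mod_cast h.pos
  rw [h.σ_eq] at ht
  rw [Nat.floor_lt (mul_nonneg hn.le ht.1.le)]
  nlinarith [ht.2]

/-- Only the indices k < n occur on the open interval. At t = 1 the index is n, where y may vanish,
as it does for the operator of a measure. -/
lemma IsStep.regular (h : D.IsStep n xs ys) (h0 : D.u0 = ![1, 0]) (h1 : D.u1 1 = -1) :
    D.Regular where
  pos := by rw [h.σ_eq]; exact one_pos
  measurable_x := by
    rw [funext h.x_eq]
    exact measurable_from_nat.comp (Nat.measurable_floor.comp (measurable_const_mul _))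
  measurable_y := by
    rw [funext h.y_eq]
    exact measurable_from_nat.comp (Nat.measurable_floor.comp (measurable_const_mul _))
  bound := by
    have hpos : ∀ k ∈ Finset.range n, 0 ≤ |xs k| + ys k + (ys k)⁻¹ := fun k hk => by
      have := h.y_pos k (Finset.mem_range.1 hk)
      positivity
    refine ⟨∑ k ∈ Finset.range n, (|xs k| + ys k + (ys k)⁻¹), Finset.sum_nonneg hpos,
      fun t ht => ?_⟩
    have hk := h.floor_lt ht
    have hle := Finset.single_le_sum (f := fun k => |xs k| + ys k + (ys k)⁻¹) hpos
      (Finset.mem_range.2 hk)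
    rw [h.x_eq, h.y_eq]
    have hy := h.y_pos _ hk
    have hyi := inv_pos.2 hy
    have hx := abs_nonneg (xs ⌊(n : ℝ) * t⌋₊)
    exact ⟨hy, by linarith, by linarith, by linarith⟩
  u0_eq := h0
  u1_eq := h1

/-- The fundamental matrix of a step operator. -/
def stepFund (n : ℕ) (xs ys : ℕ → ℝ) (z : ℂ) : ℝ → Matrix (Fin 2) (Fin 2) ℂ :=
  stepSol n (fun k => cplxStr (xs k) (ys k)) z n

lemma IsStep.gen_eq (h : D.IsStep n xs ys) (t : ℝ) : D.gen t =
    (2 : ℂ)⁻¹ • cplxStr (xs ⌊(n : ℝ) * t⌋₊) (ys ⌊(n : ℝ) * t⌋₊) := by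
  rw [gen, cplxStr, h.x_eq, h.y_eq, smul_smul, Complex.ofReal_mul, mul_inv, Complex.ofReal_ofNat]

lemma mem_Ioo_floor {n : ℕ} (hn : 0 < n) {t : ℝ} (ht0 : 0 < t)
    (ht : t ∉ range fun k : ℕ => (k : ℝ) / n) :
    t ∈ Ioo ((⌊(n : ℝ) * t⌋₊ : ℝ) / n) ((⌊(n : ℝ) * t⌋₊ + 1 : ℕ) / (n : ℝ)) := by
  have hn : (0 : ℝ) < n := by exact_mod_cast hn
  have h1 : (⌊(n : ℝ) * t⌋₊ : ℝ) / n ≤ t := by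
    rw [div_le_iff₀' hn]
    exact Nat.floor_le (mul_nonneg hn.le ht0.le)
  refine ⟨lt_of_le_of_ne h1 fun he => ht ⟨_, he⟩, ?_⟩
  rw [lt_div_iff₀' hn]
  push_cast
  exact Nat.lt_floor_add_one _

lemma IsStep.hasDerivAt_stepFund (h : D.IsStep n xs ys) (z : ℂ) {t : ℝ} (ht : t ∈ Ioo 0 D.σ)
    (hne : t ∉ range fun k : ℕ => (k : ℝ) / n) (i j : Fin 2) :
    HasDerivAt (fun t => stepFund n xs ys z t i j)
      ((z • (D.gen t * stepFund n xs ys z t)) i j) t := by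
  have hk := h.floor_lt ht
  have h3 := mem_Ioo_floor h.pos ht.1 hne
  have h4 := hasDerivAt_stepSol (z := z) (B := fun k => cplxStr (xs k) (ys k)) hk
    (cplxStr_mul_self (h.y_pos _ hk).ne') h3 i j
  rw [h.gen_eq, Matrix.smul_mul, smul_smul, ← div_eq_mul_inv]
  exact h4

lemma IsStep.fundSol (h : D.IsStep n xs ys) (z : ℂ) : FundSol D z (stepFund n xs ys z) where
  zero := by rw [stepFund, stepSol_zero_time]
  det := fun t => det_stepSol (fun k hk => det_matRot_cplxStr (h.y_pos k hk).ne') t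
  ac := fun i j => stepSol_ac n i j _ _
  hasDerivAt := by
    have hne : ∀ᵐ t : ℝ, t ∉ range fun k : ℕ => (k : ℝ) / n :=
      (countable_range _).ae_notMem _
    filter_upwards [hne] with t ht hmem i j using h.hasDerivAt_stepFund z hmem ht i j

lemma setIntegral_floor {n : ℕ} (hn : 0 < n) (f : ℕ → ℝ) :
    ∫ t in Ioo (0 : ℝ) 1, f ⌊(n : ℝ) * t⌋₊ = ∑ k ∈ Finset.range n, f k / n := by
  have hn' : (0 : ℝ) < n := by exact_mod_cast hn
  have hkey : ∀ k : ℕ, ∀ᵐ t : ℝ, t ∈ uIoc ((k : ℝ) / n) ((k + 1 : ℕ) / (n : ℝ)) →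
      f k = f ⌊(n : ℝ) * t⌋₊ := by
    intro k
    have hne : ∀ᵐ t : ℝ, t ≠ (k + 1 : ℕ) / (n : ℝ) := by simp [ae_iff, measure_singleton]
    filter_upwards [hne] with t ht hmem
    rw [uIoc_of_le (by gcongr; simp)] at hmem
    have h1 := (div_lt_iff₀' hn').1 hmem.1
    have h2 := (lt_div_iff₀' hn').1 (lt_of_le_of_ne hmem.2 ht)
    have : ⌊(n : ℝ) * t⌋₊ = k := by
      rw [Nat.floor_eq_iff (by linarith [Nat.cast_nonneg (α := ℝ) k])]
      push_cast at h2
      exact ⟨h1.le, h2⟩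
    rw [this]
  have hi : ∀ k < n, IntervalIntegrable (fun t => f ⌊(n : ℝ) * t⌋₊) volume
      ((k : ℝ) / n) ((k + 1 : ℕ) / (n : ℝ)) := fun k _ =>
    (intervalIntegrable_const (c := f k)).congr_ae
      ((ae_restrict_iff' measurableSet_uIoc).2 (hkey k))
  have h := intervalIntegral.sum_integral_adjacent_intervals (a := fun k : ℕ => (k : ℝ) / n) hi
  rw [Nat.cast_zero, zero_div, div_self hn'.ne'] at h
  rw [← integral_Ioc_eq_integral_Ioo, ← intervalIntegral.integral_of_le zero_le_one, ← h]
  refine Finset.sum_congr rfl fun k _ => ?_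
  rw [← intervalIntegral.integral_congr_ae (hkey k), intervalIntegral.integral_const, smul_eq_mul]
  push_cast
  ring

lemma IsStep.kernel_trace (h : D.IsStep n xs ys) (h0 : D.u0 = ![1, 0]) (h1 : D.u1 1 = -1)
    {t : ℝ} (ht : t ∈ Ioo 0 D.σ) : (D.kernel t t).trace =
      (xs ⌊(n : ℝ) * t⌋₊ + D.u1 0) / (2 * ys ⌊(n : ℝ) * t⌋₊) := by
  have hy := h.y_pos _ (h.floor_lt ht)
  rw [kernel, if_neg (lt_irrefl t)]
  simp only [c, a, X, h0, Matrix.trace_fin_two, Matrix.smul_apply, Matrix.vecMulVec_apply,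
    Pi.smul_apply, smul_eq_mul, Matrix.mulVec, dotProduct, Fin.sum_univ_two]
  simp [h1, h.x_eq, h.y_eq]
  have hs : √(ys ⌊(n : ℝ) * t⌋₊) ≠ 0 := Real.sqrt_ne_zero'.2 hy
  have hs2 := Real.sq_sqrt hy.le
  field_simp
  rw [hs2]
  ring

lemma IsStep.integrable_kernel_trace (h : D.IsStep n xs ys) (h0 : D.u0 = ![1, 0])
    (h1 : D.u1 1 = -1) : Integrable (fun s => (D.kernel s s).trace) D.vol ∧
      D.intTrace = ∑ k ∈ Finset.range n, (xs k + D.u1 0) / (2 * ys k) / n := by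
  set f : ℕ → ℝ := fun k => (xs k + D.u1 0) / (2 * ys k)
  have hae : (fun s => (D.kernel s s).trace) =ᵐ[D.vol] fun t => f ⌊(n : ℝ) * t⌋₊ := by
    filter_upwards [ae_vol_mem] with t ht using h.kernel_trace h0 h1 ht
  constructor
  · refine Integrable.congr ?_ hae.symm
    have hm : Measurable fun t : ℝ => f ⌊(n : ℝ) * t⌋₊ :=
      (measurable_from_nat (f := f)).comp (Nat.measurable_floor.comp (measurable_const_mul (n : ℝ)))
    refine Integrable.of_bound hm.aestronglyMeasurable (∑ k ∈ Finset.range n, |f k|) ?_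
    filter_upwards [ae_vol_mem] with t ht
    exact Finset.single_le_sum (f := fun k => |f k|) (fun _ _ => abs_nonneg _)
      (Finset.mem_range.2 (h.floor_lt ht))
  · rw [intTrace, integral_congr_ae hae, vol, h.σ_eq, integral_Ioc_eq_integral_Ioo,
      setIntegral_floor h.pos]

/-- The integral trace is the logarithmic derivative at zero of the characteristic function. -/
lemma IsStep.hasDerivAt_charFun (h : D.IsStep n xs ys) (h0 : D.u0 = ![1, 0]) (h1 : D.u1 1 = -1) :
    HasDerivAt (fun z => D.charFun (stepFund n xs ys z)) (-(D.intTrace : ℂ)) 0 := by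
  have hd := fun i j => hasDerivAt_stepSol_param (n := n) (B := fun k => cplxStr (xs k) (ys k)) n
    le_rfl i j
  have hF : (fun z => D.charFun (stepFund n xs ys z)) = fun z =>
      stepSol n (fun k => cplxStr (xs k) (ys k)) z n 1 0 0 +
        D.u1 0 * stepSol n (fun k => cplxStr (xs k) (ys k)) z n 1 1 0 := by
    funext z
    simp [charFun, bdry, stepFund, h.σ_eq, Matrix.mulVec, dotProduct, Fin.sum_univ_two]
  rw [hF]
  refine ((hd 0 0).add ((hd 1 0).const_mul _)).congr_deriv ?_
  rw [(h.integrable_kernel_trace h0 h1).2, Finset.mul_sum, ← Finset.sum_add_distrib]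
  push_cast
  rw [← Finset.sum_neg_distrib]
  refine Finset.sum_congr rfl fun k hk => ?_
  have hy : (ys k : ℂ) ≠ 0 :=
    Complex.ofReal_ne_zero.2 (h.y_pos k (Finset.mem_range.1 hk)).ne'
  have hn : (n : ℂ) ≠ 0 := Nat.cast_ne_zero.2 h.pos.ne'
  simp [cplxStr]
  field_simp
  ring

end DiracOp

/-! ### The Dirac operator of a finitely supported measure -/

/-- For s = ±i the row [1, -(x + s y)] is a left eigenvector of the matrix, with eigenvalue s. -/
lemma matRot_row {x y : ℝ} (hy : y ≠ 0) (θ : ℂ) (v : Fin 2 → ℂ) {s : ℂ} (hs : s ^ 2 = -1) :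
    (matRot (cplxStr x y) θ *ᵥ v) 0 - (x + s * y) * (matRot (cplxStr x y) θ *ᵥ v) 1 =
      (Complex.cos θ + s * Complex.sin θ) * (v 0 - (x + s * y) * v 1) := by
  have hy' : (y : ℂ) ≠ 0 := Complex.ofReal_ne_zero.2 hy
  simp only [Matrix.mulVec, dotProduct, Fin.sum_univ_two, matRot_apply]
  simp [cplxStr]
  field_simp
  linear_combination (Complex.sin θ * y ^ 2 * v 1) * hs

namespace DiracOp

variable {D : DiracOp} {n : ℕ} {xs ys : ℕ → ℝ}

lemma regSol_stepFund_succ {k : ℕ} (hk : k < n) (z : ℂ) :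
    regSol (stepFund n xs ys z) ((k + 1 : ℕ) / (n : ℝ)) =
      matRot (cplxStr (xs k) (ys k)) (z / (2 * n)) *ᵥ
        regSol (stepFund n xs ys z) ((k : ℝ) / n) := by
  have hmem : ((k + 1 : ℕ) / (n : ℝ)) ∈ Icc ((k : ℝ) / n) ((k + 1 : ℕ) / (n : ℝ)) :=
    ⟨by gcongr; simp, le_rfl⟩
  rw [regSol, regSol, stepFund, stepSol_of_mem hk hmem, Matrix.mulVec_mulVec]
  congr 3
  push_cast
  ring

lemma FundSol.isSolution {z : ℂ} {M : ℝ → Matrix (Fin 2) (Fin 2) ℂ} (hM : FundSol D z M)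
    (hD : D.Regular) : D.IsSolution z (regSol M) := by
  refine ⟨hM.regSol_ac, ?_, hM.tau_regSol hD⟩
  rw [regSol, hM.zero, Matrix.one_mulVec, hD.u0_eq]
  ext i
  fin_cases i <;> simp [vecC]

/-- Variation of constants with zero source determines a solution on (0, σ] by its limit at 0. -/
lemma FundSol.eq_regSol {z : ℂ} {M : ℝ → Matrix (Fin 2) (Fin 2) ℂ} (hM : FundSol D z M)
    (hD : D.Regular) {G : ℝ → Fin 2 → ℂ} (hG : D.IsSolution z G) :
    ∀ t ∈ Icc 0 D.σ, G t = regSol M t := by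
  obtain ⟨hac, h0, hτ⟩ := hG
  obtain ⟨c, hc⟩ := hM.eq_varConst hD (g := 0) (integrable_zero _ _ _) (v := G)
    (fun ε hε => hac.mono (by
      rw [uIcc_of_le hε.2, uIcc_of_le hD.pos.le]; exact Icc_subset_Icc_left hε.1.le))
    (by simpa using hτ)
  have h1 := tendsto_zero_of_ac hD.pos (hM.varConst_ac hD c (integrable_zero _ _ _)) hc
  have h2 := tendsto_zero_of_ac hD.pos hac fun _ _ => rfl
  have hG0 : G 0 = ![1, 0] := by
    rw [h0, hD.u0_eq]
    ext i
    fin_cases i <;> simp [vecC]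
  have hceq := tendsto_nhds_unique h1 h2
  rw [hM.varConst_zero, hG0] at hceq
  rw [hceq, ← regSol_eq_varConst] at hc
  intro t ht
  rcases ht.1.eq_or_lt with rfl | h
  · rw [hG0, regSol, hM.zero, Matrix.one_mulVec]
  · exact hc t ⟨h, ht.2⟩

end DiracOp

section Circle

open DiracOp

variable {n : ℕ} {ζ : Fin n → ℂ} {μ : Measure ℂ}

lemma isStep_circDirac (hn : 0 < n) (hy : ∀ k < n, 0 < (verblunskyPath μ k).2) :
    (circDirac μ n).IsStep n (fun k => (verblunskyPath μ k).1) fun k => (verblunskyPath μ k).2 where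
  pos := hn
  σ_eq := rfl
  x_eq := fun _ => rfl
  y_eq := fun _ => rfl
  y_pos := hy

/-- The fundamental matrix of the discrete Dirac operator. -/
def circFund (μ : Measure ℂ) (n : ℕ) (z : ℂ) : ℝ → Matrix (Fin 2) (Fin 2) ℂ :=
  stepFund n (fun k => (verblunskyPath μ k).1) (fun k => (verblunskyPath μ k).2) z

/-- The recursion mixes ψ_k with its reversal, so both formulas are proved together. Let E =
e^{iz/(2n)}, u = E² and let W be H at time (k+1)/n. With the old point (x, y), uψ_k and the reversal
are E^(k+1) times W₀ - (x ± iy) W₁. Then the recursion gives W₀ - (x + iy + i a y) W₁ with a = w -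
iv, and x + iy + i a y is the next point of the path. -/
lemma orthoPoly_eval_exp [IsProbabilityMeasure μ] (hζ : Function.Injective ζ)
    (hsupp : μ.support = Set.range ζ) (hn : ∀ j, ‖ζ j‖ = 1) (h1 : ∀ j, ζ j ≠ 1) (z : ℂ)
    {k : ℕ} (hk : k ≤ n) :
    (orthoPoly μ k).eval (Complex.exp (z / (2 * n) * Complex.I) ^ 2) =
      Complex.exp (z / (2 * n) * Complex.I) ^ k * (regSol (circFund μ n z) (k / n) 0 -
        ((verblunskyPath μ k).1 + Complex.I * (verblunskyPath μ k).2) *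
          regSol (circFund μ n z) (k / n) 1) ∧
    (orthoDual μ k).eval (Complex.exp (z / (2 * n) * Complex.I) ^ 2) =
      Complex.exp (z / (2 * n) * Complex.I) ^ k * (regSol (circFund μ n z) (k / n) 0 -
        ((verblunskyPath μ k).1 + -Complex.I * (verblunskyPath μ k).2) *
          regSol (circFund μ n z) (k / n) 1) := by
  induction k with
  | zero =>
    have h0 := orthoPoly_eq_of_isOrthoPoly hζ hsupp hn h1 hk
      ((isOrthoPoly_iff hζ hsupp 0 1).2 ⟨by simp, by simp, by simp⟩)
    simp [h0, orthoDual, regSol, circFund, stepFund, stepSol_zero_time]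
  | succ k ih =>
    obtain ⟨ihp, ihq⟩ := ih (by omega)
    have hk' : k < n := hk
    have hy := (verblunskyPath_pos hζ hsupp hn h1 hk').ne'
    rw [(orthoPoly_succ hζ hsupp hn h1 hk').1, orthoDual]
    have hV : regSol (circFund μ n z) ((k + 1 : ℕ) / (n : ℝ)) = _ := regSol_stepFund_succ hk' z
    have hI : Complex.I ^ 2 = -1 := Complex.I_sq
    have hI' : (-Complex.I) ^ 2 = -1 := by rw [neg_sq, Complex.I_sq]
    have hP := matRot_row (x := (verblunskyPath μ k).1) hy (z / (2 * n))
      (regSol (circFund μ n z) ((k : ℝ) / n)) hI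
    have hQ := matRot_row (x := (verblunskyPath μ k).1) hy (z / (2 * n))
      (regSol (circFund μ n z) ((k : ℝ) / n)) hI'
    have hE : Complex.exp (z / (2 * n) * Complex.I) =
        Complex.cos (z / (2 * n)) + Complex.I * Complex.sin (z / (2 * n)) := by
      rw [Complex.exp_mul_I]; ring
    have hE' : Complex.exp (z / (2 * n) * Complex.I) *
        (Complex.cos (z / (2 * n)) + -Complex.I * Complex.sin (z / (2 * n))) = 1 := by
      rw [hE]
      linear_combination Complex.cos_sq_add_sin_sq (z / (2 * n)) -
        Complex.sin (z / (2 * n)) ^ 2 * Complex.I_sq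
    rw [← circFund] at hV
    rw [← hV, ← hE] at hP
    rw [← hV] at hQ
    set E := Complex.exp (z / (2 * n) * Complex.I)
    set c := Complex.cos (z / (2 * n)) + -Complex.I * Complex.sin (z / (2 * n))
    set V := regSol (circFund μ n z) ((k : ℝ) / n)
    set W := regSol (circFund μ n z) ((k + 1 : ℕ) / (n : ℝ))
    set x := (verblunskyPath μ k).1
    set y := (verblunskyPath μ k).2
    set P := V 0 - (x + Complex.I * y) * V 1
    set Q := V 0 - (x + -Complex.I * y) * V 1
    have hxs : ((verblunskyPath μ (k + 1)).1 : ℂ) = x + vCoeff μ k * y := by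
      rw [verblunskyPath]; push_cast; rfl
    have hys : ((verblunskyPath μ (k + 1)).2 : ℂ) = y * (1 + wCoeff μ k) := by
      rw [verblunskyPath]; push_cast; rfl
    have hw : wv μ k = wCoeff μ k - Complex.I * vCoeff μ k := by
      rw [wCoeff, vCoeff]
      push_cast
      linear_combination -(Complex.re_add_im (wv μ k))
    have hwc : (starRingEnd ℂ) (wv μ k) = wCoeff μ k + Complex.I * vCoeff μ k := by
      rw [hw]; simp
    -- The step divides the pairing with the conjugate row by E, which is why the reversal needs no
    -- factor u.
    have hQ2 : E ^ (k + 1) * (W 0 - (x + -Complex.I * y) * W 1) = E ^ k * Q := by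
      rw [hQ, pow_succ]
      linear_combination E ^ k * Q * hE'
    constructor
    · rw [szegoNext]
      simp only [Polynomial.eval_add, Polynomial.eval_mul, Polynomial.eval_sub, Polynomial.eval_X,
        Polynomial.eval_C, ihp, ihq]
      rw [hxs, hys, ← hQ2, hw]
      linear_combination (-(E ^ (k + 1)) * (1 + (wCoeff μ k - Complex.I * vCoeff μ k) / 2)) * hP +
        (E ^ (k + 1) * y * W 1 * vCoeff μ k) * Complex.I_sq
    · rw [szegoDualNext]
      simp only [Polynomial.eval_add, Polynomial.eval_mul, Polynomial.eval_sub, Polynomial.eval_X,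
        Polynomial.eval_C, ihp, ihq]
      rw [hxs, hys, ← hQ2, hwc]
      linear_combination (E ^ (k + 1) * (wCoeff μ k + Complex.I * vCoeff μ k) / 2) * hP +
        (E ^ (k + 1) * y * W 1 * vCoeff μ k) * Complex.I_sq

end Circle

/-! ### The sine product: its zeros, its regularized product and its derivative at 0 -/

section Final

open DiracOp

variable {n : ℕ} {lam : Fin n → ℝ}

/-- e^{2iw} - e^{2iθ} = -2i e^{i(w+θ)} sin(θ - w); divide by the case w = 0. -/
lemma exp_factor (θ w : ℂ) (h : Complex.exp (Complex.I * (2 * θ)) ≠ 1) :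
    (Complex.exp (Complex.I * (2 * w)) - Complex.exp (Complex.I * (2 * θ))) /
      (1 - Complex.exp (Complex.I * (2 * θ))) =
    Complex.exp (Complex.I * w) * (Complex.sin (θ - w) / Complex.sin θ) := by
  have hexp : ∀ s : ℂ, Complex.exp (Complex.I * (2 * s)) = Complex.exp (Complex.I * s) ^ 2 :=
    fun s => by rw [← Complex.exp_nat_mul]; congr 1; push_cast; ring
  have hsin : ∀ s : ℂ, Complex.sin s =
      (Complex.exp (Complex.I * s))⁻¹ * (1 - Complex.exp (Complex.I * s) ^ 2) * Complex.I / 2 := by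
    intro s
    have h1 : Complex.exp (s * Complex.I) = Complex.exp (Complex.I * s) := by rw [mul_comm]
    have h2 : Complex.exp (-s * Complex.I) = (Complex.exp (Complex.I * s))⁻¹ := by
      rw [← Complex.exp_neg]; congr 1; ring
    have hne := Complex.exp_ne_zero (Complex.I * s)
    rw [Complex.sin, h1, h2]
    field_simp
  have hsub : Complex.exp (Complex.I * (θ - w)) =
      Complex.exp (Complex.I * θ) / Complex.exp (Complex.I * w) := by
    rw [← Complex.exp_sub]; congr 1; ring
  rw [hexp] at h
  have h' : 1 - Complex.exp (Complex.I * θ) ^ 2 ≠ 0 := sub_ne_zero.2 h.symm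
  have hθ := Complex.exp_ne_zero (Complex.I * θ)
  have hw := Complex.exp_ne_zero (Complex.I * w)
  rw [hexp, hexp, hsin, hsin, hsub]
  have hI := Complex.I_ne_zero
  field_simp

lemma normCharPoly_eq_prod_sin (hn : 0 < n)
    (h1 : ∀ j, Complex.exp (Complex.I * (lam j : ℂ)) ≠ 1) (z : ℂ) :
    normCharPoly lam (Complex.exp (Complex.I * z / n)) * Complex.exp (-(Complex.I * z / 2)) =
      ∏ j, Complex.sin ((lam j : ℂ) / 2 - z / (2 * n)) / Complex.sin ((lam j : ℂ) / 2) := by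
  have hn' : (n : ℂ) ≠ 0 := Nat.cast_ne_zero.2 hn.ne'
  have hz : Complex.I * z / n = Complex.I * (2 * (z / (2 * n))) := by field_simp
  have hfac : ∀ j, (Complex.exp (Complex.I * z / n) - Complex.exp (Complex.I * (lam j : ℂ))) /
      (1 - Complex.exp (Complex.I * (lam j : ℂ))) = Complex.exp (Complex.I * (z / (2 * n))) *
        (Complex.sin ((lam j : ℂ) / 2 - z / (2 * n)) / Complex.sin ((lam j : ℂ) / 2)) := by
    intro j
    have hl : Complex.I * (lam j : ℂ) = Complex.I * (2 * ((lam j : ℂ) / 2)) := by ring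
    rw [hz, hl]
    exact exp_factor _ _ (hl ▸ h1 j)
  rw [normCharPoly, Finset.prod_congr rfl fun j _ => hfac j, Finset.prod_mul_distrib,
    Finset.prod_const, Finset.card_univ, Fintype.card_fin, ← Complex.exp_nat_mul, mul_right_comm,
    ← Complex.exp_add]
  -- The n phases e^{iz/(2n)} combine to e^{iz/2}.
  have : (n : ℂ) * (Complex.I * (z / (2 * n))) + -(Complex.I * z / 2) = 0 := by
    field_simp; ring
  rw [this, Complex.exp_zero, one_mul]

lemma exp_eq_one_of_eq {l : ℝ} {j : ℤ} (h : (l : ℂ) = 2 * Real.pi * j) :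
    Complex.exp (Complex.I * (l : ℂ)) = 1 := by
  rw [h]
  exact Complex.exp_eq_one_iff.2 ⟨j, by ring⟩

lemma sin_half_ne_zero {l : ℝ} (h : Complex.exp (Complex.I * (l : ℂ)) ≠ 1) :
    Complex.sin ((l : ℂ) / 2) ≠ 0 := by
  intro h0
  obtain ⟨j, hj⟩ := Complex.sin_eq_zero_iff.1 h0
  exact h (exp_eq_one_of_eq (j := j) (by linear_combination 2 * hj))

lemma mem_integerComplement_of_exp {l : ℝ} (h : Complex.exp (Complex.I * (l : ℂ)) ≠ 1) :
    ((l / (2 * Real.pi) : ℝ) : ℂ) ∈ Complex.integerComplement := by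
  rw [Complex.mem_integerComplement_iff]
  rintro ⟨j, hj⟩
  refine h (exp_eq_one_of_eq (j := j) ?_)
  have hpi : (Real.pi : ℂ) ≠ 0 := Complex.ofReal_ne_zero.2 Real.pi_ne_zero
  rw [hj]
  push_cast
  field_simp

/-- The points `n λ_k + 2 π n j`. -/
def latticePt (lam : Fin n → ℝ) (p : Fin n × ℤ) : ℂ :=
  n * (lam p.1 : ℂ) + 2 * Real.pi * n * p.2

/-- The enumeration of the zeros must be free of repetitions, because each eigenvalue contributes
exactly one factor to det₂. -/
lemma latticePt_injective (hn : 0 < n)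
    (hlam : Function.Injective fun j => Complex.exp (Complex.I * (lam j : ℂ))) :
    Function.Injective (latticePt lam) := by
  have hn' : (n : ℂ) ≠ 0 := Nat.cast_ne_zero.2 hn.ne'
  have hpi : (Real.pi : ℂ) ≠ 0 := Complex.ofReal_ne_zero.2 Real.pi_ne_zero
  rintro ⟨k, j⟩ ⟨k', j'⟩ h
  simp only [latticePt] at h
  have h2 : (lam k : ℂ) + 2 * Real.pi * j = lam k' + 2 * Real.pi * j' := by
    apply mul_left_cancel₀ hn'
    linear_combination h
  have hk : k = k' := by
    apply hlam
    simp only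
    refine Complex.exp_eq_exp_iff_exists_int.2 ⟨j' - j, ?_⟩
    push_cast
    linear_combination Complex.I * h2
  subst hk
  have h3 : (j : ℂ) = j' := by
    apply mul_left_cancel₀ (mul_ne_zero two_ne_zero hpi)
    linear_combination h2
  rw [Int.cast_injective h3]

lemma latticePt_ne_zero (hn : 0 < n) (h1 : ∀ j, Complex.exp (Complex.I * (lam j : ℂ)) ≠ 1)
    (p : Fin n × ℤ) : latticePt lam p ≠ 0 := by
  have hn' : (n : ℂ) ≠ 0 := Nat.cast_ne_zero.2 hn.ne'
  intro h
  rw [latticePt] at h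
  refine h1 p.1 (exp_eq_one_of_eq (j := -p.2) ?_)
  apply mul_left_cancel₀ hn'
  push_cast
  linear_combination h

lemma prod_sin_eq_zero_iff (hn : 0 < n) (h1 : ∀ j, Complex.exp (Complex.I * (lam j : ℂ)) ≠ 1)
    (z : ℂ) : ∏ j, Complex.sin ((lam j : ℂ) / 2 - z / (2 * n)) / Complex.sin ((lam j : ℂ) / 2) = 0 ↔
      z ∈ range (latticePt lam) := by
  have hn' : (n : ℂ) ≠ 0 := Nat.cast_ne_zero.2 hn.ne'
  simp only [Finset.prod_eq_zero_iff, Finset.mem_univ, true_and, div_eq_zero_iff,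
    sin_half_ne_zero (h1 _), or_false, Complex.sin_eq_zero_iff]
  have key : ∀ (k : Fin n) (j : ℤ), (lam k : ℂ) / 2 - z / (2 * n) = j * Real.pi ↔
      latticePt lam (k, -j) = z := by
    intro k j
    rw [latticePt]
    push_cast
    constructor
    · intro h
      field_simp at h
      linear_combination h
    · intro h
      field_simp
      linear_combination h
  constructor
  · rintro ⟨k, j, h⟩
    exact ⟨_, (key k j).1 h⟩
  · rintro ⟨⟨k, j⟩, h⟩
    exact ⟨k, -j, (key k (-j)).2 (by rwa [neg_neg])⟩

/-- Dividing by 2πn turns the zeros with fixed k into λ_k/(2π) + ℤ, the form needed for the sine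
product. -/
lemma div_latticePt (hn : 0 < n) (z : ℂ) (p : Fin n × ℤ) : z * (latticePt lam p)⁻¹ =
    z / (2 * Real.pi * n) / (((lam p.1 / (2 * Real.pi) : ℝ) : ℂ) + p.2) := by
  have hn' : (n : ℂ) ≠ 0 := Nat.cast_ne_zero.2 hn.ne'
  have hpi : (Real.pi : ℂ) ≠ 0 := Complex.ofReal_ne_zero.2 Real.pi_ne_zero
  rw [div_div, div_eq_mul_inv]
  congr 2
  rw [latticePt]
  push_cast
  field_simp

lemma multipliable_latticePt (hn : 0 < n) (z : ℂ) : Multipliable fun p : Fin n × ℤ =>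
    (1 - z * (latticePt lam p)⁻¹) * Complex.exp (z * (latticePt lam p)⁻¹) := by
  refine multipliable_one_sub_mul_exp ?_
  have h0 : 0 ≤ fun p : Fin n × ℤ => ‖z * (latticePt lam p)⁻¹‖ ^ 2 := fun _ => sq_nonneg _
  refine (summable_prod_of_nonneg h0).2 ⟨fun k => ?_, Summable.of_finite⟩
  simp only [div_latticePt hn]
  exact summable_sq_div_add_int _ _

/-- Absolute convergence lets the product be taken over j first; each k then contributes a
regularized sine product at x = λ_k/(2π), w = z/(2πn). -/
lemma tprod_latticePt (hn : 0 < n) (h1 : ∀ j, Complex.exp (Complex.I * (lam j : ℂ)) ≠ 1) (z : ℂ) :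
    ∏' p : Fin n × ℤ, (1 - z * (latticePt lam p)⁻¹) * Complex.exp (z * (latticePt lam p)⁻¹) =
      (∏ j, Complex.sin ((lam j : ℂ) / 2 - z / (2 * n)) / Complex.sin ((lam j : ℂ) / 2)) *
        Complex.exp (z * ∑ j, Complex.cot ((lam j : ℂ) / 2) / (2 * n)) := by
  have hn' : (n : ℂ) ≠ 0 := Nat.cast_ne_zero.2 hn.ne'
  have hpi : (Real.pi : ℂ) ≠ 0 := Complex.ofReal_ne_zero.2 Real.pi_ne_zero
  have hfib : ∀ k : Fin n, Multipliable fun j : ℤ =>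
      (1 - z * (latticePt lam (k, j))⁻¹) * Complex.exp (z * (latticePt lam (k, j))⁻¹) := by
    intro k
    simp only [div_latticePt hn]
    exact multipliable_one_sub_mul_exp (summable_sq_div_add_int _ _)
  refine ((multipliable_latticePt hn z).tprod_prod' hfib).trans ?_
  rw [tprod_fintype, Finset.mul_sum, Complex.exp_sum, ← Finset.prod_mul_distrib]
  refine Finset.prod_congr rfl fun k _ => ?_
  simp only [div_latticePt hn]
  rw [tprod_sin (mem_integerComplement_of_exp (h1 k))]
  have e1 : (Real.pi : ℂ) * ((lam k / (2 * Real.pi) : ℝ) : ℂ) = (lam k : ℂ) / 2 := by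
    push_cast; field_simp
  have e2 : (Real.pi : ℂ) * (((lam k / (2 * Real.pi) : ℝ) : ℂ) - z / (2 * Real.pi * n)) =
      (lam k : ℂ) / 2 - z / (2 * n) := by
    push_cast; field_simp
  rw [e1, e2]
  congr 2
  field_simp

lemma hasDerivAt_prod_sin (h1 : ∀ j, Complex.exp (Complex.I * (lam j : ℂ)) ≠ 1) :
    HasDerivAt (fun z : ℂ =>
      ∏ j, Complex.sin ((lam j : ℂ) / 2 - z / (2 * n)) / Complex.sin ((lam j : ℂ) / 2))
      (-∑ j, Complex.cot ((lam j : ℂ) / 2) / (2 * n)) 0 := by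
  have hj : ∀ j ∈ Finset.univ, HasDerivAt (fun z : ℂ =>
      Complex.sin ((lam j : ℂ) / 2 - z / (2 * n)) / Complex.sin ((lam j : ℂ) / 2))
      (-(Complex.cot ((lam j : ℂ) / 2) / (2 * n))) 0 := by
    intro j _
    have hlin : HasDerivAt (fun z : ℂ => (lam j : ℂ) / 2 - z / (2 * n)) (-(1 / (2 * n))) 0 :=
      ((hasDerivAt_id (0 : ℂ)).div_const _).const_sub _
    refine (hlin.csin.div_const _).congr_deriv ?_
    rw [zero_div, sub_zero, Complex.cot]
    ring
  refine (HasDerivAt.fun_finsetProd hj).congr_deriv ?_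
  rw [← Finset.sum_neg_distrib]
  refine Finset.sum_congr rfl fun j _ => ?_
  -- Every factor equals 1 at z = 0, so the logarithmic and the ordinary derivative agree.
  rw [Finset.prod_eq_one fun i _ => ?_, one_smul]
  rw [zero_div, sub_zero, div_self (sin_half_ne_zero (h1 i))]

end Final

end

/-! ### Assembly of the main theorem -/

theorem mainTheorem12 (n : ℕ) (lam : Fin n → ℝ) (μ : Measure ℂ) [IsProbabilityMeasure μ]
    (hlam : Function.Injective (fun j => Complex.exp (Complex.I * (lam j : ℂ))))
    (hsupp : μ.support = Set.range (fun j => Complex.exp (Complex.I * (lam j : ℂ))))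
    (h1 : μ {1} = 0) :
    -- the objects are well defined
    (∀ k ≤ n, IsOrthoPoly μ k (orthoPoly μ k) ∧
      ∀ p, IsOrthoPoly μ k p → p = orthoPoly μ k) ∧
    (∀ k < n, modVerblunsky μ k ≠ 1 ∧
      2 * modVerblunsky μ k / (1 - modVerblunsky μ k) = wv μ k) ∧
    (∀ k < n, 0 < (verblunskyPath μ k).2) ∧ (verblunskyPath μ n).2 = 0 ∧
    (circDirac μ n).SecularDefined ∧
    -- the solution `H` and the orthogonal polynomials
    (∃ H : ℝ → ℂ → Fin 2 → ℂ,
      (∀ z, (circDirac μ n).IsSolution z (fun t => H t z)) ∧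
      (∀ z G, (circDirac μ n).IsSolution z G → ∀ t ∈ Icc (0 : ℝ) 1, G t = H t z) ∧
      (∀ k ≤ n, ∀ z : ℂ,
        (orthoPoly μ k).eval (Complex.exp (Complex.I * z / n)) =
          Complex.exp (Complex.I * z * k / (2 * n)) *
            (![1, -(((verblunskyPath μ k).1 : ℂ) + Complex.I * ((verblunskyPath μ k).2 : ℂ))] ⬝ᵥ
              H ((k : ℝ) / n) z)) ∧
      (∀ z : ℂ,
        normCharPoly lam (Complex.exp (Complex.I * z / n)) =
            (orthoPoly μ n).eval (Complex.exp (Complex.I * z / n)) ∧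
        (orthoPoly μ n).eval (Complex.exp (Complex.I * z / n)) =
          Complex.exp (Complex.I * z / 2) * (![1, -((verblunskyPath μ n).1 : ℂ)] ⬝ᵥ H 1 z))) ∧
    -- the secular function
    (∀ z : ℂ, (circDirac μ n).secular z =
      normCharPoly lam (Complex.exp (Complex.I * z / n)) * Complex.exp (-(Complex.I * z / 2))) ∧
    -- the spectrum
    ((circDirac μ n).spec =
        {z : ℂ | ∃ (k : Fin n) (j : ℤ), z = n * (lam k : ℂ) + 2 * Real.pi * n * j} ∧
      {z : ℂ | (circDirac μ n).IsEigenvalue z} = (circDirac μ n).spec) ∧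
    -- the product formula
    (∀ z : ℂ, (circDirac μ n).secular z =
      ∏ j, Complex.sin ((lam j : ℂ) / 2 - z / (2 * n)) / Complex.sin ((lam j : ℂ) / 2)) := by
  set ζ : Fin n → ℂ := fun j => Complex.exp (Complex.I * (lam j : ℂ)) with hζdef
  have hnorm : ∀ j, ‖ζ j‖ = 1 := fun j => by
    rw [hζdef]
    simp only [mul_comm Complex.I]
    exact Complex.norm_exp_ofReal_mul_I _
  -- Each ζ_j is an atom of positive mass, whereas {1} is null.
  have hone : ∀ j, ζ j ≠ 1 := fun j h => by
    have hpos := measure_singleton_pos_of_support hsupp j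
    rw [h, Measure.real, h1] at hpos
    simp at hpos
  have hn : 0 < n := pos_of_support hsupp
  have hn' : (n : ℂ) ≠ 0 := Nat.cast_ne_zero.2 hn.ne'
  have hy : ∀ k < n, 0 < (verblunskyPath μ k).2 := fun k hk =>
    verblunskyPath_pos hlam hsupp hnorm hone hk
  have hy0 := verblunskyPath_top hlam hsupp hnorm hone
  have hstep := isStep_circDirac hn hy
  have hu0 : (circDirac μ n).u0 = ![1, 0] := rfl
  have hu1 : (circDirac μ n).u1 1 = -1 := rfl
  have hD := hstep.regular hu0 hu1
  have hM : ∀ z, (circDirac μ n).FundSol z (circFund μ n z) := hstep.fundSol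
  have hev := fun z (k : ℕ) (hk : k ≤ n) => orthoPoly_eval_exp hlam hsupp hnorm hone z hk
  have hE2 : ∀ z : ℂ, Complex.exp (z / (2 * n) * Complex.I) ^ 2 = Complex.exp (Complex.I * z / n) :=
    fun z => by
      rw [← Complex.exp_nat_mul]
      congr 1
      push_cast
      field_simp
  have hEk : ∀ (z : ℂ) (k : ℕ), Complex.exp (z / (2 * n) * Complex.I) ^ k =
      Complex.exp (Complex.I * z * k / (2 * n)) := fun z k => by
    rw [← Complex.exp_nat_mul]
    congr 1
    ring
  have hEn : ∀ z : ℂ, Complex.exp (Complex.I * z * n / (2 * n)) = Complex.exp (Complex.I * z / 2) :=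
    fun z => by
      congr 1
      field_simp
  have hpn : ∀ z : ℂ, normCharPoly lam (Complex.exp (Complex.I * z / n)) =
      (orthoPoly μ n).eval (Complex.exp (Complex.I * z / n)) := fun z =>
    (orthoPoly_eval_top hlam hsupp hnorm hone _).symm
  have hpH : ∀ z : ℂ, (orthoPoly μ n).eval (Complex.exp (Complex.I * z / n)) =
      Complex.exp (Complex.I * z / 2) *
        (![1, -((verblunskyPath μ n).1 : ℂ)] ⬝ᵥ DiracOp.regSol (circFund μ n z) 1) := by
    intro z
    have h := (hev z n le_rfl).1
    rw [hE2, hEk, hEn, hy0, div_self (Nat.cast_ne_zero.2 hn.ne')] at h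
    rw [h]
    simp only [dotProduct, Fin.sum_univ_two, Matrix.cons_val_zero, Matrix.cons_val_one]
    push_cast
    ring
  -- As y_n = 0, the row of index n is [1, -x_n], which is the boundary form given by u₁.
  have hchar : ∀ z, (circDirac μ n).charFun (circFund μ n z) =
      ∏ j, Complex.sin ((lam j : ℂ) / 2 - z / (2 * n)) / Complex.sin ((lam j : ℂ) / 2) := by
    intro z
    rw [← normCharPoly_eq_prod_sin hn hone, hpn, hpH, mul_right_comm, ← Complex.exp_add,
      add_neg_cancel, Complex.exp_zero, one_mul]
    simp [DiracOp.charFun, DiracOp.bdry, DiracOp.regSol, circDirac, dotProduct, Fin.sum_univ_two]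
  have hzero : ∀ z, (circDirac μ n).charFun (circFund μ n z) = 0 ↔ z ∈ range (latticePt lam) :=
    fun z => by rw [hchar, prod_sin_eq_zero_iff hn hone]
  have hinj : Function.Injective fun p => (latticePt lam p)⁻¹ :=
    inv_injective.comp (latticePt_injective hn hlam)
  have hfac := fun z => DiracOp.detTwoFactor_comp hD hM (latticePt_ne_zero hn hone) hzero z
  have hcomp : ∀ z, (detTwoFactor (circDirac μ n).resEnd z ∘ fun p => (latticePt lam p)⁻¹) =
      fun p => (1 - z * (latticePt lam p)⁻¹) * Complex.exp (z * (latticePt lam p)⁻¹) :=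
    fun z => funext (hfac z).2
  -- The derivative of the characteristic function at 0, computed from the steps and from the sines,
  -- must agree.
  have htrace : ((circDirac μ n).intTrace : ℂ) = ∑ j, Complex.cot ((lam j : ℂ) / 2) / (2 * n) := by
    have hd1 := hstep.hasDerivAt_charFun hu0 hu1
    have hd2 := hasDerivAt_prod_sin (n := n) hone
    have heq : (fun z => (circDirac μ n).charFun (circFund μ n z)) = _ := funext hchar
    rw [← heq] at hd2
    exact neg_injective (hd1.unique hd2)
  have hsec : ∀ z : ℂ, (circDirac μ n).secular z =
      ∏ j, Complex.sin ((lam j : ℂ) / 2 - z / (2 * n)) / Complex.sin ((lam j : ℂ) / 2) := by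
    intro z
    have hdet : detTwo (circDirac μ n).resEnd z = ∏' p, (1 - z * (latticePt lam p)⁻¹) *
        Complex.exp (z * (latticePt lam p)⁻¹) := by
      rw [← hcomp z, detTwo]
      -- The product over all ν reduces to the inverses of the zeros, since all other factors are 1.
      refine (hinj.tprod_eq fun ν hν => ?_).symm
      by_contra h
      exact hν ((hfac z).1 ν h)
    rw [DiracOp.secular, hdet, tprod_latticePt hn hone, htrace, mul_left_comm, ← Complex.exp_add, neg_mul,
      neg_add_cancel, Complex.exp_zero, mul_one]
  have hspec : (circDirac μ n).spec = range (latticePt lam) := by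
    ext z
    rw [DiracOp.spec, mem_ofPred_eq, (hM z).inResolventSet_iff hD, not_not, hzero]
  refine ⟨fun k hk => ⟨isOrthoPoly_orthoPoly hlam hsupp hnorm hone hk, fun p hp =>
      (orthoPoly_eq_of_isOrthoPoly hlam hsupp hnorm hone hk hp).symm⟩,
    fun k hk => modVerblunsky_spec hlam hsupp hnorm hone hk, hy, hy0,
    ⟨DiracOp.isInverse_res hD, (hstep.integrable_kernel_trace hu0 hu1).1, fun z => ?_⟩,
    ⟨fun t z => DiracOp.regSol (circFund μ n z) t, fun z => (hM z).isSolution hD,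
      fun z G hG => (hM z).eq_regSol hD hG, fun k hk z => ?_, fun z => ⟨hpn z, hpH z⟩⟩,
    fun z => ?_, ⟨?_, ?_⟩, hsec⟩
  · rw [← hinj.multipliable_iff (hfac z).1, hcomp z]
    exact multipliable_latticePt hn z
  · have h := (hev z k hk).1
    rw [hE2, hEk] at h
    rw [h]
    simp only [dotProduct, Fin.sum_univ_two, Matrix.cons_val_zero, Matrix.cons_val_one]
    ring
  · rw [hsec, normCharPoly_eq_prod_sin hn hone]
  · rw [hspec]
    ext z
    simp only [latticePt, mem_range, Prod.exists, mem_ofPred_eq, eq_comm]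
  · rw [hspec]
    ext z
    rw [mem_ofPred_eq, (hM z).isEigenvalue_iff hD, hzero]
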